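/- Fix $1\le d_\beta\le d_g$ and let $P$ be a probability distribution of an observation $\mathcal D=(x,z,y)\in\mathbb R^{d_\beta}\times\mathbb R^{d_g}\times\mathbb R$. Let $\mathcal D_i=(x_i,z_i,y_i)$, $i\ge 1$ (the main sample, of which the first $n$ are used at sample size $n$) and $\mathcal D_{0j}=(x_{0j},z_{0j},y_{0j})$, $j=1,\dots,n_0$ (the initialization sample, $n_0\ge1$ fixed) be jointly independent with common law $P$. Write $G_i=z_ix_i'$, $g_i(\beta)=z_i(x_i'\beta-y_i)$, $G=\mathbb E[G_i]$ and, for the $\beta_*$ below, $\Omega=\operatorname{var}(g_i(\beta_*))$. Let $A^\dagger$ denote the Moore–Penrose inverse, $\lambda_{\min}$ the smallest eigenvalue, and $\|\cdot\|$ the Euclidean norm of vectors and the $\ell^2$-operator norm of matrices. Algorithm. Let $\gamma_i=\gamma_0 i^{-a}$. Let $\beta_0$ be a $\sigma(\mathcal D_{01},\dots,\mathcal D_{0n_0})$-measurable initial estimate, $\bar\beta_0=\beta_0$, $\Phi_0=\frac1{n_0}\sum_j z_{0j}x_{0j}'$ and, for a fixed $\eta_0\ge0$, $W_0=\big(\frac1{n_0}\sum_j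 z_{0j}z_{0j}'+\eta_0I\big)^{-1}$, where the matrix in parentheses is assumed to be almost surely invertible (which is automatic if $\eta_0>0$). For vectors $v_i\in\mathbb R^{d_g}$ consider the recursion, for $i\ge1$, $$\beta_i=\beta_{i-1}-\gamma_i(\Phi_{i-1}'W_{i-1}\Phi_{i-1})^{\dagger}\Phi_{i-1}'W_{i-1}g_i(\beta_{i-1}),\qquad \Phi_i=\tfrac{n_0+i-1}{n_0+i}\Phi_{i-1}+\tfrac1{n_0+i}G_i,$$ $$m_i=n_0+i-1+v_i'W_{i-1}v_i,\qquad W_i=\tfrac{n_0+i}{n_0+i-1}W_{i-1}\big[I-m_i^{-1}v_iv_i'W_{i-1}\big],\qquad \bar\beta_i=\tfrac{i-1}i\bar\beta_{i-1}+\tfrac1i\beta_i .$$ Given a sample size $n$ and a warm-up length $n_1=n_1(n)$, the efficient SGMM algorithm runs this recursion with $v_i=z_i$ for $i\le n_1$, which yields $\bar\beta_{n_1}$, and continues it with $v_i=g_i(\bar\beta_{n_1})$ for $n_1<i\le n$. Its output is $\beta_n$ and $\bar\beta_n$. Theorem. Assume: (i) $\mathbb E\|z_i\|^2<\infty$, $\lambda_{\min}(G'G)>0$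 and $\lambda_{\min}(\mathbb E[z_iz_i'])>0$; (ii) $\beta_*$ is the unique solution of $\mathbb E[g_i(\beta)]=0$; (iii) $\gamma_0>0$ and $a\in(1/2,1)$; (iv) $\mathbb E\|G_i\|^2<\infty$ and $\mathbb E\|g_i(\beta_*)\|^2<\infty$; (v) $n_1\to\infty$ and $n_1/n\to0$ as $n\to\infty$, $\mathbb E\|\beta_0\|^2<\infty$, and $\inf_{\beta\in\mathcal K}\lambda_{\min}(\mathbb E[g_i(\beta)g_i(\beta)'])>0$ for some compact set $\mathcal K$ containing $\beta_*$ in its interior. Then $\Omega$ and $G'\Omega^{-1}G$ are positive definite and, as $n\to\infty$, $\beta_n\to\beta_*$ and $\bar\beta_n\to\beta_*$ in probability, and $$\sqrt n\,(\bar\beta_n-\beta_*)\ \xrightarrow{d}\ N\big(0,(G'\Omega^{-1}G)^{-1}\big).$$ -/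

import Mathlib

open MeasureTheory ProbabilityTheory Filter Topology

noncomputable section

namespace SGMM

/-! ### Matrix preliminaries -/

/-- The four Penrose equations: `B` is a Moore–Penrose generalized inverse of the real matrix
`A`. -/
structure IsMoorePenrose {p q : ℕ} (A : Matrix (Fin p) (Fin q) ℝ)
    (B : Matrix (Fin q) (Fin p) ℝ) : Prop where
  mul_mul_self : A * B * A = A
  mul_mul_inv : B * A * B = B
  symm_left : (A * B).transpose = A * B
  symm_right : (B * A).transpose = B * A

theorem IsMoorePenrose.unique {p q : ℕ} {A : Matrix (Fin p) (Fin q) ℝ}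
    {B C : Matrix (Fin q) (Fin p) ℝ} (hB : IsMoorePenrose A B) (hC : IsMoorePenrose A C) :
    B = C := by
  have h1 : A * B = A * C := by
    calc A * B = (A * C) * (A * B) := by
            rw [← Matrix.mul_assoc, hC.mul_mul_self]
      _ = (A * C).transpose * (A * B).transpose := by rw [hC.symm_left, hB.symm_left]
      _ = ((A * B) * (A * C)).transpose := by rw [Matrix.transpose_mul (A * B)]
      _ = (A * C).transpose := by rw [← Matrix.mul_assoc, hB.mul_mul_self]
      _ = A * C := hC.symm_left
  have h2 : B * A = C * A := by
    calc B * A = (B * A) * (C * A) := by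
            rw [Matrix.mul_assoc B A, ← Matrix.mul_assoc A C A, hC.mul_mul_self]
      _ = (B * A).transpose * (C * A).transpose := by rw [hC.symm_right, hB.symm_right]
      _ = ((C * A) * (B * A)).transpose := by rw [Matrix.transpose_mul (C * A)]
      _ = (C * A).transpose := by
            rw [Matrix.mul_assoc C A, ← Matrix.mul_assoc A B A, hB.mul_mul_self]
      _ = C * A := hC.symm_right
  calc B = B * A * B := hB.mul_mul_inv.symm
    _ = C * (A * B) := by rw [h2, Matrix.mul_assoc]
    _ = C * A * C := by rw [h1, Matrix.mul_assoc]
    _ = C := hC.mul_mul_inv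

/-- Every real matrix has a Moore–Penrose inverse. -/
theorem exists_isMoorePenrose {p q : ℕ} (A : Matrix (Fin p) (Fin q) ℝ) :
    ∃ B, IsMoorePenrose A B := by
  classical
  have hH : (A.transpose * A).IsHermitian := by
    simpa using Matrix.isHermitian_conjTranspose_mul_self A
  obtain ⟨U, D, hU, hU', hD⟩ : ∃ (U : Matrix (Fin q) (Fin q) ℝ) (D : Fin q → ℝ),
      U.transpose * U = 1 ∧ U * U.transpose = 1 ∧
      A.transpose * A = U * Matrix.diagonal D * U.transpose := by
    refine ⟨hH.eigenvectorUnitary, hH.eigenvalues, ?_, ?_, ?_⟩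
    · simpa [Matrix.star_eq_conjTranspose] using Unitary.coe_star_mul_self hH.eigenvectorUnitary
    · simpa [Matrix.star_eq_conjTranspose] using Unitary.coe_mul_star_self hH.eigenvectorUnitary
    · have := hH.spectral_theorem
      rw [Unitary.conjStarAlgAut_apply] at this
      simpa [Matrix.star_eq_conjTranspose, Function.comp_def] using this
  set E : Matrix (Fin q) (Fin q) ℝ := Matrix.diagonal fun i => (D i)⁻¹ with hE
  set K : Matrix (Fin q) (Fin q) ℝ := U * E * U.transpose with hK
  set H : Matrix (Fin q) (Fin q) ℝ := A.transpose * A with hHdef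
  have conj : ∀ X Y : Matrix (Fin q) (Fin q) ℝ,
      (U * X * U.transpose) * (U * Y * U.transpose) = U * (X * Y) * U.transpose := by
    intro X Y
    calc (U * X * U.transpose) * (U * Y * U.transpose)
        = U * X * (U.transpose * U) * Y * U.transpose := by simp only [Matrix.mul_assoc]
      _ = U * (X * Y) * U.transpose := by rw [hU, Matrix.mul_one]; simp only [Matrix.mul_assoc]
  have hKt : K.transpose = K := by
    simp [hK, hE, Matrix.transpose_mul, Matrix.mul_assoc]
  have hHt : H.transpose = H := by simp [hHdef, Matrix.transpose_mul]
  have hKH : K * H = H * K := by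
    rw [hD, hK, conj, conj, hE, Matrix.diagonal_mul_diagonal, Matrix.diagonal_mul_diagonal]
    simp only [mul_comm]
  have hHKH : H * K * H = H := by
    rw [hD, hK, conj, conj, hE, Matrix.diagonal_mul_diagonal, Matrix.diagonal_mul_diagonal]
    congr 3
    funext i
    exact mul_inv_mul_cancel (D i)
  have hKHK : K * H * K = K := by
    rw [hD, hK, conj, conj, hE, Matrix.diagonal_mul_diagonal, Matrix.diagonal_mul_diagonal]
    congr 3
    funext i
    by_cases h : D i = 0 <;> simp [h]
  have hAKH : A * K * H = A := by
    have h0 : (A * K * H - A).transpose * (A * K * H - A) = 0 := by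
      have ht : (A * K * H - A).transpose = H * K * A.transpose - A.transpose := by
        rw [Matrix.transpose_sub, Matrix.transpose_mul (A * K) H, Matrix.transpose_mul A K, hKt,
          hHt]
        simp only [hHdef, Matrix.mul_assoc]
      have e : (H * K * A.transpose - A.transpose) * (A * K * H - A)
          = H * K * H * K * H - H * K * H - H * K * H + H := by
        simp only [hHdef, Matrix.sub_mul, Matrix.mul_sub, Matrix.mul_assoc]
        abel
      rw [ht, e, hHKH, hHKH]
      abel
    have h1 : A * K * H - A = 0 := by
      rw [← Matrix.conjTranspose_mul_self_eq_zero]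
      simpa using h0
    exact sub_eq_zero.mp h1
  refine ⟨K * A.transpose, ?_, ?_, ?_, ?_⟩
  · calc A * (K * A.transpose) * A = A * K * H := by simp only [hHdef, Matrix.mul_assoc]
      _ = A := hAKH
  · calc K * A.transpose * A * (K * A.transpose) = K * H * K * A.transpose := by
          simp only [hHdef, Matrix.mul_assoc]
      _ = K * A.transpose := by rw [hKHK]
  · simp [Matrix.transpose_mul, hKt, Matrix.mul_assoc]
  · show (K * A.transpose * A).transpose = K * A.transpose * A
    calc (K * A.transpose * A).transpose = (K * H).transpose := by
          rw [hHdef, Matrix.mul_assoc]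
      _ = H * K := by
          rw [Matrix.transpose_mul K H, hKt, hHt]
      _ = K * A.transpose * A := by rw [← hKH]; simp only [hHdef, Matrix.mul_assoc]

/-- The Moore–Penrose inverse `A†`. -/
def pinv {p q : ℕ} (A : Matrix (Fin p) (Fin q) ℝ) : Matrix (Fin q) (Fin p) ℝ :=
  (exists_isMoorePenrose A).choose

theorem pinv_spec {p q : ℕ} (A : Matrix (Fin p) (Fin q) ℝ) : IsMoorePenrose A (pinv A) :=
  (exists_isMoorePenrose A).choose_spec

/-- The smallest eigenvalue of a (symmetric) real matrix. -/
def lambdaMin {p : ℕ} (A : Matrix (Fin p) (Fin p) ℝ) : ℝ := sInf (spectrum ℝ A)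

/-- The `ℓ²`-operator norm of a real matrix. -/
def opNorm {p q : ℕ} (A : Matrix (Fin p) (Fin q) ℝ) : ℝ :=
  ‖LinearMap.toContinuousLinearMap (Matrix.toLpLin 2 2 A)‖

/-! ### The linear instrumental variable model -/

/-- An observation `(x, z, y)`: regressors, instruments, outcome. -/
abbrev Obs (dβ dg : ℕ) : Type :=
  EuclideanSpace ℝ (Fin dβ) × EuclideanSpace ℝ (Fin dg) × ℝ

variable {dβ dg : ℕ}

/-- The regressors `x` of an observation. -/
abbrev Obs.x (d : Obs dβ dg) : EuclideanSpace ℝ (Fin dβ) := d.1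

/-- The instruments `z` of an observation. -/
abbrev Obs.z (d : Obs dβ dg) : EuclideanSpace ℝ (Fin dg) := d.2.1

/-- The outcome `y` of an observation. -/
abbrev Obs.y (d : Obs dβ dg) : ℝ := d.2.2

/-- `G_i = z_i x_i'`. -/
def Gmat (d : Obs dβ dg) : Matrix (Fin dg) (Fin dβ) ℝ :=
  Matrix.vecMulVec (Obs.z d).ofLp (Obs.x d).ofLp

/-- The moment function `g_i(β) = z_i (x_i'β - y_i)`. -/
def g (β : EuclideanSpace ℝ (Fin dβ)) (d : Obs dβ dg) : EuclideanSpace ℝ (Fin dg) :=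
  (inner ℝ (Obs.x d) β - Obs.y d) • Obs.z d

/-- Entrywise expectation of a matrix-valued function of an observation with law `P`. -/
def meanMat {p q : ℕ} (P : Measure (Obs dβ dg))
    (M : Obs dβ dg → Matrix (Fin p) (Fin q) ℝ) : Matrix (Fin p) (Fin q) ℝ :=
  Matrix.of fun k l => ∫ d, M d k l ∂P

/-- The outer product `v v'`. -/
def outer {p : ℕ} (v : EuclideanSpace ℝ (Fin p)) : Matrix (Fin p) (Fin p) ℝ :=
  Matrix.vecMulVec v.ofLp v.ofLp

/-- The population matrix `G = E[z_i x_i']`. -/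
def Gpop (P : Measure (Obs dβ dg)) : Matrix (Fin dg) (Fin dβ) ℝ := meanMat P Gmat

/-- The covariance matrix `var(g_i(β))`; at the true parameter it is `Ω`. -/
def varg (P : Measure (Obs dβ dg)) (β : EuclideanSpace ℝ (Fin dβ)) :
    Matrix (Fin dg) (Fin dg) ℝ :=
  Matrix.of fun k l => cov[fun d => g β d k, fun d => g β d l; P]

/-! ### The algorithm -/

/-- The quantities `(β_i, Φ_i, W_i, β̄_i)` carried by the algorithm. -/
structure State (dβ dg : ℕ) where
  β : EuclideanSpace ℝ (Fin dβ)
  Φ : Matrix (Fin dg) (Fin dβ) ℝ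
  W : Matrix (Fin dg) (Fin dg) ℝ
  βbar : EuclideanSpace ℝ (Fin dβ)

/-- One update, from time `i - 1` to time `i ≥ 1`, on observation `d = D_i`, where `v` is the
vector whose outer product is averaged by the inverse weighting matrix, `γi` is the learning rate
`γ_i` and `n0` is the size of the initialization sample. -/
def step (n0 : ℕ) (γi : ℝ) (i : ℕ) (d : Obs dβ dg) (v : EuclideanSpace ℝ (Fin dg))
    (s : State dβ dg) : State dβ dg :=
  let βnew : EuclideanSpace ℝ (Fin dβ) := s.β - γi • WithLp.toLp 2
    ((pinv (s.Φ.transpose * s.W * s.Φ) * s.Φ.transpose * s.W).mulVec (g s.β d).ofLp)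
  let m : ℝ := ((n0 : ℝ) + i - 1) + v.ofLp ⬝ᵥ s.W.mulVec v.ofLp
  { β := βnew
    Φ := (((n0 : ℝ) + i - 1) / ((n0 : ℝ) + i)) • s.Φ + (1 / ((n0 : ℝ) + i)) • Gmat d
    W := (((n0 : ℝ) + i) / ((n0 : ℝ) + i - 1)) • (s.W * (1 - m⁻¹ • (outer v * s.W)))
    βbar := (((i : ℝ) - 1) / i) • s.βbar + (1 / (i : ℝ)) • βnew }

/-- The matrix `(1 / n0) ∑ z_{0j} z_{0j}' + η₀ I`, whose inverse is `W_0`. -/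
def Q0 {n0 : ℕ} (η0 : ℝ) (d0 : Fin n0 → Obs dβ dg) : Matrix (Fin dg) (Fin dg) ℝ :=
  (1 / (n0 : ℝ)) • ∑ j, outer (Obs.z (d0 j)) + η0 • 1

/-- The initial state computed from the initialization sample `d0` and the initial
estimate `b0`. -/
def init {n0 : ℕ} (η0 : ℝ) (d0 : Fin n0 → Obs dβ dg) (b0 : EuclideanSpace ℝ (Fin dβ)) :
    State dβ dg where
  β := b0
  Φ := (1 / (n0 : ℝ)) • ∑ j, Gmat (d0 j)
  W := (Q0 η0 d0)⁻¹
  βbar := b0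

/-- The S2SLS (warm-up) algorithm. The sequence `d` is indexed from `0`, so the observation
`D_{i+1}` is `d i`. -/
def s2sls (n0 : ℕ) (γ : ℕ → ℝ) (s0 : State dβ dg) (d : ℕ → Obs dβ dg) : ℕ → State dβ dg
  | 0 => s0
  | i + 1 => step n0 (γ (i + 1)) (i + 1) (d i) (Obs.z (d i)) (s2sls n0 γ s0 d i)

/-- The efficient SGMM algorithm with warm-up length `n1`: S2SLS updates up to time `n1`, and from
time `n1 + 1` on the weighting matrix is updated with `g_i(β̄_{n1})` instead of `z_i`. -/
def sgmm (n0 : ℕ) (γ : ℕ → ℝ) (s0 : State dβ dg) (d : ℕ → Obs dβ dg) (n1 : ℕ) :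
    ℕ → State dβ dg
  | 0 => s0
  | i + 1 => step n0 (γ (i + 1)) (i + 1) (d i)
      (if i + 1 ≤ n1 then Obs.z (d i) else g (s2sls n0 γ s0 d n1).βbar (d i))
      (sgmm n0 γ s0 d n1 i)

end SGMM

end

open SGMM

set_option linter.unusedSectionVars false

noncomputable section

namespace SGMM

section

/-! ### Measurability of matrix operations -/

/-! Since `g` is affine in `β` (`g_eq`), the error `Δ_i = β_i - βs` satisfies a linear recursion
`Δ_{i+1} = Δ_i - γ_{i+1} A_i (H_{i+1} Δ_i + ε_{i+1})`, where `H` is the observed Jacobian with mean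
`Γ = G`, `ε = g(βs)` is centered, and the gain `A_i = (Φ_i' W_i Φ_i)† Φ_i' W_i` depends only on the
past. If `A_i` is bounded and `A_i Γ` is within `1/4` of the identity, one step contracts the second
moment by `1 - 3γ/4` up to noise of order `γ²`, so `E‖Δ_i‖² = O(i^{-a})`
(`IsStochApprox.exists_lintegral_le`).

Dividing the recursion by `γ` and summing gives `∑ (Δ_i + A_* ε_{i+1}) = ∑ γ⁻¹(Δ_i - Δ_{i+1}) - ∑
(A_i Γ - 1) Δ_i - ∑ [A_i (H - Γ) Δ_i + (A_i - A_*) ε]`. Each sum on the right is `o(√n)`: the first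
by Abel summation, the second because `A_i Φ_i = 1` exactly, so that `A_i Γ - 1 = -A_i (Φ_i - G)`
has size `i^{-1/2}`, the third because it is a martingale whose variance is averaged away once `A_i
→ A_*` on average (`tendstoInMeasure_asymptotic_linearity`). The central limit theorem for `-A_* ε`
then gives the limit law, and with `A_* = (G'Ω⁻¹G)⁻¹G'Ω⁻¹` the sandwich variance collapses to
`(G'Ω⁻¹G)⁻¹` (`gain_mul_mul_gain_transpose`).

It remains to control the gains. By Sherman–Morrison `W_i` is the inverse of a running average of
outer products (`sgmm_W`). On almost every path the laws of large numbers put this average near the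
segment joining `E[zz']` to `Ω`, uniformly in the warm-up length, provided that the warm-up estimate
is precise whenever it is in use; it is near `Ω` once `i` is a large multiple of the warm-up length.
All points of the segment are positive definite, so compactness bounds the gains there
(`exists_regularSet_mem_nhds`). Outside an event of small probability the gains are therefore
regular from a fixed time `N` on, and the error coincides with that of a recursion with truncated
gains and a truncated starting value, to which the moment bounds apply (`exists_coupling`).

Consistency of the warm-up estimate is not circular: pure S2SLS is the case where the warm-up never
ends (`isWarmup_id`), for which no precision requirement arises. Its consistency then feeds the
efficient algorithm (`isWarmup`). -/

instance matrixMeasurableSpace {p q : ℕ} : MeasurableSpace (Matrix (Fin p) (Fin q) ℝ) :=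
  inferInstanceAs (MeasurableSpace (Fin p → Fin q → ℝ))

instance matrixBorelSpace {p q : ℕ} : BorelSpace (Matrix (Fin p) (Fin q) ℝ) :=
  inferInstanceAs (BorelSpace (Fin p → Fin q → ℝ))

instance matrixPolishSpace {p q : ℕ} : PolishSpace (Matrix (Fin p) (Fin q) ℝ) :=
  inferInstanceAs (PolishSpace (Fin p → Fin q → ℝ))

/-- The pseudoinverse is not continuous, but its graph is closed, being cut out by the four Penrose
equations. Uniqueness makes the projection of the graph injective, so by Lusin–Souslin the
projection of a Borel part of the graph is Borel. -/
theorem measurable_pinv {p q : ℕ} :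
    Measurable (pinv : Matrix (Fin p) (Fin q) ℝ → Matrix (Fin q) (Fin p) ℝ) := by
  intro s hs
  let Gr : Set (Matrix (Fin p) (Fin q) ℝ × Matrix (Fin q) (Fin p) ℝ) :=
    {x | IsMoorePenrose x.1 x.2}
  have hGr : IsClosed Gr := by
    have : Gr = {x | x.1 * x.2 * x.1 = x.1} ∩ {x | x.2 * x.1 * x.2 = x.2} ∩
        {x | (x.1 * x.2).transpose = x.1 * x.2} ∩ {x | (x.2 * x.1).transpose = x.2 * x.1} := by
      ext x
      constructor
      · rintro ⟨h1, h2, h3, h4⟩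
        exact ⟨⟨⟨h1, h2⟩, h3⟩, h4⟩
      · rintro ⟨⟨⟨h1, h2⟩, h3⟩, h4⟩
        exact ⟨h1, h2, h3, h4⟩
    rw [this]
    refine ((IsClosed.inter ?_ ?_).inter ?_).inter ?_ <;>
      exact isClosed_eq (by fun_prop) (by fun_prop)
  have himg : pinv ⁻¹' s = Prod.fst '' (Gr ∩ Prod.snd ⁻¹' s) := by
    ext A
    constructor
    · intro hA
      exact ⟨(A, pinv A), ⟨pinv_spec A, hA⟩, rfl⟩
    · rintro ⟨⟨A', B⟩, ⟨h1, h2⟩, rfl⟩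
      have : pinv A' = B := (pinv_spec A').unique h1
      simpa [this] using h2
  rw [himg]
  refine MeasurableSet.image_of_continuousOn_injOn
    (hGr.measurableSet.inter (measurable_snd hs)) continuous_fst.continuousOn ?_
  rintro ⟨A, B⟩ ⟨h1, -⟩ ⟨A', B'⟩ ⟨h2, -⟩ (rfl : A = A')
  exact Prod.ext rfl (h1.unique h2)

theorem pinv_eq_inv {p : ℕ} {A : Matrix (Fin p) (Fin p) ℝ} (hA : IsUnit A.det) :
    pinv A = A⁻¹ :=
  (pinv_spec A).unique
    ⟨by rw [Matrix.mul_nonsing_inv _ hA, Matrix.one_mul],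
     by rw [Matrix.nonsing_inv_mul _ hA, Matrix.one_mul],
     by rw [Matrix.mul_nonsing_inv _ hA, Matrix.transpose_one],
     by rw [Matrix.nonsing_inv_mul _ hA, Matrix.transpose_one]⟩

theorem measurable_matrix_inv {p : ℕ} :
    Measurable (fun A : Matrix (Fin p) (Fin p) ℝ => A⁻¹) := by
  have h : (fun A : Matrix (Fin p) (Fin p) ℝ => A⁻¹) = fun A => (A.det)⁻¹ • A.adjugate := by
    funext A
    rw [Matrix.inv_def, Ring.inverse_eq_inv']
  rw [h]
  have h1 : Measurable fun A : Matrix (Fin p) (Fin p) ℝ => (A.det)⁻¹ :=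
    (Continuous.matrix_det continuous_id).measurable.inv
  have h2 : Measurable fun A : Matrix (Fin p) (Fin p) ℝ => A.adjugate :=
    (Continuous.matrix_adjugate continuous_id).measurable
  refine measurable_pi_lambda _ fun i => measurable_pi_lambda _ fun j => ?_
  exact h1.mul ((measurable_pi_apply j).comp ((measurable_pi_apply i).comp h2))

theorem continuousAt_matrix_inv {p : ℕ} {A : Matrix (Fin p) (Fin p) ℝ} (hA : A.det ≠ 0) :
    ContinuousAt (fun A : Matrix (Fin p) (Fin p) ℝ => A⁻¹) A := by
  have h : (fun A : Matrix (Fin p) (Fin p) ℝ => A⁻¹) = fun A => (A.det)⁻¹ • A.adjugate := by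
    funext A
    rw [Matrix.inv_def, Ring.inverse_eq_inv']
  rw [h]
  exact ((Continuous.matrix_det continuous_id).continuousAt.inv₀ hA).smul
    (Continuous.matrix_adjugate continuous_id).continuousAt

/-! ### Positive definiteness -/

/-- The real spectrum is finite, so the infimum defining `lambdaMin` is a genuine lower bound for
the eigenvalues. -/
theorem posDef_of_lambdaMin_pos {p : ℕ} {A : Matrix (Fin p) (Fin p) ℝ} (hA : A.IsHermitian)
    (h : 0 < lambdaMin A) : A.PosDef := by
  rw [hA.posDef_iff_eigenvalues_pos]
  intro i
  refine h.trans_le (csInf_le ?_ (hA.eigenvalues_mem_spectrum_real i))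
  exact (Matrix.finite_real_spectrum (A := A)).bddBelow

/-- Positive definiteness of `B'B` is only used as injectivity of `B`. -/
theorem transpose_mul_mul_posDef {p q : ℕ} {S : Matrix (Fin q) (Fin q) ℝ} (hS : S.PosDef)
    {B : Matrix (Fin q) (Fin p) ℝ} (hB : (B.transpose * B).PosDef) :
    (B.transpose * S * B).PosDef := by
  have hinj : Function.Injective B.mulVec := by
    intro v w hvw
    have h0 : B.mulVec (v - w) = 0 := by rw [Matrix.mulVec_sub, hvw, sub_self]
    by_contra hne
    have := hB.dotProduct_mulVec_pos (x := v - w) (sub_ne_zero.2 hne)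
    rw [← Matrix.mulVec_mulVec, h0, Matrix.mulVec_zero, dotProduct_zero] at this
    exact lt_irrefl _ this
  simpa using hS.conjTranspose_mul_mul_same hinj

theorem posSemidef_outer {p : ℕ} (v : EuclideanSpace ℝ (Fin p)) : (outer v).PosSemidef := by
  simpa [outer] using Matrix.posSemidef_vecMulVec_self_star (v.ofLp)

/-! ### The rank-one update of the weighting matrix -/

/-- This is Sherman–Morrison. With `R = vv'W` and `s = v'Wv` one has `R² = sR`, hence `(1 + R/c)(1 -
R/(c+s)) = 1`; the scalar factors turn the rank-one update into a step of a running average with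
past weight `c`. -/
theorem mul_rankOne_update_eq_one {p : ℕ} {Q W : Matrix (Fin p) (Fin p) ℝ} (hQW : Q * W = 1)
    (v : EuclideanSpace ℝ (Fin p)) {c : ℝ} (hc : 0 < c)
    (hm : c + v.ofLp ⬝ᵥ W.mulVec v.ofLp ≠ 0) :
    (((c / (c + 1)) • Q + (1 / (c + 1)) • outer v) *
      (((c + 1) / c) • (W * (1 - (c + v.ofLp ⬝ᵥ W.mulVec v.ofLp)⁻¹ • (outer v * W))))) = 1 := by
  set s : ℝ := v.ofLp ⬝ᵥ W.mulVec v.ofLp with hs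
  set R := outer v * W with hR
  have hRR : R * R = s • R := by
    have h1 : outer v * W * outer v = s • outer v := by
      rw [outer, Matrix.mul_assoc, Matrix.mul_vecMulVec, Matrix.vecMulVec_mul_vecMulVec]
      simp [hs, Matrix.vecMulVec_smul]
    calc R * R = (outer v * W * outer v) * W := by simp only [hR, Matrix.mul_assoc]
      _ = s • R := by rw [h1, Matrix.smul_mul]
  have hc1 : c + 1 ≠ 0 := by positivity
  have e1 : ((c / (c + 1)) • Q + (1 / (c + 1)) • outer v) * (((c + 1) / c) • (W *
      (1 - (c + s)⁻¹ • R))) = (1 + (1 / c) • R) * (1 - (c + s)⁻¹ • R) := by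
    have e2 : ((c + 1) / c) • (((c / (c + 1)) • Q + (1 / (c + 1)) • outer v) * W)
        = 1 + (1 / c) • R := by
      rw [Matrix.add_mul, Matrix.smul_mul, Matrix.smul_mul, hQW, smul_add, smul_smul, smul_smul]
      congr 1
      · rw [show (c + 1) / c * (c / (c + 1)) = 1 by field_simp, one_smul]
      · rw [show (c + 1) / c * (1 / (c + 1)) = 1 / c by field_simp]
    rw [← e2, Matrix.mul_smul, Matrix.smul_mul, Matrix.mul_assoc]
  rw [e1, Matrix.add_mul, Matrix.one_mul, Matrix.mul_sub, Matrix.mul_one, Matrix.smul_mul,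
    Matrix.mul_smul, hRR]
  have e3 : (1 / c) • (c + s)⁻¹ • s • R = ((1 / c) * (c + s)⁻¹ * s) • R := by
    rw [smul_smul, smul_smul]
  rw [e3]
  have e4 : (1 - (c + s)⁻¹ • R + ((1 / c) • R - ((1 / c) * (c + s)⁻¹ * s) • R))
      = 1 + (1 / c - (c + s)⁻¹ - (1 / c) * (c + s)⁻¹ * s) • R := by
    simp only [sub_smul]
    abel
  rw [e4, show 1 / c - (c + s)⁻¹ - (1 / c) * (c + s)⁻¹ * s = 0 by field_simp; ring, zero_smul,
    add_zero]

/-! ### Matrices as operators between Euclidean spaces -/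

/-- A real matrix as a continuous linear map between Euclidean spaces. -/
def op {p q : ℕ} : Matrix (Fin p) (Fin q) ℝ →ₗ[ℝ]
    (EuclideanSpace ℝ (Fin q) →L[ℝ] EuclideanSpace ℝ (Fin p)) :=
  LinearMap.toContinuousLinearMap.toLinearMap ∘ₗ (Matrix.toLpLin 2 2).toLinearMap

theorem op_apply {p q : ℕ} (A : Matrix (Fin p) (Fin q) ℝ) (v : EuclideanSpace ℝ (Fin q)) :
    op A v = WithLp.toLp 2 (A.mulVec v.ofLp) := rfl

theorem op_mul {p q r : ℕ} (A : Matrix (Fin p) (Fin q) ℝ) (B : Matrix (Fin q) (Fin r) ℝ) :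
    op (A * B) = (op A).comp (op B) := by
  ext v i
  simp [op_apply]

theorem op_one {p : ℕ} : op (1 : Matrix (Fin p) (Fin p) ℝ) = 1 := by
  ext v i
  simp [op_apply]

theorem continuous_op {p q : ℕ} : Continuous (op (p := p) (q := q)) := by
  have : FiniteDimensional ℝ (Matrix (Fin p) (Fin q) ℝ) := inferInstance
  exact LinearMap.continuous_of_finiteDimensional (op (p := p) (q := q))

theorem measurable_op {p q : ℕ} : Measurable (op (p := p) (q := q)) := continuous_op.measurable

theorem norm_op_le_sum {p q : ℕ} (A : Matrix (Fin p) (Fin q) ℝ) :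
    ‖op A‖ ≤ ∑ k, ∑ l, |A k l| := by
  refine ContinuousLinearMap.opNorm_le_bound _ (by positivity) fun v => ?_
  have h (w : EuclideanSpace ℝ (Fin p)) : ‖w‖ ≤ ∑ k, |w k| := by
    rw [EuclideanSpace.norm_eq]
    refine Real.sqrt_le_iff.2 ⟨by positivity, ?_⟩
    simpa using Finset.sum_sq_le_sq_sum_of_nonneg (s := Finset.univ)
      (f := fun k => |w k|) (fun i _ => abs_nonneg _)
  refine (h _).trans ?_
  rw [Finset.sum_mul]
  refine Finset.sum_le_sum fun k _ => ?_
  rw [Finset.sum_mul]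
  refine (Finset.abs_sum_le_sum_abs (fun l => A k l * v l) Finset.univ).trans
    (Finset.sum_le_sum fun l _ => ?_)
  rw [abs_mul]
  exact mul_le_mul_of_nonneg_left (PiLp.norm_apply_le v l) (abs_nonneg _)

end

section

/-! ### Stochastic approximation with an adapted preconditioner -/

/-- Adding a linear image of a centered square integrable variable that is independent of the
past increases the second moment by at most the product of second moments. -/
theorem lintegral_enorm_sq_add_noise_le {Ω 𝒟 : Type*} {m mΩ : MeasurableSpace Ω}
    [MeasurableSpace 𝒟] {μ : Measure Ω} [IsProbabilityMeasure μ] {E W : Type*} [NormedAddCommGroup E]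
    [InnerProductSpace ℝ E] [FiniteDimensional ℝ E] [MeasurableSpace E] [BorelSpace E]
    [NormedAddCommGroup W] [NormedSpace ℝ W] [FiniteDimensional ℝ W] [MeasurableSpace W]
    [BorelSpace W] {P : Measure 𝒟} [IsProbabilityMeasure P]
    (hm : m ≤ mΩ) {D : Ω → 𝒟} (hD : Measurable D) (hP : μ.map D = P)
    (hind : Indep m (MeasurableSpace.comap D inferInstance) μ)
    {w : 𝒟 → W} (hw_meas : Measurable w) (hw : MemLp w 2 P) (hw0 : ∫ d, w d ∂P = 0)
    {X : Ω → E} (hX : Measurable[m] X) {T : Ω → W →L[ℝ] E} (hT : Measurable[m] T) :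
    ∫⁻ ω, ‖X ω + T ω (w (D ω))‖ₑ ^ 2 ∂μ ≤
      ∫⁻ ω, ‖X ω‖ₑ ^ 2 ∂μ + (∫⁻ ω, ‖T ω‖ₑ ^ 2 ∂μ) * ∫⁻ d, ‖w d‖ₑ ^ 2 ∂P := by
  have hXm : Measurable X := hX.mono hm le_rfl
  have hTm : Measurable T := hT.mono hm le_rfl
  have hYm : Measurable[m] fun ω => (X ω, T ω) := hX.prodMk hT
  have hY : Measurable fun ω => (X ω, T ω) := hXm.prodMk hTm
  have hindep : IndepFun (fun ω => (X ω, T ω)) D μ :=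
    indep_of_indep_of_le_left hind hYm.comap_le
  have hmap := (indepFun_iff_map_prod_eq_prod_map_map hY.aemeasurable hD.aemeasurable).1 hindep
  have hφ : Measurable fun p : (E × (W →L[ℝ] E)) × 𝒟 => ‖p.1.1 + p.1.2 (w p.2)‖ₑ ^ 2 := by
    have h1 : Measurable fun p : (E × (W →L[ℝ] E)) × 𝒟 => p.1.2 (w p.2) :=
      (isBoundedBilinearMap_apply (𝕜 := ℝ) (E := W) (F := E)).continuous.measurable.comp
        ((measurable_snd.comp measurable_fst).prodMk (hw_meas.comp measurable_snd))
    exact ((measurable_fst.comp measurable_fst).add h1).enorm.pow_const 2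
  -- With the past frozen at `(x, S)`, the cross term in the square integrates to zero because `w`
  -- is centered. Working with `lintegral` leaves the second moments of `X` and `T` free to be
  -- infinite.
  have inner_le (x : E) (S : W →L[ℝ] E) :
      ∫⁻ d, ‖x + S (w d)‖ₑ ^ 2 ∂P ≤ ‖x‖ₑ ^ 2 + ‖S‖ₑ ^ 2 * ∫⁻ d, ‖w d‖ₑ ^ 2 ∂P := by
    have hS : MemLp (fun d => S (w d)) 2 P := S.comp_memLp' hw
    have hint : Integrable (fun d => S (w d)) P := hS.integrable one_le_two
    have hint2 : Integrable (fun d => ‖S (w d)‖ ^ 2) P := hS.integrable_norm_pow (by norm_num)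
    have h0 : ∫ d, S (w d) ∂P = 0 := by
      rw [S.integral_comp_comm (hw.integrable one_le_two), hw0, map_zero]
    have hexp : (fun d => ‖x + S (w d)‖ ^ 2) =
        fun d => ‖x‖ ^ 2 + 2 * inner ℝ x (S (w d)) + ‖S (w d)‖ ^ 2 := by
      funext d
      exact norm_add_sq_real x (S (w d))
    have hintx : Integrable (fun d => 2 * inner ℝ x (S (w d))) P :=
      (hint.const_inner x).const_mul 2
    have hL : ∫⁻ d, ‖x + S (w d)‖ₑ ^ 2 ∂P = ENNReal.ofReal (∫ d, ‖x + S (w d)‖ ^ 2 ∂P) := by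
      rw [ofReal_integral_eq_lintegral_ofReal]
      · simp [ENNReal.ofReal_pow]
      · rw [hexp]
        exact ((integrable_const _).add hintx).add hint2
      · exact ae_of_all _ fun d => by positivity
    have hR : ENNReal.ofReal (∫ d, ‖S (w d)‖ ^ 2 ∂P) = ∫⁻ d, ‖S (w d)‖ₑ ^ 2 ∂P := by
      rw [ofReal_integral_eq_lintegral_ofReal hint2 (ae_of_all _ fun d => by positivity)]
      simp [ENNReal.ofReal_pow]
    have hI : ∫ d, ‖x + S (w d)‖ ^ 2 ∂P = ‖x‖ ^ 2 + ∫ d, ‖S (w d)‖ ^ 2 ∂P := by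
      rw [hexp, integral_add (f := fun d => ‖x‖ ^ 2 + 2 * inner ℝ x (S (w d)))
        ((integrable_const _).add hintx) hint2,
        integral_add (integrable_const _) hintx, integral_const_mul, integral_inner hint, h0,
        inner_zero_right, mul_zero, add_zero, integral_const, probReal_univ, one_smul]
    rw [hL, hI, ENNReal.ofReal_add (by positivity) (integral_nonneg fun d => by positivity), hR]
    gcongr
    · simp [ENNReal.ofReal_pow]
    · rw [← lintegral_const_mul' _ _ (by simp)]
      refine lintegral_mono fun d => ?_
      rw [← mul_pow]
      gcongr
      exact S.le_opENorm (w d)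
  -- Independence makes the joint law of past and observation a product, so the new observation can
  -- be integrated out first.
  have e1 : ∫⁻ ω, ‖X ω + T ω (w (D ω))‖ₑ ^ 2 ∂μ =
      ∫⁻ ω, ∫⁻ d, ‖X ω + T ω (w d)‖ₑ ^ 2 ∂P ∂μ := by
    have := lintegral_map (μ := μ) hφ (hY.prodMk hD)
    rw [hmap, lintegral_prod _ hφ.aemeasurable, hP, lintegral_map _ hY] at this
    · exact this.symm
    · exact hφ.lintegral_prod_right'
  rw [e1]
  refine (lintegral_mono fun ω => inner_le (X ω) (T ω)).trans_eq ?_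
  rw [lintegral_add_left (hXm.enorm.pow_const 2), lintegral_mul_const _ (hTm.enorm.pow_const 2)]

section StochasticApproximation

variable {Ω 𝒟 : Type*} {mΩ : MeasurableSpace Ω} [MeasurableSpace 𝒟] {μ : Measure Ω}
  [IsProbabilityMeasure μ]
  {E F : Type*} [NormedAddCommGroup E] [InnerProductSpace ℝ E] [FiniteDimensional ℝ E]
  [MeasurableSpace E] [BorelSpace E] [NormedAddCommGroup F] [InnerProductSpace ℝ F]
  [FiniteDimensional ℝ F] [MeasurableSpace F] [BorelSpace F]

/-- Independent observations `D i` with law `P`, adapted to `ℱ` and independent of its past,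
carrying a square integrable random linear map `H` with mean `Γ` and centered square integrable
noise `ε`. -/
structure IsDriven (μ : Measure Ω) (ℱ : ℕ → MeasurableSpace Ω) (D : ℕ → Ω → 𝒟) (P : Measure 𝒟)
    (H : 𝒟 → E →L[ℝ] F) (ε : 𝒟 → F) (Γ : E →L[ℝ] F) : Prop where
  le : ∀ i, ℱ i ≤ mΩ
  mono : Monotone ℱ
  meas : ∀ i, Measurable[ℱ (i + 1)] (D i)
  law : ∀ i, μ.map (D i) = P
  indep : ∀ i, Indep (ℱ i) (MeasurableSpace.comap (D i) inferInstance) μ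
  measH : Measurable H
  measε : Measurable ε
  memH : MemLp H 2 P
  memε : MemLp ε 2 P
  meanH : ∫ d, H d ∂P = Γ
  meanε : ∫ d, ε d ∂P = 0

/-- A stochastic approximation recursion, from time `N` on, with adapted preconditioners `A i`
that are bounded and approximately left inverse to `Γ`. -/
structure IsStochApprox (ℱ : ℕ → MeasurableSpace Ω) (D : ℕ → Ω → 𝒟)
    (H : 𝒟 → E →L[ℝ] F) (ε : 𝒟 → F) (Γ : E →L[ℝ] F) (γ : ℕ → ℝ) (M : ℝ) (N : ℕ)
    (A : ℕ → Ω → F →L[ℝ] E) (Δ : ℕ → Ω → E) : Prop where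
  measA : ∀ i, Measurable[ℱ i] (A i)
  normA_le : ∀ i ω, ‖A i ω‖ ≤ M
  leftInv : ∀ i ω, ‖(A i ω).comp Γ - 1‖ ≤ 1 / 4
  meas_start : Measurable[ℱ N] (Δ N)
  recursion : ∀ i, N ≤ i → ∀ ω,
    Δ (i + 1) ω = Δ i ω - γ (i + 1) • A i ω (H (D i ω) (Δ i ω) + ε (D i ω))

/-- The linear map `(h, e) ↦ A (h b) + B e`. -/
def noiseMap (A B : F →L[ℝ] E) (b : E) : ((E →L[ℝ] F) × F) →L[ℝ] E :=
  (A.comp (ContinuousLinearMap.apply ℝ F b)).comp (ContinuousLinearMap.fst ℝ _ _) +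
    B.comp (ContinuousLinearMap.snd ℝ _ _)

theorem noiseMap_apply (A B : F →L[ℝ] E) (b : E) (h : E →L[ℝ] F) (e : F) :
    noiseMap A B b (h, e) = A (h b) + B e := by
  simp [noiseMap]

theorem norm_noiseMap_le (A B : F →L[ℝ] E) (b : E) :
    ‖noiseMap A B b‖ ≤ ‖A‖ * ‖b‖ + ‖B‖ := by
  refine ContinuousLinearMap.opNorm_le_bound _ (by positivity) fun p => ?_
  obtain ⟨h, e⟩ := p
  rw [noiseMap_apply]
  have h1 : ‖h‖ ≤ ‖(h, e)‖ := le_max_left _ _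
  have h2 : ‖e‖ ≤ ‖(h, e)‖ := le_max_right _ _
  calc ‖A (h b) + B e‖ ≤ ‖A (h b)‖ + ‖B e‖ := norm_add_le _ _
    _ ≤ ‖A‖ * (‖h‖ * ‖b‖) + ‖B‖ * ‖e‖ := by
        gcongr
        · exact (A.le_opNorm _).trans (by gcongr; exact h.le_opNorm b)
        · exact B.le_opNorm e
    _ ≤ ‖A‖ * (‖(h, e)‖ * ‖b‖) + ‖B‖ * ‖(h, e)‖ := by gcongr
    _ = _ := by ring

theorem measurable_noiseMap {m : MeasurableSpace Ω} {A B : Ω → F →L[ℝ] E} {b : Ω → E}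
    (hA : Measurable A) (hB : Measurable B) (hb : Measurable b) :
    Measurable fun ω => noiseMap (A ω) (B ω) (b ω) := by
  have h : Continuous fun p : (F →L[ℝ] E) × (F →L[ℝ] E) × E => noiseMap p.1 p.2.1 p.2.2 := by
    unfold noiseMap
    fun_prop
  exact h.measurable.comp (hA.prodMk (hB.prodMk hb))

namespace IsDriven

variable {ℱ : ℕ → MeasurableSpace Ω} {D : ℕ → Ω → 𝒟} {P : Measure 𝒟} [IsProbabilityMeasure P]
  {H : 𝒟 → E →L[ℝ] F} {ε : 𝒟 → F} {Γ : E →L[ℝ] F}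

/-- The second moment of the centered noise `(H - Γ, ε)`. -/
def noiseVar (P : Measure 𝒟) (H : 𝒟 → E →L[ℝ] F) (ε : 𝒟 → F) (Γ : E →L[ℝ] F) : ℝ :=
  (∫⁻ d, ‖(H d - Γ, ε d)‖ₑ ^ 2 ∂P).toReal

theorem memLp_noise (h : IsDriven μ ℱ D P H ε Γ) : MemLp (fun d => (H d - Γ, ε d)) 2 P :=
  memLp_prod_iff.2 ⟨h.memH.sub (memLp_const Γ), h.memε⟩

theorem ofReal_noiseVar (h : IsDriven μ ℱ D P H ε Γ) :
    ∫⁻ d, ‖(H d - Γ, ε d)‖ₑ ^ 2 ∂P = ENNReal.ofReal (noiseVar P H ε Γ) := by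
  have h1 := h.memLp_noise.eLpNorm_lt_top
  rw [eLpNorm_lt_top_iff_lintegral_rpow_enorm_lt_top (by norm_num) (by norm_num)] at h1
  rw [noiseVar, ENNReal.ofReal_toReal]
  simpa using h1.ne

theorem lintegral_add_noise_le (h : IsDriven μ ℱ D P H ε Γ) (i : ℕ)
    {X : Ω → E} (hX : Measurable[ℱ i] X) {T : Ω → ((E →L[ℝ] F) × F) →L[ℝ] E}
    (hT : Measurable[ℱ i] T) :
    ∫⁻ ω, ‖X ω + T ω (H (D i ω) - Γ, ε (D i ω))‖ₑ ^ 2 ∂μ ≤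
      ∫⁻ ω, ‖X ω‖ₑ ^ 2 ∂μ + (∫⁻ ω, ‖T ω‖ₑ ^ 2 ∂μ) * ENNReal.ofReal (noiseVar P H ε Γ) := by
  have hD : Measurable (D i) := (h.meas i).mono (h.le _) le_rfl
  have hmean : ∫ d, (H d - Γ, ε d) ∂P = 0 := by
    have hH := h.memH.integrable one_le_two
    rw [integral_pair (f := fun d => H d - Γ) (hH.sub (integrable_const Γ)) (h.memε.integrable one_le_two),
      integral_sub hH (integrable_const Γ), h.meanH, h.meanε]
    simp
  have := lintegral_enorm_sq_add_noise_le (m := ℱ i) (mΩ := mΩ) (h.le i) hD (h.law i) (h.indep i)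
    (w := fun d => (H d - Γ, ε d)) ((h.measH.sub_const Γ).prodMk h.measε) h.memLp_noise hmean hX hT
  rwa [h.ofReal_noiseVar] at this

end IsDriven

end StochasticApproximation

end

section

theorem enorm_sq_eq_ofReal {V : Type*} [SeminormedAddCommGroup V] (x : V) :
    ‖x‖ₑ ^ 2 = ENNReal.ofReal (‖x‖ ^ 2) := by
  rw [ENNReal.ofReal_pow (norm_nonneg x), ofReal_norm]

/-! ### Power learning rates -/

theorem tendsto_natCast_rpow_neg {a : ℝ} (ha : 0 < a) :
    Tendsto (fun i : ℕ => (i : ℝ) ^ (-a)) atTop (𝓝 0) :=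
  (tendsto_rpow_neg_atTop ha).comp tendsto_natCast_atTop_atTop

/-- The relative change of `i^{-a}` in one step is of order `1/i`; for `a < 1` this is negligible
against the learning rate, so the contraction outpaces the decay of the target rate. -/
theorem eventually_inv_le_mul_rpow {c a : ℝ} (hc : 0 < c) (ha : a < 1) :
    ∀ᶠ i : ℕ in atTop, 1 / (i : ℝ) ≤ c * (i + 1 : ℝ) ^ (-a) := by
  have h1 : Tendsto (fun i : ℕ => (i : ℝ) ^ (-(1 - a))) atTop (𝓝 0) :=
    tendsto_natCast_rpow_neg (by linarith)
  have h2 : ∀ᶠ i : ℕ in atTop, (i : ℝ) ^ (-(1 - a)) < c / 2 ^ |a| :=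
    h1.eventually_lt_const (by positivity)
  filter_upwards [h2, eventually_ge_atTop 1] with i hi h1i
  have hi0 : (0 : ℝ) < i := by exact_mod_cast h1i
  have h1i' : (1 : ℝ) ≤ i := by exact_mod_cast h1i
  have e1 : 1 / (i : ℝ) = (i : ℝ) ^ (-(1 - a)) * (i : ℝ) ^ (-a) := by
    rw [← Real.rpow_add hi0, show -(1 - a) + -a = -1 by ring, Real.rpow_neg_one, one_div]
  have e2 : (i : ℝ) ^ (-a) ≤ 2 ^ |a| * (i + 1 : ℝ) ^ (-a) := by
    rcases le_or_gt 0 a with h | h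
    · rw [abs_of_nonneg h]
      have : (i : ℝ) ^ (-a) = 2 ^ a * (2 * i : ℝ) ^ (-a) := by
        rw [Real.mul_rpow (by norm_num) hi0.le, ← mul_assoc, ← Real.rpow_add (by norm_num)]
        simp
      rw [this]
      gcongr 2 ^ a * ?_
      exact Real.rpow_le_rpow_of_nonpos (by positivity) (by linarith) (by linarith)
    · have h3 : (i : ℝ) ^ (-a) ≤ (i + 1 : ℝ) ^ (-a) :=
        Real.rpow_le_rpow hi0.le (by linarith) (by linarith)
      refine h3.trans (le_mul_of_one_le_left (by positivity) ?_)
      exact Real.one_le_rpow (by norm_num) (abs_nonneg a)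
  rw [e1]
  calc (i : ℝ) ^ (-(1 - a)) * (i : ℝ) ^ (-a)
      ≤ (c / 2 ^ |a|) * (2 ^ |a| * (i + 1 : ℝ) ^ (-a)) := by gcongr
    _ = c * (i + 1 : ℝ) ^ (-a) := by field_simp

theorem rpow_neg_le_mul_succ {a : ℝ} (ha1 : a ≤ 1) {i : ℕ} (hi : 1 ≤ i) :
    (i : ℝ) ^ (-a) ≤ (1 + 1 / (i : ℝ)) * (i + 1 : ℝ) ^ (-a) := by
  have hi0 : (0 : ℝ) < i := by exact_mod_cast hi
  have e : (i : ℝ) ^ (-a) = (1 + 1 / (i : ℝ)) ^ a * (i + 1 : ℝ) ^ (-a) := by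
    have h1 : (i + 1 : ℝ) = (1 + 1 / (i : ℝ)) * i := by field_simp
    have h2 : (0 : ℝ) < 1 + 1 / (i : ℝ) := by positivity
    rw [h1, Real.mul_rpow h2.le hi0.le, ← mul_assoc, ← Real.rpow_add h2]
    simp
  rw [e]
  gcongr
  have h3 : (1 : ℝ) ≤ 1 + 1 / (i : ℝ) := by
    have : (0 : ℝ) < 1 / (i : ℝ) := by positivity
    linarith
  calc (1 + 1 / (i : ℝ)) ^ a ≤ (1 + 1 / (i : ℝ)) ^ (1 : ℝ) :=
        Real.rpow_le_rpow_of_exponent_le h3 ha1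
    _ = _ := Real.rpow_one _

/-- The Robbins–Monro recursion for second moments yields the rate of the learning rate. -/
theorem exists_rate {γ0 a c : ℝ} (hγ0 : 0 < γ0) (ha0 : 0 < a) (ha1 : a < 1) (hc : 0 ≤ c) :
    ∃ N0 : ℕ, 1 ≤ N0 ∧ (∀ i ≥ N0, γ0 * ((i + 1 : ℕ) : ℝ) ^ (-a) ≤ 1) ∧
      ∀ N ≥ N0, ∀ L : ℝ, ∃ K : ℝ, 0 ≤ K ∧ ∀ u : ℕ → ENNReal, u N ≤ ENNReal.ofReal L →
        (∀ i ≥ N, u (i + 1) ≤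
          ENNReal.ofReal (1 - 3 / 4 * (γ0 * ((i + 1 : ℕ) : ℝ) ^ (-a)) +
            c * (γ0 * ((i + 1 : ℕ) : ℝ) ^ (-a)) ^ 2) * u i +
          ENNReal.ofReal (c * (γ0 * ((i + 1 : ℕ) : ℝ) ^ (-a)) ^ 2)) →
        ∀ i ≥ N, u i ≤ ENNReal.ofReal (K * (i : ℝ) ^ (-a)) := by
  have hγ : Tendsto (fun i : ℕ => γ0 * ((i + 1 : ℕ) : ℝ) ^ (-a)) atTop (𝓝 0) := by
    simpa using ((tendsto_natCast_rpow_neg ha0).comp (tendsto_add_atTop_nat 1)).const_mul γ0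
  have hγc : Tendsto (fun i : ℕ => c * (γ0 * ((i + 1 : ℕ) : ℝ) ^ (-a))) atTop (𝓝 0) := by
    simpa using hγ.const_mul c
  have h1 : ∀ᶠ i : ℕ in atTop, γ0 * ((i + 1 : ℕ) : ℝ) ^ (-a) < 1 := hγ.eventually_lt_const one_pos
  have h2 : ∀ᶠ i : ℕ in atTop, c * (γ0 * ((i + 1 : ℕ) : ℝ) ^ (-a)) < 1 / 4 :=
    hγc.eventually_lt_const (by norm_num)
  have h3 := eventually_inv_le_mul_rpow (c := γ0 / 4) (a := a) (by positivity) ha1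
  -- Past this index, with `y` the learning rate at `i + 1`: `y < 1`, `c y < 1/4` and `1/i ≤ y/4`.
  obtain ⟨N1, hN1⟩ := eventually_atTop.1 (h1.and (h2.and h3))
  refine ⟨max N1 1, le_max_right _ _, fun i hi => (hN1 i (le_of_max_le_left hi)).1.le, ?_⟩
  -- The threshold is fixed before the starting bound `L`, and only the constant depends on `L`: the
  -- coupling chooses the starting time first and learns afterwards how large the error is at that
  -- time.
  intro N hN L
  have hN0 : (0 : ℝ) < N := by exact_mod_cast (le_of_max_le_right hN)
  -- The first entry absorbs the noise term, `c y² ≤ (K/4) y (i+1)^{-a}`; the second makes the bound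
  -- hold at the start `i = N`.
  refine ⟨max (4 * c * γ0) (L * (N : ℝ) ^ a), le_max_of_le_left (by positivity), ?_⟩
  set K := max (4 * c * γ0) (L * (N : ℝ) ^ a) with hK
  have hK0 : 0 ≤ K := le_max_of_le_left (by positivity)
  intro u hu hrec i hi
  induction i, hi using Nat.le_induction with
  | base =>
    refine hu.trans (ENNReal.ofReal_le_ofReal ?_)
    calc L = L * (N : ℝ) ^ a * (N : ℝ) ^ (-a) := by
          rw [mul_assoc, ← Real.rpow_add hN0]; simp
      _ ≤ K * (N : ℝ) ^ (-a) := by gcongr; exact le_max_right _ _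
  | succ i hi ih =>
    obtain ⟨g1, g2, g3⟩ := hN1 i ((le_of_max_le_left hN).trans hi)
    have hi1 : 1 ≤ i := (le_of_max_le_right hN).trans hi
    have hq := rpow_neg_le_mul_succ ha1.le hi1
    set q' : ℝ := ((i + 1 : ℕ) : ℝ) ^ (-a) with hq'
    have hq'0 : 0 < q' := by positivity
    have hcast : (i + 1 : ℝ) ^ (-a) = q' := by rw [hq']; push_cast; rfl
    rw [hcast] at hq g3
    set y := γ0 * q' with hy
    have hy0 : 0 < y := by positivity
    have hcoef : 0 ≤ 1 - 3 / 4 * y + c * y ^ 2 := by nlinarith [mul_nonneg hc (sq_nonneg y)]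
    refine (hrec i hi).trans ?_
    calc _ ≤ ENNReal.ofReal (1 - 3 / 4 * y + c * y ^ 2) * ENNReal.ofReal (K * (i : ℝ) ^ (-a)) +
          ENNReal.ofReal (c * y ^ 2) := by gcongr
      _ = ENNReal.ofReal ((1 - 3 / 4 * y + c * y ^ 2) * (K * (i : ℝ) ^ (-a)) + c * y ^ 2) := by
          rw [← ENNReal.ofReal_mul hcoef, ← ENNReal.ofReal_add (by positivity) (by positivity)]
      _ ≤ ENNReal.ofReal (K * q') := by
          refine ENNReal.ofReal_le_ofReal ?_
          have f1 : 1 - 3 / 4 * y + c * y ^ 2 ≤ 1 - y / 2 := by nlinarith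
          have f2 : K * (i : ℝ) ^ (-a) ≤ K * ((1 + y / 4) * q') := by
            gcongr
            have h5 : 1 + 1 / (i : ℝ) ≤ 1 + y / 4 := by rw [hy]; linarith
            exact hq.trans (mul_le_mul_of_nonneg_right h5 hq'0.le)
          have f3 : c * y ^ 2 ≤ K / 4 * y * q' := by
            have : 4 * c * γ0 ≤ K := le_max_left _ _
            have h5 : c * y ^ 2 = (4 * c * γ0) / 4 * y * q' := by rw [hy]; ring
            rw [h5]
            gcongr
          -- The net contraction `y/2` pays `y/4` for replacing `i^{-a}` by `(i+1)^{-a}` and `y/4`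
          -- for the noise: `(1 - y/2)(1 + y/4) + y/4 = 1 - y²/8`.
          calc (1 - 3 / 4 * y + c * y ^ 2) * (K * (i : ℝ) ^ (-a)) + c * y ^ 2
              ≤ (1 - y / 2) * (K * ((1 + y / 4) * q')) + K / 4 * y * q' := by
                have f4 : 0 ≤ 1 - y / 2 := by linarith
                gcongr
            _ = K * q' - K * q' * y ^ 2 / 8 := by ring
            _ ≤ K * q' := by
                have : 0 ≤ K * q' * y ^ 2 / 8 := by positivity
                linarith

/-- Bernoulli's inequality for the concave power, applied to `i/(i+1) = 1 - 1/(i+1)`; it replaces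
comparison of the sum with an integral by a telescoping sum. -/
theorem mul_rpow_sub_one_le {p : ℝ} (hp0 : 0 ≤ p) (hp1 : p ≤ 1) (i : ℕ) :
    p * ((i + 1 : ℕ) : ℝ) ^ (p - 1) ≤ ((i + 1 : ℕ) : ℝ) ^ p - (i : ℝ) ^ p := by
  have h0 : (0 : ℝ) < ((i + 1 : ℕ) : ℝ) := by positivity
  have hb := rpow_one_add_le_one_add_mul_self (s := -(1 / ((i + 1 : ℕ) : ℝ))) (p := p)
    (by
      have : 1 / ((i + 1 : ℕ) : ℝ) ≤ 1 := by
        rw [div_le_one h0]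
        push_cast
        have : (0 : ℝ) ≤ i := by positivity
        linarith
      linarith) hp0 hp1
  have e1 : (i : ℝ) = ((i + 1 : ℕ) : ℝ) * (1 + -(1 / ((i + 1 : ℕ) : ℝ))) := by
    field_simp
    push_cast
    ring
  have hnn : 0 ≤ 1 + -(1 / ((i + 1 : ℕ) : ℝ)) := by
    by_contra hneg
    push Not at hneg
    have : (i : ℝ) < 0 := by rw [e1]; exact mul_neg_of_pos_of_neg h0 hneg
    exact absurd this (not_lt.2 (by positivity))
  have e2 : (i : ℝ) ^ p = ((i + 1 : ℕ) : ℝ) ^ p * (1 + -(1 / ((i + 1 : ℕ) : ℝ))) ^ p := by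
    rw [← Real.mul_rpow h0.le hnn, ← e1]
  have e3 : ((i + 1 : ℕ) : ℝ) ^ (p - 1) = ((i + 1 : ℕ) : ℝ) ^ p * (1 / ((i + 1 : ℕ) : ℝ)) := by
    rw [Real.rpow_sub_one h0.ne']
    ring
  rw [e2, e3]
  have := mul_le_mul_of_nonneg_left hb (Real.rpow_nonneg h0.le p)
  nlinarith

theorem sum_rpow_sub_one_le {p : ℝ} (hp0 : 0 < p) (hp1 : p ≤ 1) {N : ℕ} (hN : 1 ≤ N) (n : ℕ) :
    ∑ i ∈ Finset.Ico N n, (i : ℝ) ^ (p - 1) ≤ (n : ℝ) ^ p / p := by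
  have hsub : ∑ i ∈ Finset.Ico N n, (i : ℝ) ^ (p - 1)
      ≤ ∑ i ∈ Finset.Ico 1 (n + 1), (i : ℝ) ^ (p - 1) := by
    refine Finset.sum_le_sum_of_subset_of_nonneg
      (Finset.Ico_subset_Ico hN (Nat.le_succ n)) fun i _ _ => by positivity
  refine hsub.trans ?_
  rw [le_div_iff₀ hp0, mul_comm, Finset.mul_sum, Finset.sum_Ico_eq_sum_range]
  simp only [Nat.add_sub_cancel]
  calc ∑ k ∈ Finset.range n, p * ((1 + k : ℕ) : ℝ) ^ (p - 1)
      ≤ ∑ k ∈ Finset.range n, (((k + 1 : ℕ) : ℝ) ^ p - (k : ℝ) ^ p) :=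
        Finset.sum_le_sum fun k _ => by rw [add_comm 1 k]; exact mul_rpow_sub_one_le hp0.le hp1 k
    _ = (n : ℝ) ^ p := by
        rw [Finset.sum_range_sub (fun k : ℕ => (k : ℝ) ^ p)]
        simp [Real.zero_rpow hp0.ne']

theorem tendsto_inv_sqrt_mul_rpow {p : ℝ} (hp : p < 1 / 2) :
    Tendsto (fun n : ℕ => (√(n : ℝ))⁻¹ * (n : ℝ) ^ p) atTop (𝓝 0) := by
  have h := tendsto_natCast_rpow_neg (a := 1 / 2 - p) (by linarith)
  refine h.congr' ?_
  filter_upwards [eventually_ge_atTop 1] with n hn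
  have hn0 : (0 : ℝ) < n := by exact_mod_cast hn
  rw [Real.sqrt_eq_rpow, ← Real.rpow_neg hn0.le, ← Real.rpow_add hn0]
  congr 1
  ring

end

section

/-! ### Convergence in measure -/

section InMeasure

variable {Ω V : Type*} {mΩ : MeasurableSpace Ω} {μ : Measure Ω} [NormedAddCommGroup V]

theorem tendstoInMeasure_zero_of_lintegral {f : ℕ → Ω → V}
    (hf : ∀ n, AEStronglyMeasurable (f n) μ)
    (h : Tendsto (fun n => ∫⁻ ω, ‖f n ω‖ₑ ∂μ) atTop (𝓝 0)) :
    TendstoInMeasure μ f atTop 0 := by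
  refine tendstoInMeasure_of_tendsto_eLpNorm (p := 1) one_ne_zero hf
    aestronglyMeasurable_zero ?_
  simpa [eLpNorm_one_eq_lintegral_enorm] using h

theorem tendstoInMeasure_zero_of_lintegral_sq {f : ℕ → Ω → V}
    (hf : ∀ n, AEStronglyMeasurable (f n) μ)
    (h : Tendsto (fun n => ∫⁻ ω, ‖f n ω‖ₑ ^ 2 ∂μ) atTop (𝓝 0)) :
    TendstoInMeasure μ f atTop 0 := by
  refine tendstoInMeasure_of_tendsto_eLpNorm (p := 2) two_ne_zero hf
    aestronglyMeasurable_zero ?_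
  have h2 := (ENNReal.continuous_rpow_const (y := 1 / 2)).tendsto 0 |>.comp h
  simpa [eLpNorm_eq_lintegral_rpow_enorm_toReal (p := 2) two_ne_zero (by norm_num),
    Function.comp_def] using h2

theorem tendstoInMeasure_zero_add {f g : ℕ → Ω → V} (hf : TendstoInMeasure μ f atTop 0)
    (hg : TendstoInMeasure μ g atTop 0) :
    TendstoInMeasure μ (fun n ω => f n ω + g n ω) atTop 0 := by
  rw [tendstoInMeasure_iff_norm] at *
  intro ε hε
  have h := (hf (ε / 2) (by positivity)).add (hg (ε / 2) (by positivity))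
  rw [zero_add] at h
  refine tendsto_of_tendsto_of_tendsto_of_le_of_le tendsto_const_nhds h (fun _ => zero_le)
    fun n => (measure_mono ?_).trans (measure_union_le _ _)
  intro ω hω
  simp only [Set.mem_ofPred_eq, Pi.zero_apply, sub_zero, Set.mem_union] at hω ⊢
  by_contra! hc
  linarith [norm_add_le (f n ω) (g n ω)]

theorem tendstoInMeasure_zero_of_norm_le {V' : Type*} [NormedAddCommGroup V'] {f : ℕ → Ω → V}
    {g : ℕ → Ω → V'} (hg : TendstoInMeasure μ g atTop 0)
    (h : ∀ᶠ n in atTop, ∀ ω, ‖f n ω‖ ≤ ‖g n ω‖) : TendstoInMeasure μ f atTop 0 := by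
  rw [tendstoInMeasure_iff_norm] at *
  intro ε hε
  refine tendsto_of_tendsto_of_tendsto_of_le_of_le' tendsto_const_nhds (hg ε hε)
    (Eventually.of_forall fun _ => zero_le) ?_
  filter_upwards [h] with n hn
  refine measure_mono fun ω hω => ?_
  simp only [Set.mem_ofPred_eq, Pi.zero_apply, sub_zero] at hω ⊢
  exact hω.trans (hn ω)

theorem tendstoInMeasure_zero_neg {f : ℕ → Ω → V} (hf : TendstoInMeasure μ f atTop 0) :
    TendstoInMeasure μ (fun n ω => -f n ω) atTop 0 :=
  tendstoInMeasure_zero_of_norm_le hf (Eventually.of_forall fun n ω => by simp)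

/-- Convergence in measure to zero may be checked on approximations that are exact up to small
probability. -/
theorem tendstoInMeasure_zero_of_approx {f : ℕ → Ω → V}
    (h : ∀ δ : ℝ, 0 < δ → ∃ g : ℕ → Ω → V, TendstoInMeasure μ g atTop 0 ∧
      ∀ᶠ n in atTop, μ {ω | f n ω ≠ g n ω} ≤ ENNReal.ofReal δ) :
    TendstoInMeasure μ f atTop 0 := by
  rw [tendstoInMeasure_iff_norm]
  intro ε hε
  rw [ENNReal.tendsto_nhds_zero]
  intro δ hδ
  obtain ⟨δ', hδ'0, hδ'⟩ : ∃ δ' : ℝ, 0 < δ' ∧ ENNReal.ofReal δ' + ENNReal.ofReal δ' ≤ δ := by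
    rcases eq_or_ne δ ⊤ with rfl | ht
    · exact ⟨1, one_pos, le_top⟩
    · refine ⟨δ.toReal / 2, half_pos (ENNReal.toReal_pos hδ.ne' ht), ?_⟩
      have h0 : 0 ≤ δ.toReal / 2 := by positivity
      rw [← ENNReal.ofReal_add h0 h0, add_halves, ENNReal.ofReal_toReal ht]
  obtain ⟨g, hg, hfg⟩ := h δ' hδ'0
  rw [tendstoInMeasure_iff_norm] at hg
  have h2 := (ENNReal.tendsto_nhds_zero.1 (hg ε hε)) (ENNReal.ofReal δ')
    (ENNReal.ofReal_pos.2 hδ'0)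
  filter_upwards [hfg, h2] with n h3 h4
  refine (measure_mono (t := {ω | f n ω ≠ g n ω} ∪
    {ω | ε ≤ ‖g n ω - (0 : Ω → V) ω‖}) ?_).trans ((measure_union_le _ _).trans
    ((add_le_add h3 h4).trans hδ'))
  intro ω hω
  by_cases he : f n ω = g n ω
  · exact Or.inr (by simpa [he] using hω)
  · exact Or.inl he

/-- Cauchy–Schwarz. The bounds `b` and `c` need no sign, since `ENNReal.ofReal` and the square root
both vanish on negative numbers. -/
theorem lintegral_enorm_mul_le {V' : Type*} [NormedAddCommGroup V'] {X : Ω → V} {Y : Ω → V'}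
    (hX : AEStronglyMeasurable X μ) (hY : AEStronglyMeasurable Y μ) {b c : ℝ}
    (hb : ∫⁻ ω, ‖X ω‖ₑ ^ 2 ∂μ ≤ ENNReal.ofReal b) (hc : ∫⁻ ω, ‖Y ω‖ₑ ^ 2 ∂μ ≤ ENNReal.ofReal c) :
    ∫⁻ ω, ‖X ω‖ₑ * ‖Y ω‖ₑ ∂μ ≤ ENNReal.ofReal (√b * √c) := by
  have h := ENNReal.lintegral_mul_le_Lp_mul_Lq μ Real.HolderConjugate.two_two hX.enorm hY.enorm
  refine h.trans ?_
  have aux {z : ENNReal} {r : ℝ} (hz : z ≤ ENNReal.ofReal r) :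
      z ^ (1 / (2 : ℝ)) ≤ ENNReal.ofReal (√r) := by
    refine (ENNReal.rpow_le_rpow hz (by norm_num)).trans_eq ?_
    rcases le_or_gt 0 r with h0 | h0
    · rw [ENNReal.ofReal_rpow_of_nonneg h0 (by norm_num), Real.sqrt_eq_rpow]
    · rw [ENNReal.ofReal_of_nonpos h0.le, Real.sqrt_eq_zero_of_nonpos h0.le]
      simp
  rw [ENNReal.ofReal_mul (Real.sqrt_nonneg _)]
  exact mul_le_mul' (aux (by simpa using hb)) (aux (by simpa using hc))

theorem lintegral_enorm_le [IsProbabilityMeasure μ] {X : Ω → V}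
    (hX : AEStronglyMeasurable X μ) {b : ℝ}
    (hb : ∫⁻ ω, ‖X ω‖ₑ ^ 2 ∂μ ≤ ENNReal.ofReal b) :
    ∫⁻ ω, ‖X ω‖ₑ ∂μ ≤ ENNReal.ofReal (√b) := by
  simpa using lintegral_enorm_mul_le hX (Y := fun _ => (1 : ℝ)) aestronglyMeasurable_const
    (c := 1) hb (by simp)

end InMeasure

/-! ### Rates for stochastic approximation -/

section StochasticApproximation

variable {Ω 𝒟 : Type*} {mΩ : MeasurableSpace Ω} [MeasurableSpace 𝒟] {μ : Measure Ω}
  [IsProbabilityMeasure μ]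
  {E F : Type*} [NormedAddCommGroup E] [InnerProductSpace ℝ E] [FiniteDimensional ℝ E]
  [MeasurableSpace E] [BorelSpace E] [NormedAddCommGroup F] [InnerProductSpace ℝ F]
  [FiniteDimensional ℝ F] [MeasurableSpace F] [BorelSpace F]
  {ℱ : ℕ → MeasurableSpace Ω} {D : ℕ → Ω → 𝒟} {P : Measure 𝒟} [IsProbabilityMeasure P]
  {H : 𝒟 → E →L[ℝ] F} {ε : 𝒟 → F} {Γ : E →L[ℝ] F} {γ : ℕ → ℝ} {M : ℝ} {N : ℕ}
  {A : ℕ → Ω → F →L[ℝ] E} {Δ : ℕ → Ω → E}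

theorem enorm_sq_noiseMap_le (A B : F →L[ℝ] E) (b : E) :
    ‖noiseMap A B b‖ₑ ^ 2 ≤ ENNReal.ofReal (2 * (‖A‖ ^ 2 * ‖b‖ ^ 2 + ‖B‖ ^ 2)) := by
  rw [enorm_sq_eq_ofReal]
  refine ENNReal.ofReal_le_ofReal ((pow_le_pow_left₀ (ContinuousLinearMap.opNorm_nonneg _)
    (norm_noiseMap_le A B b) 2).trans ?_)
  nlinarith [sq_nonneg (‖A‖ * ‖b‖ - ‖B‖)]

theorem measurable_clm_apply {m : MeasurableSpace Ω} {B : Ω → F →L[ℝ] E} {v : Ω → F}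
    (hB : Measurable B) (hv : Measurable v) : Measurable fun ω => B ω (v ω) :=
  (isBoundedBilinearMap_apply (𝕜 := ℝ) (E := F) (F := E)).continuous.measurable.comp
    (hB.prodMk hv)

namespace IsStochApprox

theorem measurable (h : IsStochApprox ℱ D H ε Γ γ M N A Δ) (hdr : IsDriven μ ℱ D P H ε Γ) :
    ∀ i, N ≤ i → Measurable[ℱ i] (Δ i) := by
  intro i hi
  induction i, hi using Nat.le_induction with
  | base => exact h.meas_start
  | succ i hi ih =>
    have hle := hdr.mono (Nat.le_succ i)
    have e : Δ (i + 1) = fun ω => Δ i ω - γ (i + 1) • A i ω (H (D i ω) (Δ i ω) + ε (D i ω)) := by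
      funext ω
      exact h.recursion i hi ω
    have hΔ : Measurable[ℱ (i + 1)] (Δ i) := ih.mono hle le_rfl
    have hH : Measurable[ℱ (i + 1)] fun ω => H (D i ω) := hdr.measH.comp (hdr.meas i)
    have hε : Measurable[ℱ (i + 1)] fun ω => ε (D i ω) := hdr.measε.comp (hdr.meas i)
    have hA : Measurable[ℱ (i + 1)] (A i) := (h.measA i).mono hle le_rfl
    have h1 : Measurable[ℱ (i + 1)] fun ω => H (D i ω) (Δ i ω) + ε (D i ω) := (measurable_clm_apply hH hΔ).add hε
    have h2 : Measurable[ℱ (i + 1)] fun ω => A i ω (H (D i ω) (Δ i ω) + ε (D i ω)) := measurable_clm_apply hA h1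
    rw [e]
    exact hΔ.sub (h2.const_smul (γ (i + 1)))

/-- Splitting `H = Γ + (H - Γ)` separates a drift known from the past from centered noise. The drift
contracts because `A_i Γ` is close to the identity; the noise is orthogonal to it and contributes at
most `2M²V γ² (E‖Δ_i‖² + 1)`, where `V` is `noiseVar`. -/
theorem lintegral_step_le (h : IsStochApprox ℱ D H ε Γ γ M N A Δ) (hdr : IsDriven μ ℱ D P H ε Γ)
    {i : ℕ} (hi : N ≤ i) (hγ0 : 0 ≤ γ (i + 1)) (hγ1 : γ (i + 1) ≤ 1) :
    ∫⁻ ω, ‖Δ (i + 1) ω‖ₑ ^ 2 ∂μ ≤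
      ENNReal.ofReal (1 - 3 / 4 * γ (i + 1) +
        2 * M ^ 2 * IsDriven.noiseVar P H ε Γ * γ (i + 1) ^ 2) * ∫⁻ ω, ‖Δ i ω‖ₑ ^ 2 ∂μ +
      ENNReal.ofReal (2 * M ^ 2 * IsDriven.noiseVar P H ε Γ * γ (i + 1) ^ 2) := by
  set y := γ (i + 1) with hy
  set V := IsDriven.noiseVar P H ε Γ with hV
  have hV0 : 0 ≤ V := ENNReal.toReal_nonneg
  have hΔ := h.measurable hdr i hi
  have hA := h.measA i
  have hX : Measurable[ℱ i] fun ω => Δ i ω - y • (A i ω) (Γ (Δ i ω)) := by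
    have h1 : Measurable[ℱ i] fun ω => A i ω (Γ (Δ i ω)) :=
      measurable_clm_apply hA (Γ.continuous.measurable.comp hΔ)
    exact hΔ.sub (h1.const_smul y)
  have hyA : Measurable[ℱ i] fun ω => (-y) • A i ω := hA.const_smul (-y)
  have hT : Measurable[ℱ i] fun ω => noiseMap ((-y) • A i ω) ((-y) • A i ω) (Δ i ω) :=
    measurable_noiseMap hyA hyA hΔ
  have key := hdr.lintegral_add_noise_le i hX hT
  have e : ∀ ω, Δ (i + 1) ω = Δ i ω - y • (A i ω) (Γ (Δ i ω)) +
      noiseMap ((-y) • A i ω) ((-y) • A i ω) (Δ i ω) (H (D i ω) - Γ, ε (D i ω)) := by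
    intro ω
    have hs (v : F) : ((-y) • A i ω) v = -(y • A i ω v) := by simp
    rw [h.recursion i hi ω, noiseMap_apply, hs, hs, ← hy]
    simp only [_root_.sub_apply, map_add, map_sub, smul_add, smul_sub]
    abel
  simp_rw [← e] at key
  have hΔm : Measurable (Δ i) := hΔ.mono (hdr.le i) le_rfl
  have b1 : ∫⁻ ω, ‖Δ i ω - y • (A i ω) (Γ (Δ i ω))‖ₑ ^ 2 ∂μ ≤
      ENNReal.ofReal (1 - 3 / 4 * y) * ∫⁻ ω, ‖Δ i ω‖ₑ ^ 2 ∂μ := by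
    rw [← lintegral_const_mul _ (hΔm.enorm.pow_const 2)]
    refine lintegral_mono fun ω => ?_
    rw [enorm_sq_eq_ofReal, enorm_sq_eq_ofReal, ← ENNReal.ofReal_mul (by linarith)]
    refine ENNReal.ofReal_le_ofReal ?_
    have e1 : Δ i ω - y • (A i ω) (Γ (Δ i ω)) =
        (1 - y) • Δ i ω - y • (((A i ω).comp Γ - 1) (Δ i ω)) := by
      simp only [_root_.sub_apply, ContinuousLinearMap.comp_apply,
        one_apply_eq_self, smul_sub, sub_smul, one_smul]
      abel
    -- The identity part contributes `1 - y`, the deviation of `A_i Γ` from it at most `y/4`.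
    have n1 : ‖Δ i ω - y • (A i ω) (Γ (Δ i ω))‖ ≤ (1 - 3 / 4 * y) * ‖Δ i ω‖ := by
      rw [e1]
      refine (norm_sub_le _ _).trans ?_
      rw [norm_smul, norm_smul, Real.norm_of_nonneg hγ0, Real.norm_of_nonneg (by linarith)]
      have n2 := (((A i ω).comp Γ - 1).le_opNorm (Δ i ω)).trans
        (mul_le_mul_of_nonneg_right (h.leftInv i ω) (norm_nonneg _))
      nlinarith [mul_le_mul_of_nonneg_left n2 hγ0]
    calc ‖Δ i ω - y • (A i ω) (Γ (Δ i ω))‖ ^ 2 ≤ ((1 - 3 / 4 * y) * ‖Δ i ω‖) ^ 2 := by gcongr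
      _ = (1 - 3 / 4 * y) ^ 2 * ‖Δ i ω‖ ^ 2 := by ring
      _ ≤ (1 - 3 / 4 * y) * ‖Δ i ω‖ ^ 2 := by
          gcongr
          nlinarith
  have b2 : ∫⁻ ω, ‖noiseMap ((-y) • A i ω) ((-y) • A i ω) (Δ i ω)‖ₑ ^ 2 ∂μ ≤
      ENNReal.ofReal (2 * M ^ 2 * y ^ 2) * (∫⁻ ω, ‖Δ i ω‖ₑ ^ 2 ∂μ + 1) := by
    have : ∫⁻ ω, ‖Δ i ω‖ₑ ^ 2 ∂μ + 1 = ∫⁻ ω, (‖Δ i ω‖ₑ ^ 2 + 1) ∂μ := by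
      rw [lintegral_add_right _ measurable_const]
      simp
    rw [this, ← lintegral_const_mul _ ((hΔm.enorm.pow_const 2).add_const 1)]
    refine lintegral_mono fun ω => ?_
    refine (enorm_sq_noiseMap_le _ _ _).trans ?_
    rw [enorm_sq_eq_ofReal, ← ENNReal.ofReal_one,
      ← ENNReal.ofReal_add (by positivity) one_pos.le, ← ENNReal.ofReal_mul (by positivity)]
    refine ENNReal.ofReal_le_ofReal ?_
    rw [norm_smul, norm_neg, Real.norm_of_nonneg hγ0]
    have n1 : y * ‖A i ω‖ ≤ y * M := mul_le_mul_of_nonneg_left (h.normA_le i ω) hγ0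
    calc 2 * ((y * ‖A i ω‖) ^ 2 * ‖Δ i ω‖ ^ 2 + (y * ‖A i ω‖) ^ 2)
        ≤ 2 * ((y * M) ^ 2 * ‖Δ i ω‖ ^ 2 + (y * M) ^ 2) := by gcongr
      _ = _ := by ring
  refine key.trans ((add_le_add b1 (mul_le_mul_left b2 _)).trans ?_)
  rw [ENNReal.ofReal_add (by linarith) (by positivity), add_mul, mul_add, mul_one, add_mul,
    show 2 * M ^ 2 * V * y ^ 2 = 2 * M ^ 2 * y ^ 2 * V by ring,
    ENNReal.ofReal_mul (p := 2 * M ^ 2 * y ^ 2) (by positivity), add_assoc]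
  refine le_of_eq ?_
  congr 2
  ring

/-- Second moments of a stochastic approximation decay at the rate of the learning rate, uniformly
over the preconditioners. -/
theorem exists_lintegral_le (P : Measure 𝒟) [IsProbabilityMeasure P] (H : 𝒟 → E →L[ℝ] F)
    (ε : 𝒟 → F) (Γ : E →L[ℝ] F) (M : ℝ) {γ0 a : ℝ} (hγ0 : 0 < γ0) (ha0 : 0 < a) (ha1 : a < 1) :
    ∃ N0 : ℕ, 1 ≤ N0 ∧ ∀ N ≥ N0, ∀ L : ℝ, ∃ K : ℝ, 0 ≤ K ∧
      ∀ (ℱ : ℕ → MeasurableSpace Ω) (D : ℕ → Ω → 𝒟), IsDriven μ ℱ D P H ε Γ →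
      ∀ (A : ℕ → Ω → F →L[ℝ] E) (Δ : ℕ → Ω → E),
        IsStochApprox ℱ D H ε Γ (fun i => γ0 * (i : ℝ) ^ (-a)) M N A Δ →
        ∫⁻ ω, ‖Δ N ω‖ₑ ^ 2 ∂μ ≤ ENNReal.ofReal L →
        ∀ i ≥ N, ∫⁻ ω, ‖Δ i ω‖ₑ ^ 2 ∂μ ≤ ENNReal.ofReal (K * (i : ℝ) ^ (-a)) := by
  obtain ⟨N0, h1, h2, h3⟩ := exists_rate (c := 2 * M ^ 2 * IsDriven.noiseVar P H ε Γ) hγ0 ha0 ha1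
    (mul_nonneg (by positivity) ENNReal.toReal_nonneg)
  refine ⟨N0, h1, fun N hN L => ?_⟩
  obtain ⟨K, hK0, hK⟩ := h3 N hN L
  refine ⟨K, hK0, fun ℱ D hdr A Δ h hL i hi => ?_⟩
  exact hK (fun i => ∫⁻ ω, ‖Δ i ω‖ₑ ^ 2 ∂μ) hL
    (fun i hi => h.lintegral_step_le hdr hi (by positivity) (h2 i (hN.trans hi))) i hi

end IsStochApprox

end StochasticApproximation

end

/-! ### Averages and weighted increments of a stochastic approximation -/

section

section

variable {Ω V : Type*} {mΩ : MeasurableSpace Ω} {μ : Measure Ω} [NormedAddCommGroup V]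

theorem lintegral_enorm_sum_le {s : Finset ℕ} {f : ℕ → Ω → V} {b : ℕ → ℝ}
    (hf : ∀ i ∈ s, AEStronglyMeasurable (f i) μ) (hb0 : ∀ i ∈ s, 0 ≤ b i)
    (hb : ∀ i ∈ s, ∫⁻ ω, ‖f i ω‖ₑ ∂μ ≤ ENNReal.ofReal (b i)) :
    ∫⁻ ω, ‖∑ i ∈ s, f i ω‖ₑ ∂μ ≤ ENNReal.ofReal (∑ i ∈ s, b i) := by
  calc ∫⁻ ω, ‖∑ i ∈ s, f i ω‖ₑ ∂μ ≤ ∫⁻ ω, ∑ i ∈ s, ‖f i ω‖ₑ ∂μ :=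
        lintegral_mono fun ω => enorm_sum_le s _
    _ = ∑ i ∈ s, ∫⁻ ω, ‖f i ω‖ₑ ∂μ := lintegral_finsetSum' s fun i hi => (hf i hi).enorm
    _ ≤ ∑ i ∈ s, ENNReal.ofReal (b i) := Finset.sum_le_sum hb
    _ = _ := (ENNReal.ofReal_sum_of_nonneg hb0).symm

theorem tendstoInMeasure_smul_of_lintegral_le [NormedSpace ℝ V] {c b : ℕ → ℝ} {f : ℕ → Ω → V}
    (hc : ∀ n, 0 ≤ c n) (hf : ∀ n, AEStronglyMeasurable (f n) μ)
    (hb : ∀ᶠ n in atTop, ∫⁻ ω, ‖f n ω‖ₑ ∂μ ≤ ENNReal.ofReal (b n))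
    (hcb : Tendsto (fun n => c n * b n) atTop (𝓝 0)) :
    TendstoInMeasure μ (fun n ω => c n • f n ω) atTop 0 := by
  refine tendstoInMeasure_zero_of_lintegral (fun n => (hf n).const_smul (c n)) ?_
  have h0 : Tendsto (fun n => ENNReal.ofReal (c n * b n)) atTop (𝓝 0) := by
    simpa [Function.comp_def] using (ENNReal.continuous_ofReal.tendsto 0).comp hcb
  refine tendsto_of_tendsto_of_tendsto_of_le_of_le' tendsto_const_nhds h0
    (Eventually.of_forall fun _ => zero_le) ?_
  filter_upwards [hb] with n hn
  have e : ∀ ω, ‖c n • f n ω‖ₑ = ENNReal.ofReal (c n) * ‖f n ω‖ₑ := fun ω => by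
    rw [enorm_smul, Real.enorm_of_nonneg (hc n)]
  simp_rw [e]
  rw [lintegral_const_mul'' _ (hf n).enorm, ENNReal.ofReal_mul (hc n)]
  gcongr

end

/-- Abel summation. -/
theorem sum_Ico_smul_sub {V : Type*} [AddCommGroup V] [Module ℝ V] (c : ℕ → ℝ) (x : ℕ → V)
    {N n : ℕ} (h : N ≤ n) :
    ∑ i ∈ Finset.Ico N n, c (i + 1) • (x i - x (i + 1)) =
      c N • x N - c n • x n + ∑ i ∈ Finset.Ico N n, (c (i + 1) - c i) • x i := by
  induction n, h using Nat.le_induction with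
  | base => simp
  | succ n hn ih =>
    rw [Finset.sum_Ico_succ_top hn, Finset.sum_Ico_succ_top hn, ih]
    simp only [smul_sub, sub_smul]
    abel

/-- With `x = i^{a/2}` and `y = (i+1)^{a/2}` the left side is `(y - x)(y + x)/x`, and `y ≤ 2x`. The
right side telescopes, which handles the sum left over by Abel summation. -/
theorem rpow_succ_sub_rpow_mul_le {a : ℝ} (ha0 : 0 ≤ a) (ha1 : a ≤ 1) {i : ℕ} (hi : 1 ≤ i) :
    (((i + 1 : ℕ) : ℝ) ^ a - (i : ℝ) ^ a) * (i : ℝ) ^ (-(a / 2)) ≤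
      3 * (((i + 1 : ℕ) : ℝ) ^ (a / 2) - (i : ℝ) ^ (a / 2)) := by
  have hi0 : (0 : ℝ) < i := by exact_mod_cast hi
  have hi1 : (1 : ℝ) ≤ i := by exact_mod_cast hi
  have hs0 : (0 : ℝ) < ((i + 1 : ℕ) : ℝ) := by positivity
  set x := (i : ℝ) ^ (a / 2) with hx
  set y := ((i + 1 : ℕ) : ℝ) ^ (a / 2) with hy
  have hx0 : 0 < x := by positivity
  have e1 : (i : ℝ) ^ a = x ^ 2 := by
    rw [hx, ← Real.rpow_natCast, ← Real.rpow_mul hi0.le]; norm_num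
  have e2 : ((i + 1 : ℕ) : ℝ) ^ a = y ^ 2 := by
    rw [hy, ← Real.rpow_natCast, ← Real.rpow_mul hs0.le]; norm_num
  have e3 : (i : ℝ) ^ (-(a / 2)) = x⁻¹ := by rw [Real.rpow_neg hi0.le]
  have hxy : x ≤ y := Real.rpow_le_rpow hi0.le (by push_cast; linarith) (by positivity)
  have hyx : y ≤ 2 * x := by
    calc y ≤ (2 * i : ℝ) ^ (a / 2) :=
          Real.rpow_le_rpow hs0.le (by push_cast; linarith) (by positivity)
      _ = 2 ^ (a / 2) * x := by rw [Real.mul_rpow (by norm_num) hi0.le]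
      _ ≤ 2 ^ (1 : ℝ) * x := by
          gcongr
          · norm_num
          · linarith
      _ = 2 * x := by rw [Real.rpow_one]
  rw [e1, e2, e3, ← div_eq_mul_inv, div_le_iff₀ hx0]
  nlinarith

section StochasticApproximation

variable {Ω 𝒟 : Type*} {mΩ : MeasurableSpace Ω} [MeasurableSpace 𝒟] {μ : Measure Ω}
  [IsProbabilityMeasure μ]
  {E F : Type*} [NormedAddCommGroup E] [InnerProductSpace ℝ E] [FiniteDimensional ℝ E]
  [MeasurableSpace E] [BorelSpace E] [NormedAddCommGroup F] [InnerProductSpace ℝ F]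
  [FiniteDimensional ℝ F] [MeasurableSpace F] [BorelSpace F]
  {ℱ : ℕ → MeasurableSpace Ω} {D : ℕ → Ω → 𝒟} {P : Measure 𝒟} [IsProbabilityMeasure P]
  {H : 𝒟 → E →L[ℝ] F} {ε : 𝒟 → F} {Γ : E →L[ℝ] F} {γ : ℕ → ℝ} {M : ℝ} {N : ℕ}
  {A : ℕ → ℕ → Ω → F →L[ℝ] E} {Δ : ℕ → ℕ → Ω → E}

theorem sqrt_mul_rpow_neg {K a : ℝ} (hK : 0 ≤ K) (i : ℕ) :
    √(K * (i : ℝ) ^ (-a)) = √K * (i : ℝ) ^ (-(a / 2)) := by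
  rw [Real.sqrt_mul hK, Real.sqrt_eq_rpow ((i : ℝ) ^ (-a)), ← Real.rpow_mul (by positivity)]
  congr 2
  ring

/-- The index `max N n` keeps the path inside the range where it is controlled; it equals `n` from
`N` on. -/
theorem tendstoInMeasure_last {a K : ℝ} (ha0 : 0 < a)
    (hm : ∀ n i, N ≤ i → Measurable (Δ n i))
    (hK : ∀ n, ∀ i ≥ N, ∫⁻ ω, ‖Δ n i ω‖ₑ ^ 2 ∂μ ≤ ENNReal.ofReal (K * (i : ℝ) ^ (-a))) :
    TendstoInMeasure μ (fun n ω => Δ n (max N n) ω) atTop 0 := by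
  refine tendstoInMeasure_zero_of_lintegral_sq
    (fun n => (hm n _ (le_max_left _ _)).aestronglyMeasurable) ?_
  have h0 : Tendsto (fun n : ℕ => ENNReal.ofReal (K * (n : ℝ) ^ (-a))) atTop (𝓝 0) := by
    have := (tendsto_natCast_rpow_neg ha0).const_mul K
    simpa [Function.comp_def] using (ENNReal.continuous_ofReal.tendsto _).comp this
  refine tendsto_of_tendsto_of_tendsto_of_le_of_le' tendsto_const_nhds h0
    (Eventually.of_forall fun _ => zero_le) ?_
  filter_upwards [eventually_ge_atTop N] with n hn
  rw [max_eq_right hn]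
  exact hK n n hn

/-- First moments are `O(i^{-a/2})`, so their sum is `O(n^{1-a/2})` and the average is
`O(n^{-a/2})`. -/
theorem tendstoInMeasure_average {a K : ℝ} (ha0 : 0 < a) (ha1 : a < 1) (hN : 1 ≤ N) (hK0 : 0 ≤ K)
    (hm : ∀ n i, N ≤ i → Measurable (Δ n i))
    (hK : ∀ n, ∀ i ≥ N, ∫⁻ ω, ‖Δ n i ω‖ₑ ^ 2 ∂μ ≤ ENNReal.ofReal (K * (i : ℝ) ^ (-a))) :
    TendstoInMeasure μ (fun (n : ℕ) ω => (n : ℝ)⁻¹ • ∑ i ∈ Finset.Ico N n, Δ n i ω) atTop 0 := by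
  refine tendstoInMeasure_smul_of_lintegral_le
    (b := fun n => √K * ((n : ℝ) ^ (1 - a / 2) / (1 - a / 2))) (fun n => by positivity)
    (fun n => ?_) (Eventually.of_forall fun n => ?_) ?_
  · exact (Finset.measurable_fun_sum _ fun i hi =>
      hm n i (Finset.mem_Ico.1 hi).1).aestronglyMeasurable
  · refine (lintegral_enorm_sum_le (b := fun i => √K * (i : ℝ) ^ (-(a / 2)))
      (fun i hi => (hm n i (Finset.mem_Ico.1 hi).1).aestronglyMeasurable)
      (fun i _ => by positivity) fun i hi => ?_).trans (ENNReal.ofReal_le_ofReal ?_)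
    · have hi' := (Finset.mem_Ico.1 hi).1
      rw [← sqrt_mul_rpow_neg hK0]
      exact lintegral_enorm_le (hm n i hi').aestronglyMeasurable (hK n i hi')
    · rw [← Finset.mul_sum]
      gcongr
      have := sum_rpow_sub_one_le (p := 1 - a / 2) (by linarith) (by linarith) hN n
      simpa using this
  · have h := (tendsto_natCast_rpow_neg (a := a / 2) (by positivity)).const_mul (√K / (1 - a / 2))
    rw [mul_zero] at h
    refine h.congr' ?_
    filter_upwards [eventually_ge_atTop 1] with n hn
    have hn0 : (0 : ℝ) < n := by exact_mod_cast hn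
    have : (n : ℝ) ^ (1 - a / 2) = n * (n : ℝ) ^ (-(a / 2)) := by
      rw [sub_eq_add_neg, Real.rpow_add hn0, Real.rpow_one]
    rw [this]
    field_simp

/-- The sum of weighted increments is negligible at the root-n scale. -/
theorem tendstoInMeasure_sum_increments {a γ0 K : ℝ} (ha0 : 0 < a) (ha1 : a < 1) (hγ0 : 0 < γ0)
    (hN : 1 ≤ N) (hK0 : 0 ≤ K) (hm : ∀ n i, N ≤ i → Measurable (Δ n i))
    (hK : ∀ n, ∀ i ≥ N, ∫⁻ ω, ‖Δ n i ω‖ₑ ^ 2 ∂μ ≤ ENNReal.ofReal (K * (i : ℝ) ^ (-a))) :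
    TendstoInMeasure μ (fun (n : ℕ) ω => (√(n : ℝ))⁻¹ • ∑ i ∈ Finset.Ico N n,
      (γ0 * ((i + 1 : ℕ) : ℝ) ^ (-a))⁻¹ • (Δ n i ω - Δ n (i + 1) ω)) atTop 0 := by
  have hΔ1 (n i : ℕ) (hi : N ≤ i) :
      ∫⁻ ω, ‖Δ n i ω‖ₑ ∂μ ≤ ENNReal.ofReal (√K * (i : ℝ) ^ (-(a / 2))) := by
    rw [← sqrt_mul_rpow_neg hK0]
    exact lintegral_enorm_le (hm n i hi).aestronglyMeasurable (hK n i hi)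
  have hsm (c : ℝ) (hc : 0 ≤ c) (n i : ℕ) (hi : N ≤ i) :
      ∫⁻ ω, ‖c • Δ n i ω‖ₑ ∂μ ≤ ENNReal.ofReal (c * (√K * (i : ℝ) ^ (-(a / 2)))) := by
    have e : ∀ ω, ‖c • Δ n i ω‖ₑ = ENNReal.ofReal c * ‖Δ n i ω‖ₑ := fun ω => by
      rw [enorm_smul, Real.enorm_of_nonneg hc]
    simp_rw [e]
    rw [lintegral_const_mul _ (hm n i hi).enorm, ENNReal.ofReal_mul hc]
    gcongr
    exact hΔ1 n i hi
  have hc (i : ℕ) : (γ0 * (i : ℝ) ^ (-a))⁻¹ = γ0⁻¹ * (i : ℝ) ^ a := by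
    rw [mul_inv, Real.rpow_neg (by positivity), inv_inv]
  refine tendstoInMeasure_smul_of_lintegral_le
    -- The constant is `1 + 1 + 3`: two boundary terms of Abel summation and the factor in
    -- `rpow_succ_sub_rpow_mul_le`. The order `n^{a/2}` is below `√n` because `a < 1`.
    (b := fun n => 5 * γ0⁻¹ * √K * (n : ℝ) ^ (a / 2)) (fun n => by positivity) (fun n => ?_) ?_ ?_
  · refine (Finset.measurable_fun_sum _ fun i hi => ?_).aestronglyMeasurable
    have hi' := (Finset.mem_Ico.1 hi).1
    exact ((hm n i hi').sub (hm n (i + 1) (hi'.trans (Nat.le_succ i)))).const_smul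
      (γ0 * ((i + 1 : ℕ) : ℝ) ^ (-a))⁻¹
  · filter_upwards [eventually_ge_atTop N] with n hn
    have hmono {i : ℕ} : (i : ℝ) ^ a ≤ ((i + 1 : ℕ) : ℝ) ^ a :=
      Real.rpow_le_rpow (by positivity) (by push_cast; linarith) ha0.le
    -- Abel summation moves the differences from the path onto the weights `γ⁻¹`, proportional to
    -- `i^a`.
    have e (ω : Ω) : ‖∑ i ∈ Finset.Ico N n,
        (γ0 * ((i + 1 : ℕ) : ℝ) ^ (-a))⁻¹ • (Δ n i ω - Δ n (i + 1) ω)‖ₑ ≤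
        ‖(γ0⁻¹ * (N : ℝ) ^ a) • Δ n N ω‖ₑ + ‖(γ0⁻¹ * (n : ℝ) ^ a) • Δ n n ω‖ₑ +
        ‖∑ i ∈ Finset.Ico N n,
          (γ0⁻¹ * (((i + 1 : ℕ) : ℝ) ^ a - (i : ℝ) ^ a)) • Δ n i ω‖ₑ := by
      rw [sum_Ico_smul_sub (fun i => (γ0 * (i : ℝ) ^ (-a))⁻¹) (fun i => Δ n i ω) hn]
      simp only [hc, ← mul_sub]
      exact (enorm_add_le _ _).trans (by gcongr; exact enorm_sub_le)
    have mN := (hm n N le_rfl).const_smul (γ0⁻¹ * (N : ℝ) ^ a)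
    have mn := (hm n n hn).const_smul (γ0⁻¹ * (n : ℝ) ^ a)
    have hpow (i : ℕ) (hi : N ≤ i) : (i : ℝ) ^ a * (i : ℝ) ^ (-(a / 2)) = (i : ℝ) ^ (a / 2) := by
      have : (0 : ℝ) < i := by exact_mod_cast hN.trans hi
      rw [← Real.rpow_add this]
      ring_nf
    calc _ ≤ ∫⁻ ω, (‖(γ0⁻¹ * (N : ℝ) ^ a) • Δ n N ω‖ₑ + ‖(γ0⁻¹ * (n : ℝ) ^ a) • Δ n n ω‖ₑ +
          ‖∑ i ∈ Finset.Ico N n,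
            (γ0⁻¹ * (((i + 1 : ℕ) : ℝ) ^ a - (i : ℝ) ^ a)) • Δ n i ω‖ₑ) ∂μ := lintegral_mono e
      _ = ∫⁻ ω, ‖(γ0⁻¹ * (N : ℝ) ^ a) • Δ n N ω‖ₑ ∂μ + ∫⁻ ω, ‖(γ0⁻¹ * (n : ℝ) ^ a) • Δ n n ω‖ₑ ∂μ +
          ∫⁻ ω, ‖∑ i ∈ Finset.Ico N n,
            (γ0⁻¹ * (((i + 1 : ℕ) : ℝ) ^ a - (i : ℝ) ^ a)) • Δ n i ω‖ₑ ∂μ := by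
          rw [lintegral_add_left, lintegral_add_left]
          · exact mN.enorm
          · exact mN.enorm.add mn.enorm
      _ ≤ ENNReal.ofReal (γ0⁻¹ * √K * (n : ℝ) ^ (a / 2)) +
          ENNReal.ofReal (γ0⁻¹ * √K * (n : ℝ) ^ (a / 2)) +
          ENNReal.ofReal (3 * γ0⁻¹ * √K * (n : ℝ) ^ (a / 2)) := by
          gcongr ?_ + ?_ + ?_
          · refine (hsm _ (by positivity) n N le_rfl).trans (ENNReal.ofReal_le_ofReal ?_)
            calc γ0⁻¹ * (N : ℝ) ^ a * (√K * (N : ℝ) ^ (-(a / 2)))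
                = γ0⁻¹ * √K * ((N : ℝ) ^ a * (N : ℝ) ^ (-(a / 2))) := by ring
              _ ≤ _ := by
                rw [hpow N le_rfl]
                gcongr
          · refine (hsm _ (by positivity) n n hn).trans (ENNReal.ofReal_le_ofReal ?_)
            calc γ0⁻¹ * (n : ℝ) ^ a * (√K * (n : ℝ) ^ (-(a / 2)))
                = γ0⁻¹ * √K * ((n : ℝ) ^ a * (n : ℝ) ^ (-(a / 2))) := by ring
              _ ≤ _ := by rw [hpow n hn]
          · have hnn (i : ℕ) : 0 ≤ γ0⁻¹ * (((i + 1 : ℕ) : ℝ) ^ a - (i : ℝ) ^ a) :=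
              mul_nonneg (by positivity) (sub_nonneg.2 hmono)
            refine (lintegral_enorm_sum_le (b := fun i =>
              (γ0⁻¹ * (((i + 1 : ℕ) : ℝ) ^ a - (i : ℝ) ^ a)) * (√K * (i : ℝ) ^ (-(a / 2))))
              (fun i hi => ?_) (fun i hi => ?_) (fun i hi => ?_)).trans
              (ENNReal.ofReal_le_ofReal ?_)
            · exact ((hm n i (Finset.mem_Ico.1 hi).1).const_smul _).aestronglyMeasurable
            · exact mul_nonneg (hnn i) (by positivity)
            · exact hsm _ (hnn i) n i (Finset.mem_Ico.1 hi).1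
            · calc _ ≤ ∑ i ∈ Finset.Ico N n, γ0⁻¹ * √K *
                    (3 * (((i + 1 : ℕ) : ℝ) ^ (a / 2) - (i : ℝ) ^ (a / 2))) := by
                    refine Finset.sum_le_sum fun i hi => ?_
                    have := rpow_succ_sub_rpow_mul_le ha0.le ha1.le
                      (hN.trans (Finset.mem_Ico.1 hi).1)
                    calc _ = γ0⁻¹ * √K * ((((i + 1 : ℕ) : ℝ) ^ a - (i : ℝ) ^ a) *
                        (i : ℝ) ^ (-(a / 2))) := by ring
                      _ ≤ _ := by gcongr
                _ = γ0⁻¹ * √K * (3 * ((n : ℝ) ^ (a / 2) - (N : ℝ) ^ (a / 2))) := by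
                    rw [← Finset.mul_sum, ← Finset.mul_sum,
                      Finset.sum_Ico_sub (fun i : ℕ => (i : ℝ) ^ (a / 2)) hn]
                _ ≤ γ0⁻¹ * √K * (3 * (n : ℝ) ^ (a / 2)) := by
                    gcongr
                    exact sub_le_self _ (by positivity)
                _ = _ := by ring
      _ = _ := by
          rw [← ENNReal.ofReal_add (by positivity) (by positivity),
            ← ENNReal.ofReal_add (by positivity) (by positivity)]
          ring_nf
  · have := (tendsto_inv_sqrt_mul_rpow (p := a / 2) (by linarith)).const_mul (5 * γ0⁻¹ * √K)
    rw [mul_zero] at this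
    refine this.congr fun n => by ring

end StochasticApproximation

end

/-! ### Remainder, martingale part and asymptotic linearity -/

section

section StochasticApproximation

variable {Ω 𝒟 : Type*} {mΩ : MeasurableSpace Ω} [MeasurableSpace 𝒟] {μ : Measure Ω}
  [IsProbabilityMeasure μ]
  {E F : Type*} [NormedAddCommGroup E] [InnerProductSpace ℝ E] [FiniteDimensional ℝ E]
  [MeasurableSpace E] [BorelSpace E] [NormedAddCommGroup F] [InnerProductSpace ℝ F]
  [FiniteDimensional ℝ F] [MeasurableSpace F] [BorelSpace F]
  {ℱ : ℕ → MeasurableSpace Ω} {D : ℕ → Ω → 𝒟} {P : Measure 𝒟} [IsProbabilityMeasure P]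
  {H : 𝒟 → E →L[ℝ] F} {ε : 𝒟 → F} {Γ : E →L[ℝ] F} {γ : ℕ → ℝ} {M : ℝ} {N : ℕ}
  {A : ℕ → ℕ → Ω → F →L[ℝ] E} {Δ : ℕ → ℕ → Ω → E}

/-- The remainder caused by the inexact left inverse is negligible at the root-n scale. -/
theorem tendstoInMeasure_sum_remainder {a K C : ℝ} (ha0 : 0 < a) (ha1 : a < 1)
    (hN : 1 ≤ N) (hK0 : 0 ≤ K) (hC0 : 0 ≤ C) (hm : ∀ n i, N ≤ i → Measurable (Δ n i))
    (hAm : ∀ n i, Measurable (A n i))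
    (hK : ∀ n, ∀ i ≥ N, ∫⁻ ω, ‖Δ n i ω‖ₑ ^ 2 ∂μ ≤ ENNReal.ofReal (K * (i : ℝ) ^ (-a)))
    {ρ : ℕ → Ω → ℝ} (hρm : ∀ i, Measurable (ρ i))
    (hρ : ∀ i ≥ N, ∫⁻ ω, ‖ρ i ω‖ₑ ^ 2 ∂μ ≤ ENNReal.ofReal (C * (i : ℝ) ^ (-1 : ℝ)))
    (hAρ : ∀ n i ω, ‖(A n i ω).comp Γ - 1‖ ≤ ρ i ω) :
    TendstoInMeasure μ (fun (n : ℕ) ω => (√(n : ℝ))⁻¹ • ∑ i ∈ Finset.Ico N n,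
      ((A n i ω) (Γ (Δ n i ω)) - Δ n i ω)) atTop 0 := by
  have hmeas (n i : ℕ) (hi : N ≤ i) :
      Measurable fun ω => (A n i ω) (Γ (Δ n i ω)) - Δ n i ω :=
    (measurable_clm_apply (hAm n i) (Γ.continuous.measurable.comp (hm n i hi))).sub (hm n i hi)
  refine tendstoInMeasure_smul_of_lintegral_le
    (b := fun n => √C * √K * ((n : ℝ) ^ ((1 - a) / 2) / ((1 - a) / 2))) (fun n => by positivity)
    (fun n => ?_) (Eventually.of_forall fun n => ?_) ?_
  · exact (Finset.measurable_fun_sum _ fun i hi =>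
      hmeas n i (Finset.mem_Ico.1 hi).1).aestronglyMeasurable
  · refine (lintegral_enorm_sum_le (b := fun i => √C * √K * (i : ℝ) ^ ((1 - a) / 2 - 1))
      (fun i hi => (hmeas n i (Finset.mem_Ico.1 hi).1).aestronglyMeasurable)
      (fun i _ => by positivity) fun i hi => ?_).trans (ENNReal.ofReal_le_ofReal ?_)
    · have hi' := (Finset.mem_Ico.1 hi).1
      have hi0 : (0 : ℝ) < i := by exact_mod_cast hN.trans hi'
      -- Cauchy–Schwarz: the inexactness has `L²` size `i^{-1/2}` and the error `i^{-a/2}`, so the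
      -- sum is `O(n^{(1-a)/2})`, below `√n`.
      calc ∫⁻ ω, ‖(A n i ω) (Γ (Δ n i ω)) - Δ n i ω‖ₑ ∂μ
          ≤ ∫⁻ ω, ‖ρ i ω‖ₑ * ‖Δ n i ω‖ₑ ∂μ := by
            refine lintegral_mono fun ω => ?_
            have h1 : ‖(A n i ω) (Γ (Δ n i ω)) - Δ n i ω‖ ≤ ‖ρ i ω‖ * ‖Δ n i ω‖ := by
              have := ((A n i ω).comp Γ - 1).le_opNorm (Δ n i ω)
              refine (le_trans (by simp) this).trans ?_
              gcongr
              exact (hAρ n i ω).trans (le_abs_self _)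
            have h2 := ENNReal.ofReal_le_ofReal h1
            rwa [ENNReal.ofReal_mul (norm_nonneg _), ofReal_norm, ofReal_norm, ofReal_norm] at h2
        _ ≤ ENNReal.ofReal (√(C * (i : ℝ) ^ (-1 : ℝ)) * √(K * (i : ℝ) ^ (-a))) :=
            lintegral_enorm_mul_le (hρm i).aestronglyMeasurable (hm n i hi').aestronglyMeasurable
              (hρ i hi') (hK n i hi')
        _ = _ := by
            rw [sqrt_mul_rpow_neg hC0, sqrt_mul_rpow_neg hK0]
            congr 1
            rw [show (1 - a) / 2 - 1 = -(1 / 2) + -(a / 2) by ring, Real.rpow_add hi0]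
            ring
    · rw [← Finset.mul_sum]
      gcongr
      exact sum_rpow_sub_one_le (p := (1 - a) / 2) (by linarith) (by linarith) hN n
  · have h := (tendsto_inv_sqrt_mul_rpow (p := (1 - a) / 2) (by linarith)).const_mul
      (√C * √K / ((1 - a) / 2))
    rw [mul_zero] at h
    refine h.congr fun n => by ring

/-- The summands are martingale differences, so second moments add; the induction adds one summand
at a time to a past-measurable partial sum. -/
theorem lintegral_sum_noise_le (hdr : IsDriven μ ℱ D P H ε Γ)
    {T : ℕ → Ω → ((E →L[ℝ] F) × F) →L[ℝ] E} (hT : ∀ i, N ≤ i → Measurable[ℱ i] (T i)) (n : ℕ) :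
    ∫⁻ ω, ‖∑ i ∈ Finset.Ico N n, T i ω (H (D i ω) - Γ, ε (D i ω))‖ₑ ^ 2 ∂μ ≤
      (∑ i ∈ Finset.Ico N n, ∫⁻ ω, ‖T i ω‖ₑ ^ 2 ∂μ) *
        ENNReal.ofReal (IsDriven.noiseVar P H ε Γ) := by
  rcases le_total n N with h | h
  · simp [Finset.Ico_eq_empty_of_le h]
  induction n, h using Nat.le_induction with
  | base => simp
  | succ n hn ih =>
    simp only [Finset.sum_Ico_succ_top hn]
    have hX : Measurable[ℱ n] fun ω =>
        ∑ i ∈ Finset.Ico N n, T i ω (H (D i ω) - Γ, ε (D i ω)) := by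
      refine Finset.measurable_fun_sum _ fun i hi => ?_
      obtain ⟨h1, h2⟩ := Finset.mem_Ico.1 hi
      have hD : Measurable[ℱ n] (D i) := (hdr.meas i).mono (hdr.mono h2) le_rfl
      have hTi : Measurable[ℱ n] (T i) := (hT i h1).mono (hdr.mono h2.le) le_rfl
      have hw : Measurable[ℱ n] fun ω => (H (D i ω) - Γ, ε (D i ω)) :=
        ((hdr.measH.comp hD).sub_const Γ).prodMk (hdr.measε.comp hD)
      exact (isBoundedBilinearMap_apply (𝕜 := ℝ) (E := (E →L[ℝ] F) × F)
        (F := E)).continuous.measurable.comp (hTi.prodMk hw)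
    refine (hdr.lintegral_add_noise_le n hX (hT n hn)).trans ?_
    rw [add_mul]
    gcongr

/-- The martingale part is asymptotically a sum of independent terms. -/
theorem tendstoInMeasure_sum_martingale {a K : ℝ} (ha0 : 0 < a) (ha1 : a < 1) (hN : 1 ≤ N)
    (hdr : IsDriven μ ℱ D P H ε Γ) (hK0 : 0 ≤ K)
    (hm : ∀ n i, N ≤ i → Measurable[ℱ i] (Δ n i)) (hAm : ∀ n i, Measurable[ℱ i] (A n i))
    (hAM : ∀ n i ω, ‖A n i ω‖ ≤ M)
    (hK : ∀ n, ∀ i ≥ N, ∫⁻ ω, ‖Δ n i ω‖ₑ ^ 2 ∂μ ≤ ENNReal.ofReal (K * (i : ℝ) ^ (-a)))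
    {As : F →L[ℝ] E}
    (hconv : Tendsto (fun n : ℕ => ENNReal.ofReal (n : ℝ)⁻¹ *
      ∑ i ∈ Finset.Ico N n, ∫⁻ ω, ‖A n i ω - As‖ₑ ^ 2 ∂μ) atTop (𝓝 0)) :
    TendstoInMeasure μ (fun (n : ℕ) ω => (√(n : ℝ))⁻¹ • ∑ i ∈ Finset.Ico N n,
      noiseMap (A n i ω) (A n i ω - As) (Δ n i ω) (H (D i ω) - Γ, ε (D i ω))) atTop 0 := by
  have hT (n i : ℕ) (hi : N ≤ i) :
      Measurable[ℱ i] fun ω => noiseMap (A n i ω) (A n i ω - As) (Δ n i ω) :=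
    measurable_noiseMap (hAm n i) ((hAm n i).sub_const As) (hm n i hi)
  have hmeas (n : ℕ) : Measurable fun ω => ∑ i ∈ Finset.Ico N n,
      noiseMap (A n i ω) (A n i ω - As) (Δ n i ω) (H (D i ω) - Γ, ε (D i ω)) := by
    refine Finset.measurable_fun_sum _ fun i hi => ?_
    have hD : Measurable (D i) := (hdr.meas i).mono (hdr.le _) le_rfl
    have hw : Measurable fun ω => (H (D i ω) - Γ, ε (D i ω)) :=
      ((hdr.measH.comp hD).sub_const Γ).prodMk (hdr.measε.comp hD)
    exact (isBoundedBilinearMap_apply (𝕜 := ℝ) (E := (E →L[ℝ] F) × F)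
      (F := E)).continuous.measurable.comp
      (((hT n i (Finset.mem_Ico.1 hi).1).mono (hdr.le i) le_rfl).prodMk hw)
  -- The first term comes from `A (H - Γ) Δ` and averages out by the rate of `Δ`; the second comes
  -- from `(A - As) ε` and averages out by `hconv`.
  have hTsq (n i : ℕ) (hi : N ≤ i) :
      ∫⁻ ω, ‖noiseMap (A n i ω) (A n i ω - As) (Δ n i ω)‖ₑ ^ 2 ∂μ ≤
        ENNReal.ofReal (2 * M ^ 2 * K * (i : ℝ) ^ (-a)) +
          2 * ∫⁻ ω, ‖A n i ω - As‖ₑ ^ 2 ∂μ := by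
    have hΔm : Measurable (Δ n i) := (hm n i hi).mono (hdr.le i) le_rfl
    calc _ ≤ ∫⁻ ω, (ENNReal.ofReal (2 * M ^ 2) * ‖Δ n i ω‖ₑ ^ 2 + 2 * ‖A n i ω - As‖ₑ ^ 2) ∂μ := by
          refine lintegral_mono fun ω => (enorm_sq_noiseMap_le _ _ _).trans ?_
          rw [enorm_sq_eq_ofReal, enorm_sq_eq_ofReal, ← ENNReal.ofReal_mul (by positivity),
            show (2 : ENNReal) = ENNReal.ofReal 2 by simp, ← ENNReal.ofReal_mul (by norm_num),
            ← ENNReal.ofReal_add (by positivity) (by positivity)]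
          refine ENNReal.ofReal_le_ofReal ?_
          have : ‖A n i ω‖ ^ 2 ≤ M ^ 2 := by
            gcongr
            exact hAM n i ω
          have := mul_le_mul_of_nonneg_right this (sq_nonneg ‖Δ n i ω‖)
          linarith
      _ = ENNReal.ofReal (2 * M ^ 2) * ∫⁻ ω, ‖Δ n i ω‖ₑ ^ 2 ∂μ +
          2 * ∫⁻ ω, ‖A n i ω - As‖ₑ ^ 2 ∂μ := by
          rw [lintegral_add_left ((hΔm.enorm.pow_const 2).const_mul _),
            lintegral_const_mul _ (hΔm.enorm.pow_const 2), lintegral_const_mul' _ _ (by simp)]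
      _ ≤ _ := by
          rw [mul_assoc (2 * M ^ 2) K, ENNReal.ofReal_mul (p := 2 * M ^ 2) (by positivity)]
          gcongr
          exact hK n i hi
  set V := IsDriven.noiseVar P H ε Γ with hV
  refine tendstoInMeasure_zero_of_lintegral_sq
    (fun n => ((hmeas n).const_smul _).aestronglyMeasurable) ?_
  have h1 : Tendsto (fun n : ℕ => ENNReal.ofReal ((n : ℝ)⁻¹ *
      (2 * M ^ 2 * K * ((n : ℝ) ^ (1 - a) / (1 - a))))) atTop (𝓝 0) := by
    have h := (tendsto_natCast_rpow_neg ha0).const_mul (2 * M ^ 2 * K / (1 - a))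
    rw [mul_zero] at h
    have h' : Tendsto (fun n : ℕ => (n : ℝ)⁻¹ * (2 * M ^ 2 * K * ((n : ℝ) ^ (1 - a) / (1 - a))))
        atTop (𝓝 0) := by
      refine h.congr' ?_
      filter_upwards [eventually_ge_atTop 1] with n hn
      have hn0 : (0 : ℝ) < n := by exact_mod_cast hn
      have : (n : ℝ) ^ (1 - a) = n * (n : ℝ) ^ (-a) := by
        rw [sub_eq_add_neg, Real.rpow_add hn0, Real.rpow_one]
      rw [this]
      field_simp
    simpa [Function.comp_def] using (ENNReal.continuous_ofReal.tendsto _).comp h'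
  have h2 := ENNReal.Tendsto.const_mul hconv (a := 2) (Or.inr (by simp))
  have h3 := ENNReal.Tendsto.mul_const (h1.add h2) (b := ENNReal.ofReal V) (Or.inr (by simp))
  simp only [mul_zero, _root_.add_zero, zero_mul] at h3
  refine tendsto_of_tendsto_of_tendsto_of_le_of_le tendsto_const_nhds h3
    (fun _ => zero_le) fun n => ?_
  have e : ∀ x : E, ‖(√(n : ℝ))⁻¹ • x‖ₑ ^ 2 = ENNReal.ofReal (n : ℝ)⁻¹ * ‖x‖ₑ ^ 2 := fun x => by
    rw [enorm_smul, mul_pow, enorm_sq_eq_ofReal (√(n : ℝ))⁻¹, Real.norm_eq_abs, sq_abs, inv_pow,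
      Real.sq_sqrt (Nat.cast_nonneg n)]
  simp_rw [e]
  rw [lintegral_const_mul _ ((hmeas n).enorm.pow_const 2)]
  calc _ ≤ ENNReal.ofReal (n : ℝ)⁻¹ * ((∑ i ∈ Finset.Ico N n,
        ∫⁻ ω, ‖noiseMap (A n i ω) (A n i ω - As) (Δ n i ω)‖ₑ ^ 2 ∂μ) * ENNReal.ofReal V) := by
        gcongr
        exact lintegral_sum_noise_le hdr (fun i hi => hT n i hi) n
    _ ≤ ENNReal.ofReal (n : ℝ)⁻¹ * ((ENNReal.ofReal (2 * M ^ 2 * K *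
        ((n : ℝ) ^ (1 - a) / (1 - a))) + 2 * ∑ i ∈ Finset.Ico N n,
          ∫⁻ ω, ‖A n i ω - As‖ₑ ^ 2 ∂μ) * ENNReal.ofReal V) := by
        gcongr
        refine (Finset.sum_le_sum fun i hi => hTsq n i (Finset.mem_Ico.1 hi).1).trans ?_
        rw [Finset.sum_add_distrib, ← Finset.mul_sum,
          ← ENNReal.ofReal_sum_of_nonneg (fun i _ => by positivity), ← Finset.mul_sum]
        gcongr
        have := sum_rpow_sub_one_le (p := 1 - a) (by linarith) (by linarith) hN n
        simpa using this
    _ = _ := by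
        rw [ENNReal.ofReal_mul (p := (n : ℝ)⁻¹) (by positivity)]
        ring

/-- Asymptotic linearity of averaged stochastic approximation. -/
theorem tendstoInMeasure_asymptotic_linearity {a γ0 K C : ℝ} (ha0 : 0 < a) (ha1 : a < 1)
    (hγ0 : 0 < γ0) (hN : 1 ≤ N) (hdr : IsDriven μ ℱ D P H ε Γ) (hK0 : 0 ≤ K) (hC0 : 0 ≤ C)
    (hSA : ∀ n, IsStochApprox ℱ D H ε Γ (fun i => γ0 * (i : ℝ) ^ (-a)) M N (A n) (Δ n))
    (hK : ∀ n, ∀ i ≥ N, ∫⁻ ω, ‖Δ n i ω‖ₑ ^ 2 ∂μ ≤ ENNReal.ofReal (K * (i : ℝ) ^ (-a)))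
    {ρ : ℕ → Ω → ℝ} (hρm : ∀ i, Measurable (ρ i))
    (hρ : ∀ i ≥ N, ∫⁻ ω, ‖ρ i ω‖ₑ ^ 2 ∂μ ≤ ENNReal.ofReal (C * (i : ℝ) ^ (-1 : ℝ)))
    (hAρ : ∀ n i ω, ‖(A n i ω).comp Γ - 1‖ ≤ ρ i ω) {As : F →L[ℝ] E}
    (hconv : Tendsto (fun n : ℕ => ENNReal.ofReal (n : ℝ)⁻¹ *
      ∑ i ∈ Finset.Ico N n, ∫⁻ ω, ‖A n i ω - As‖ₑ ^ 2 ∂μ) atTop (𝓝 0)) :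
    TendstoInMeasure μ (fun (n : ℕ) ω => (√(n : ℝ))⁻¹ • ∑ i ∈ Finset.Ico N n,
      (Δ n i ω + As (ε (D i ω)))) atTop 0 := by
  have hm (n i : ℕ) (hi : N ≤ i) : Measurable[ℱ i] (Δ n i) := (hSA n).measurable hdr i hi
  have hm' (n i : ℕ) (hi : N ≤ i) : Measurable (Δ n i) := (hm n i hi).mono (hdr.le i) le_rfl
  have h1 := tendstoInMeasure_sum_increments ha0 ha1 hγ0 hN hK0 hm' hK
  have h2 := tendstoInMeasure_sum_remainder (A := A) ha0 ha1 hN hK0 hC0 hm'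
    (fun n i => ((hSA n).measA i).mono (hdr.le i) le_rfl) hK hρm hρ hAρ
  have h3 := tendstoInMeasure_sum_martingale ha0 ha1 hN hdr hK0 hm (fun n i => (hSA n).measA i)
    (fun n i => (hSA n).normA_le i) hK hconv
  -- The recursion gives termwise `Δ + As ε = γ⁻¹(Δ_i - Δ_{i+1}) - (A Γ Δ - Δ) - (A (H - Γ) Δ + (A -
  -- As) ε)`; the three pieces are `h1`, `h2` and `h3`.
  refine (tendstoInMeasure_zero_add h1 (tendstoInMeasure_zero_neg
    (tendstoInMeasure_zero_add h2 h3))).congr_left fun n => ae_of_all _ fun ω => ?_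
  simp only
  rw [← smul_add, ← smul_neg, ← smul_add, ← Finset.sum_add_distrib, ← Finset.sum_neg_distrib,
    ← Finset.sum_add_distrib]
  congr 1
  refine Finset.sum_congr rfl fun i hi => ?_
  have hy : γ0 * ((i + 1 : ℕ) : ℝ) ^ (-a) ≠ 0 := by positivity
  rw [(hSA n).recursion i (Finset.mem_Ico.1 hi).1 ω, noiseMap_apply, sub_sub_cancel, smul_smul,
    inv_mul_cancel₀ hy, one_smul]
  simp only [_root_.sub_apply, map_add, map_sub]
  abel

end StochasticApproximation

end

section

/-! ### The multivariate central limit theorem -/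

theorem charFun_map_eq_charFun_map_inner {Ω E : Type*} {mΩ : MeasurableSpace Ω} {μ : Measure Ω}
    [NormedAddCommGroup E] [InnerProductSpace ℝ E] [MeasurableSpace E] [BorelSpace E]
    [SecondCountableTopology E] {X : Ω → E} (hX : AEMeasurable X μ) (t : E) :
    charFun (μ.map X) t = charFun (μ.map fun ω => inner ℝ t (X ω)) 1 := by
  have h1 : AEMeasurable (fun ω => inner ℝ t (X ω)) μ := by fun_prop
  rw [charFun_apply, charFun_apply, integral_map hX (by fun_prop), integral_map h1 (by fun_prop)]
  simp [real_inner_comm]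

/-- The Cramér–Wold device through characteristic functions: the value at `t` is the value at `1` of
the characteristic function of the projection on `t`, to which the one-dimensional central limit
theorem applies. -/
theorem tendstoInDistribution_multivariateGaussian {Ω : Type*} {mΩ : MeasurableSpace Ω}
    {μ : Measure Ω} [IsProbabilityMeasure μ] {p : ℕ} {Y : ℕ → Ω → EuclideanSpace ℝ (Fin p)}
    (hY : MemLp (Y 0) 2 μ) (h0 : ∫ ω, Y 0 ω ∂μ = 0) (hindep : iIndepFun Y μ)
    (hident : ∀ i, IdentDistrib (Y i) (Y 0) μ μ) {S : Matrix (Fin p) (Fin p) ℝ}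
    (hS : S.PosSemidef)
    (hcov : ∀ t : EuclideanSpace ℝ (Fin p),
      ∫ ω, (inner ℝ t (Y 0 ω)) ^ 2 ∂μ = t.ofLp ⬝ᵥ S.mulVec t.ofLp) :
    TendstoInDistribution (fun (n : ℕ) ω => (√(n : ℝ))⁻¹ • ∑ i ∈ Finset.range n, Y i ω) atTop
      (id : EuclideanSpace ℝ (Fin p) → EuclideanSpace ℝ (Fin p)) (fun _ => μ)
      (multivariateGaussian 0 S) := by
  have hmeas (n : ℕ) : AEMeasurable
      (fun ω => (√(n : ℝ))⁻¹ • ∑ i ∈ Finset.range n, Y i ω) μ := by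
    have h : AEMeasurable (fun ω => ∑ i ∈ Finset.range n, Y i ω) μ :=
      Finset.aemeasurable_fun_sum _ fun i _ => (hident i).aemeasurable_fst
    exact h.const_smul (√(n : ℝ))⁻¹
  refine ⟨hmeas, aemeasurable_id, ProbabilityMeasure.tendsto_iff_tendsto_charFun.2 fun t => ?_⟩
  simp only [ProbabilityMeasure.coe_mk, Measure.map_id]
  have hinner : Measurable fun x : EuclideanSpace ℝ (Fin p) => inner ℝ t x := by fun_prop
  have hX : MemLp (fun ω => inner ℝ t (Y 0 ω)) 2 μ := hY.const_inner t
  have hmean : ∫ ω, inner ℝ t (Y 0 ω) ∂μ = 0 := by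
    rw [integral_inner (hY.integrable one_le_two), h0, inner_zero_right]
  have hvar : Var[fun ω => inner ℝ t (Y 0 ω); μ] = t.ofLp ⬝ᵥ S.mulVec t.ofLp := by
    rw [variance_of_integral_eq_zero hX.aestronglyMeasurable.aemeasurable hmean, hcov]
  have hclt := tendstoInDistribution_inv_sqrt_mul_sum_sub
    (P := μ) (X := fun i ω => inner ℝ t (Y i ω)) (Y := id)
    (P' := gaussianReal 0 Var[fun ω => inner ℝ t (Y 0 ω); μ].toNNReal) HasLaw.id hX
    (hindep.comp (fun _ x => inner ℝ t x) fun _ => hinner) fun i => (hident i).comp hinner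
  have h1 := ProbabilityMeasure.tendsto_iff_tendsto_charFun.1 hclt.tendsto 1
  simp only [ProbabilityMeasure.coe_mk, Measure.map_id, hmean, mul_zero, sub_zero] at h1
  have e2 : charFun (gaussianReal 0 Var[fun ω => inner ℝ t (Y 0 ω); μ].toNNReal) 1 =
      charFun (multivariateGaussian 0 S) t := by
    rw [charFun_gaussianReal, charFun_multivariateGaussian hS, hvar,
      Real.coe_toNNReal _ (by simpa using hS.dotProduct_mulVec_nonneg t.ofLp)]
    simp
  rw [← e2]
  refine h1.congr fun n => ?_
  rw [charFun_map_eq_charFun_map_inner (hmeas n)]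
  congr 2
  funext ω
  rw [inner_smul_right, inner_sum]

end

section

variable {dβ dg : ℕ}

/-! ### Elementary properties of the algorithm -/

/-- The gain `(Φ'WΦ)† Φ'W` as a linear map. -/
def gain (Φ : Matrix (Fin dg) (Fin dβ) ℝ) (W : Matrix (Fin dg) (Fin dg) ℝ) :
    EuclideanSpace ℝ (Fin dg) →L[ℝ] EuclideanSpace ℝ (Fin dβ) :=
  op (pinv (Φ.transpose * W * Φ) * Φ.transpose * W)

theorem op_Gmat_apply (d : Obs dβ dg) (b : EuclideanSpace ℝ (Fin dβ)) :
    op (Gmat d) b = inner ℝ (Obs.x d) b • Obs.z d := by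
  ext k
  simp only [op_apply, Gmat, Matrix.vecMulVec_mulVec, PiLp.smul_apply, Pi.smul_apply]
  rw [EuclideanSpace.inner_eq_star_dotProduct]
  simp [dotProduct_comm, mul_comm]

/-- This identity makes the recursion for `β - βs` linear, with `H = op (Gmat d)` and noise `g βs
d`. -/
theorem g_eq (βs β : EuclideanSpace ℝ (Fin dβ)) (d : Obs dβ dg) :
    g β d = op (Gmat d) (β - βs) + g βs d := by
  rw [op_Gmat_apply, g, g, ← add_smul, inner_sub_right]
  congr 1
  ring

theorem step_β (n0 : ℕ) (γi : ℝ) (i : ℕ) (d : Obs dβ dg) (v : EuclideanSpace ℝ (Fin dg))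
    (s : State dβ dg) :
    (step n0 γi i d v s).β = s.β - γi • gain s.Φ s.W (g s.β d) := rfl

/-- Allows the warm-up to be treated as an instance of the full algorithm, so that one analysis
serves both. -/
theorem sgmm_eq_s2sls (n0 : ℕ) (γ : ℕ → ℝ) (s0 : State dβ dg) (d : ℕ → Obs dβ dg) (m : ℕ) :
    ∀ i ≤ m, sgmm n0 γ s0 d m i = s2sls n0 γ s0 d i
  | 0, _ => rfl
  | i + 1, hi => by
    rw [sgmm, s2sls, if_pos hi, sgmm_eq_s2sls n0 γ s0 d m i (by omega)]

/-- The vector whose outer product is averaged at time `j + 1`. -/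
def weightVec (n0 : ℕ) (γ : ℕ → ℝ) (s0 : State dβ dg) (d : ℕ → Obs dβ dg) (m j : ℕ) :
    EuclideanSpace ℝ (Fin dg) :=
  if j < m then Obs.z (d j) else g (s2sls n0 γ s0 d m).βbar (d j)

theorem sgmm_succ (n0 : ℕ) (γ : ℕ → ℝ) (s0 : State dβ dg) (d : ℕ → Obs dβ dg) (m i : ℕ) :
    sgmm n0 γ s0 d m (i + 1) = step n0 (γ (i + 1)) (i + 1) (d i) (weightVec n0 γ s0 d m i)
      (sgmm n0 γ s0 d m i) := rfl

theorem sgmm_Φ {n0 : ℕ} (hn0 : 1 ≤ n0) (γ : ℕ → ℝ) (s0 : State dβ dg) (d : ℕ → Obs dβ dg)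
    (m i : ℕ) :
    (sgmm n0 γ s0 d m i).Φ =
      ((n0 : ℝ) + i)⁻¹ • ((n0 : ℝ) • s0.Φ + ∑ j ∈ Finset.range i, Gmat (d j)) := by
  have hn : (0 : ℝ) < n0 := by exact_mod_cast hn0
  induction i with
  | zero =>
    simp only [sgmm, Finset.range_zero, Finset.sum_empty, Nat.cast_zero, add_zero]
    rw [smul_smul, inv_mul_cancel₀ hn.ne', one_smul]
  | succ i ih =>
    rw [sgmm_succ, step]
    simp only
    rw [ih, Finset.sum_range_succ, ← add_assoc, smul_add _ _ (Gmat (d i)), smul_smul]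
    have hi : (0 : ℝ) < (n0 : ℝ) + i := by positivity
    congr 2
    · push_cast
      rw [show (n0 : ℝ) + (i + 1) - 1 = n0 + i by ring]
      field_simp
    · rw [one_div]

theorem sgmm_βbar (n0 : ℕ) (γ : ℕ → ℝ) (s0 : State dβ dg) (d : ℕ → Obs dβ dg)
    (m i : ℕ) :
    (i : ℝ) • (sgmm n0 γ s0 d m i).βbar =
      ∑ j ∈ Finset.range i, (sgmm n0 γ s0 d m (j + 1)).β := by
  induction i with
  | zero => simp
  | succ i ih =>
    have hi : ((i + 1 : ℕ) : ℝ) ≠ 0 := by positivity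
    rw [Finset.sum_range_succ, ← ih, sgmm_succ]
    simp only [step]
    rw [smul_add, smul_smul, smul_smul]
    congr 1
    · congr 1
      field_simp
      push_cast
      ring
    · rw [mul_one_div_cancel hi, one_smul]

/-- The weighting matrix before inversion. -/
def weightAvg (n0 : ℕ) (γ : ℕ → ℝ) (s0 : State dβ dg) (d : ℕ → Obs dβ dg)
    (Q : Matrix (Fin dg) (Fin dg) ℝ) (m i : ℕ) : Matrix (Fin dg) (Fin dg) ℝ :=
  ((n0 : ℝ) + i)⁻¹ • ((n0 : ℝ) • Q + ∑ j ∈ Finset.range i, outer (weightVec n0 γ s0 d m j))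

theorem weightAvg_posDef {n0 : ℕ} (hn0 : 1 ≤ n0) (γ : ℕ → ℝ) (s0 : State dβ dg)
    (d : ℕ → Obs dβ dg) {Q : Matrix (Fin dg) (Fin dg) ℝ} (hQ : Q.PosDef) (m i : ℕ) :
    (weightAvg n0 γ s0 d Q m i).PosDef := by
  have hn : (0 : ℝ) < n0 := by exact_mod_cast hn0
  refine Matrix.PosDef.smul (Matrix.PosDef.add_posSemidef (hQ.smul hn) ?_) (by positivity)
  exact Matrix.posSemidef_sum _ fun j _ => posSemidef_outer _

/-- Sherman–Morrison at every step, with `c = n0 + i`. Laws of large numbers apply to the uninverted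
average, in which the initial matrix keeps weight `n0`. -/
theorem sgmm_W {n0 : ℕ} (hn0 : 1 ≤ n0) (γ : ℕ → ℝ) (s0 : State dβ dg) (d : ℕ → Obs dβ dg)
    {Q : Matrix (Fin dg) (Fin dg) ℝ} (hQ : Q.PosDef) (hW : s0.W = Q⁻¹) (m i : ℕ) :
    (sgmm n0 γ s0 d m i).W = (weightAvg n0 γ s0 d Q m i)⁻¹ := by
  have hn : (0 : ℝ) < n0 := by exact_mod_cast hn0
  induction i with
  | zero =>
    simp only [sgmm, weightAvg, Finset.range_zero, Finset.sum_empty, Nat.cast_zero, add_zero]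
    rw [smul_smul, inv_mul_cancel₀ hn.ne', one_smul, hW]
  | succ i ih =>
    have hpd := weightAvg_posDef hn0 γ s0 d hQ m i
    have hdet : IsUnit (weightAvg n0 γ s0 d Q m i).det := hpd.det_pos.ne'.isUnit
    have hi : (0 : ℝ) < (n0 : ℝ) + i := by positivity
    set v := weightVec n0 γ s0 d m i with hv
    have hnn : 0 ≤ v.ofLp ⬝ᵥ (weightAvg n0 γ s0 d Q m i)⁻¹.mulVec v.ofLp := by
      simpa using hpd.inv.posSemidef.dotProduct_mulVec_nonneg v.ofLp
    have key := mul_rankOne_update_eq_one (Matrix.mul_nonsing_inv _ hdet) v hi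
      (by positivity)
    have hrec : weightAvg n0 γ s0 d Q m (i + 1) =
        (((n0 : ℝ) + i) / ((n0 : ℝ) + i + 1)) • weightAvg n0 γ s0 d Q m i +
          (1 / ((n0 : ℝ) + i + 1)) • outer v := by
      rw [weightAvg, weightAvg, Finset.sum_range_succ, ← add_assoc, smul_add _ _ (outer _),
        smul_smul]
      push_cast
      rw [← add_assoc]
      congr 2
      · field_simp
      · rw [one_div]
    rw [sgmm_succ, step]
    simp only
    rw [ih, ← hv]
    refine (Matrix.inv_eq_right_inv ?_).symm
    rw [hrec]
    refine Eq.trans ?_ key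
    push_cast
    rw [show (n0 : ℝ) + (i + 1) - 1 = n0 + i by ring, ← add_assoc]

theorem Q0_posSemidef {n0 : ℕ} {η0 : ℝ} (hη0 : 0 ≤ η0) (d0 : Fin n0 → Obs dβ dg) :
    (Q0 η0 d0).PosSemidef :=
  ((Matrix.posSemidef_sum _ fun j _ => posSemidef_outer _).smul (by positivity)).add
    (Matrix.PosSemidef.one.smul hη0)

theorem Q0_posDef {n0 : ℕ} {η0 : ℝ} (hη0 : 0 ≤ η0) {d0 : Fin n0 → Obs dβ dg}
    (h : IsUnit (Q0 η0 d0)) : (Q0 η0 d0).PosDef :=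
  (Q0_posSemidef hη0 d0).posDef_iff_isUnit.2 h

/-! ### Measurability of the algorithm -/

theorem continuous_outer {p : ℕ} : Continuous (outer (p := p)) := by
  unfold outer
  exact continuous_matrix fun i j => by
    simp only [Matrix.vecMulVec_apply]
    fun_prop

theorem continuous_Gmat : Continuous (Gmat (dβ := dβ) (dg := dg)) := by
  unfold Gmat
  exact continuous_matrix fun i j => by
    simp only [Matrix.vecMulVec_apply]
    fun_prop

section Measurability

variable {Ω : Type*} {m0 : MeasurableSpace Ω}

theorem measurable_g {β : Ω → EuclideanSpace ℝ (Fin dβ)} {d : Ω → Obs dβ dg}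
    (hβ : Measurable β) (hd : Measurable d) : Measurable fun ω => g (β ω) (d ω) := by
  have hx : Measurable fun ω => Obs.x (d ω) := measurable_fst.comp hd
  have hz : Measurable fun ω => Obs.z (d ω) := measurable_fst.comp (measurable_snd.comp hd)
  have hy : Measurable fun ω => Obs.y (d ω) := measurable_snd.comp (measurable_snd.comp hd)
  exact ((hx.inner hβ).sub hy).smul hz

theorem measurable_matrix_mul {p q r : ℕ} {A : Ω → Matrix (Fin p) (Fin q) ℝ}
    {B : Ω → Matrix (Fin q) (Fin r) ℝ} (hA : Measurable A) (hB : Measurable B) :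
    Measurable fun ω => A ω * B ω := by
  have h : Continuous fun x : Matrix (Fin p) (Fin q) ℝ × Matrix (Fin q) (Fin r) ℝ =>
    x.1 * x.2 := by fun_prop
  exact h.measurable.comp (hA.prodMk hB)

theorem measurable_matrix_transpose {p q : ℕ} {A : Ω → Matrix (Fin p) (Fin q) ℝ}
    (hA : Measurable A) : Measurable fun ω => (A ω).transpose := by
  have h : Continuous fun x : Matrix (Fin p) (Fin q) ℝ => x.transpose := by fun_prop
  exact h.measurable.comp hA

theorem measurable_matrix_smul_add {p q : ℕ} {A B : Ω → Matrix (Fin p) (Fin q) ℝ}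
    {c c' : Ω → ℝ} (hc : Measurable c) (hc' : Measurable c')
    (hA : Measurable A) (hB : Measurable B) : Measurable fun ω => c ω • A ω + c' ω • B ω := by
  have h : Continuous fun x : (ℝ × ℝ) × Matrix (Fin p) (Fin q) ℝ × Matrix (Fin p) (Fin q) ℝ =>
    x.1.1 • x.2.1 + x.1.2 • x.2.2 := by fun_prop
  exact h.measurable.comp ((hc.prodMk hc').prodMk (hA.prodMk hB))

theorem measurable_gain {Φ : Ω → Matrix (Fin dg) (Fin dβ) ℝ} {W : Ω → Matrix (Fin dg) (Fin dg) ℝ}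
    (hΦ : Measurable Φ) (hW : Measurable W) : Measurable fun ω => gain (Φ ω) (W ω) :=
  measurable_op.comp (measurable_matrix_mul (measurable_matrix_mul (measurable_pinv.comp
    (measurable_matrix_mul (measurable_matrix_mul (measurable_matrix_transpose hΦ) hW) hΦ))
    (measurable_matrix_transpose hΦ)) hW)

/-- Componentwise measurability of a random state. -/
structure MeasurableState {Ω : Type*} (m0 : MeasurableSpace Ω) (s : Ω → State dβ dg) : Prop where
  β : Measurable fun ω => (s ω).β
  Φ : Measurable fun ω => (s ω).Φ
  W : Measurable fun ω => (s ω).W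
  βbar : Measurable fun ω => (s ω).βbar

theorem MeasurableState.step {s : Ω → State dβ dg} (hs : MeasurableState m0 s) (n0 : ℕ) (γi : ℝ)
    (i : ℕ) {d : Ω → Obs dβ dg} (hd : Measurable d) {v : Ω → EuclideanSpace ℝ (Fin dg)}
    (hv : Measurable v) : MeasurableState m0 fun ω => step n0 γi i (d ω) (v ω) (s ω) := by
  have hg : Measurable fun ω => g (s ω).β (d ω) := measurable_g hs.β hd
  have hβ : Measurable fun ω => (SGMM.step n0 γi i (d ω) (v ω) (s ω)).β := by
    simp only [step_β]
    have h1 : Measurable fun ω => gain (s ω).Φ (s ω).W (g (s ω).β (d ω)) :=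
      measurable_clm_apply (measurable_gain hs.Φ hs.W) hg
    exact hs.β.sub (h1.const_smul γi)
  refine ⟨hβ, ?_, ?_, ?_⟩
  · exact measurable_matrix_smul_add measurable_const measurable_const hs.Φ
      (continuous_Gmat.measurable.comp hd)
  · have hm : Measurable fun ω => ((n0 : ℝ) + i - 1) +
        (v ω).ofLp ⬝ᵥ (s ω).W.mulVec (v ω).ofLp := by
      have h : Continuous fun x : EuclideanSpace ℝ (Fin dg) × Matrix (Fin dg) (Fin dg) ℝ =>
          ((n0 : ℝ) + i - 1) + x.1.ofLp ⬝ᵥ x.2.mulVec x.1.ofLp := by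
        fun_prop
      exact h.measurable.comp (hv.prodMk hs.W)
    have h1 : Measurable fun ω => (1 : ℝ) • (1 : Matrix (Fin dg) (Fin dg) ℝ) +
        (-(((n0 : ℝ) + i - 1) + (v ω).ofLp ⬝ᵥ (s ω).W.mulVec (v ω).ofLp)⁻¹) •
          (outer (v ω) * (s ω).W) :=
      measurable_matrix_smul_add measurable_const hm.inv.neg measurable_const
        (measurable_matrix_mul (continuous_outer.measurable.comp hv) hs.W)
    have h2 := measurable_matrix_mul hs.W h1
    have h3 := measurable_matrix_smul_add (c := fun _ => ((n0 : ℝ) + i) / ((n0 : ℝ) + i - 1))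
      (c' := fun _ => 0) measurable_const measurable_const h2 h2
    simpa only [SGMM.step, one_smul, neg_smul, ← sub_eq_add_neg, zero_smul, add_zero] using h3
  · exact (hs.βbar.const_smul (((i : ℝ) - 1) / i)).add (hβ.const_smul (1 / (i : ℝ)))

end Measurability

end

section

variable {dβ dg : ℕ}

/-! ### The sample and its filtration -/

/-- An initialization sample `D0` and a main sample `D` of independent observations with
law `P`. -/
structure IsSample {Ω : Type*} [MeasurableSpace Ω] (μ : Measure Ω) {n0 : ℕ}
    (P : Measure (Obs dβ dg)) (D0 : Fin n0 → Ω → Obs dβ dg) (D : ℕ → Ω → Obs dβ dg) : Prop where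
  meas0 : ∀ j, Measurable (D0 j)
  meas : ∀ i, Measurable (D i)
  law0 : ∀ j, μ.map (D0 j) = P
  law : ∀ i, μ.map (D i) = P
  indep : iIndepFun (fun s : Fin n0 ⊕ ℕ => Sum.elim D0 D s) μ

/-- The information in the initialization sample and the first `i` observations. -/
abbrev obsFiltration {Ω : Type*} {n0 : ℕ} (D0 : Fin n0 → Ω → Obs dβ dg) (D : ℕ → Ω → Obs dβ dg)
    (i : ℕ) : MeasurableSpace Ω :=
  ⨆ s ∈ {s : Fin n0 ⊕ ℕ | ∀ k, s = Sum.inr k → k < i},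
    MeasurableSpace.comap (Sum.elim D0 D s) inferInstance

section Sample

variable {Ω : Type*} [mΩ : MeasurableSpace Ω] {μ : Measure Ω} [IsProbabilityMeasure μ] {n0 : ℕ}
  {P : Measure (Obs dβ dg)} {D0 : Fin n0 → Ω → Obs dβ dg} {D : ℕ → Ω → Obs dβ dg}

theorem measurable_obsFiltration {i : ℕ} {s : Fin n0 ⊕ ℕ} (hs : ∀ k, s = Sum.inr k → k < i) :
    Measurable[obsFiltration D0 D i] (Sum.elim D0 D s) := by
  refine (comap_measurable (Sum.elim D0 D s)).mono ?_ le_rfl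
  exact le_iSup₂ (f := fun (s : Fin n0 ⊕ ℕ) (_ : s ∈ {s : Fin n0 ⊕ ℕ | ∀ k, s = Sum.inr k → k < i})
    => MeasurableSpace.comap (Sum.elim D0 D s) inferInstance) s hs

theorem measurable_init_obsFiltration (j : Fin n0) (i : ℕ) :
    Measurable[obsFiltration D0 D i] (D0 j) :=
  measurable_obsFiltration (s := Sum.inl j) (by simp)

theorem measurable_main_obsFiltration {k i : ℕ} (h : k < i) :
    Measurable[obsFiltration D0 D i] (D k) :=
  measurable_obsFiltration (s := Sum.inr k) (by simpa using h)

theorem obsFiltration_mono : Monotone (obsFiltration D0 D) := fun _ _ hij =>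
  biSup_mono fun _ hs k hk => (hs k hk).trans_le hij

namespace IsSample

theorem meas_elim (h : IsSample μ P D0 D) (s : Fin n0 ⊕ ℕ) : Measurable (Sum.elim D0 D s) := by
  cases s with
  | inl j => exact h.meas0 j
  | inr k => exact h.meas k

theorem isProbabilityMeasure (h : IsSample μ P D0 D) : IsProbabilityMeasure P := by
  rw [← h.law 0]
  exact Measure.isProbabilityMeasure_map (h.meas 0).aemeasurable

theorem obsFiltration_le (h : IsSample μ P D0 D) (i : ℕ) : obsFiltration D0 D i ≤ mΩ :=
  iSup₂_le fun s _ => (h.meas_elim s).comap_le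

theorem indep_obsFiltration (h : IsSample μ P D0 D) (i : ℕ) :
    Indep (obsFiltration D0 D i) (MeasurableSpace.comap (D i) inferInstance) μ := by
  have hd : Disjoint {s : Fin n0 ⊕ ℕ | ∀ k, s = Sum.inr k → k < i} {Sum.inr i} := by
    rw [Set.disjoint_singleton_right]
    intro hi
    exact lt_irrefl _ (hi i rfl)
  have := indep_iSup_of_disjoint (fun s => (h.meas_elim s).comap_le) h.indep hd
  rwa [iSup_singleton] at this

theorem iIndepFun_main (h : IsSample μ P D0 D) : iIndepFun D μ :=
  h.indep.precomp (g := Sum.inr) Sum.inr_injective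

theorem identDistrib (h : IsSample μ P D0 D) (i : ℕ) : IdentDistrib (D i) (D 0) μ μ :=
  ⟨(h.meas i).aemeasurable, (h.meas 0).aemeasurable, by rw [h.law, h.law]⟩

/-- The strong law of large numbers along the main sample. -/
theorem ae_tendsto_average (h : IsSample μ P D0 D) {f : Obs dβ dg → ℝ} (hf : Measurable f)
    (hint : Integrable f P) :
    ∀ᵐ ω ∂μ, Tendsto (fun n : ℕ => (n : ℝ)⁻¹ * ∑ i ∈ Finset.range n, f (D i ω)) atTop
      (𝓝 (∫ d, f d ∂P)) := by
  have hmp : MeasurePreserving (D 0) μ P := ⟨h.meas 0, h.law 0⟩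
  have key := strong_law_ae (μ := μ) (fun i ω => f (D i ω)) (hmp.integrable_comp_of_integrable hint)
    (fun i j hij => (h.iIndepFun_main.indepFun hij).comp hf hf)
    (fun i => (h.identDistrib i).comp hf)
  have e : ∫ ω, f (D 0 ω) ∂μ = ∫ d, f d ∂P := by
    rw [← h.law 0, integral_map (h.meas 0).aemeasurable hf.aestronglyMeasurable]
  rw [e] at key
  simpa only [smul_eq_mul] using key

theorem ae_tendsto_average_matrix (h : IsSample μ P D0 D) {p q : ℕ}
    {f : Obs dβ dg → Matrix (Fin p) (Fin q) ℝ} (hf : ∀ k l, Measurable fun d => f d k l)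
    (hint : ∀ k l, Integrable (fun d => f d k l) P) :
    ∀ᵐ ω ∂μ, Tendsto (fun n : ℕ => (n : ℝ)⁻¹ • ∑ i ∈ Finset.range n, f (D i ω)) atTop
      (𝓝 (meanMat P f)) := by
  have key : ∀ᵐ ω ∂μ, ∀ k l, Tendsto (fun n : ℕ => (n : ℝ)⁻¹ * ∑ i ∈ Finset.range n, f (D i ω) k l)
      atTop (𝓝 (∫ d, f d k l ∂P)) :=
    ae_all_iff.2 fun k => ae_all_iff.2 fun l => h.ae_tendsto_average (hf k l) (hint k l)
  filter_upwards [key] with ω hω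
  refine tendsto_pi_nhds.2 fun k => tendsto_pi_nhds.2 fun l => ?_
  refine (hω k l).congr fun n => ?_
  simp [Matrix.sum_apply]

end IsSample

/-! ### Moments of an observation -/

theorem measurable_op_Gmat : Measurable fun d : Obs dβ dg => op (Gmat d) :=
  (continuous_op.comp continuous_Gmat).measurable

theorem measurable_g_const (β : EuclideanSpace ℝ (Fin dβ)) :
    Measurable fun d : Obs dβ dg => g β d := measurable_g measurable_const measurable_id

theorem abs_entry_le_norm_op {p q : ℕ} (A : Matrix (Fin p) (Fin q) ℝ) (k : Fin p) (l : Fin q) :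
    |A k l| ≤ ‖op A‖ := by
  have h1 := (op A).le_opNorm (EuclideanSpace.single l 1)
  have h2 := PiLp.norm_apply_le (op A (EuclideanSpace.single l 1)) k
  simp only [PiLp.norm_single, norm_one, mul_one] at h1
  refine le_trans (le_of_eq ?_) (h2.trans h1)
  simp [op_apply]

variable [IsProbabilityMeasure P]

theorem memLp_op_Gmat (hG2 : Integrable (fun d => opNorm (Gmat d) ^ 2) P) :
    MemLp (fun d : Obs dβ dg => op (Gmat d)) 2 P :=
  (memLp_two_iff_integrable_sq_norm measurable_op_Gmat.aestronglyMeasurable).2 hG2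

theorem memLp_Gmat_entry (hG2 : Integrable (fun d => opNorm (Gmat d) ^ 2) P) (k : Fin dg)
    (l : Fin dβ) : MemLp (fun d : Obs dβ dg => Gmat d k l) 2 P :=
  (memLp_op_Gmat hG2).of_le
    ((continuous_Gmat.matrix_elem k l).measurable.aestronglyMeasurable)
    (ae_of_all _ fun d => abs_entry_le_norm_op (Gmat d) k l)

theorem integral_op_Gmat (hG2 : Integrable (fun d => opNorm (Gmat d) ^ 2) P) :
    ∫ d : Obs dβ dg, op (Gmat d) ∂P = op (Gpop P) := by
  have hint := (memLp_op_Gmat hG2).integrable one_le_two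
  ext v k
  rw [ContinuousLinearMap.integral_apply hint]
  have h1 : Integrable (fun d : Obs dβ dg => op (Gmat d) v) P := hint.apply_continuousLinearMap v
  have h2 := (EuclideanSpace.proj k : EuclideanSpace ℝ (Fin dg) →L[ℝ] ℝ).integral_comp_comm h1
  have h3 : (∫ d, op (Gmat d) v ∂P) k = ∫ d, op (Gmat d) v k ∂P := h2.symm
  rw [h3]
  simp only [op_apply, Matrix.mulVec, dotProduct]
  rw [integral_finsetSum _ fun l _ =>
    ((memLp_Gmat_entry hG2 k l).integrable one_le_two).mul_const (v l)]
  refine Finset.sum_congr rfl fun l _ => ?_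
  rw [integral_mul_const]
  rfl

theorem memLp_g (βs : EuclideanSpace ℝ (Fin dβ)) (hg2 : Integrable (fun d => ‖g βs d‖ ^ 2) P) :
    MemLp (fun d : Obs dβ dg => g βs d) 2 P :=
  (memLp_two_iff_integrable_sq_norm (measurable_g_const βs).aestronglyMeasurable).2 hg2

theorem IsSample.isDriven (h : IsSample μ P D0 D)
    (hG2 : Integrable (fun d => opNorm (Gmat d) ^ 2) P) {βs : EuclideanSpace ℝ (Fin dβ)}
    (hg2 : Integrable (fun d => ‖g βs d‖ ^ 2) P) (h0 : ∫ d, g βs d ∂P = 0) :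
    IsDriven μ (obsFiltration D0 D) D P (fun d => op (Gmat d)) (g βs) (op (Gpop P)) where
  le := h.obsFiltration_le
  mono := obsFiltration_mono
  meas i := measurable_main_obsFiltration (Nat.lt_succ_self i)
  law := h.law
  indep := h.indep_obsFiltration
  measH := measurable_op_Gmat
  measε := measurable_g_const βs
  memH := memLp_op_Gmat hG2
  memε := memLp_g βs hg2
  meanH := integral_op_Gmat hG2
  meanε := h0

/-! ### Adaptedness of the algorithm -/

theorem measurable_matrix_of_entries {Ω' : Type*} {m : MeasurableSpace Ω'} {p q : ℕ}
    {A : Ω' → Matrix (Fin p) (Fin q) ℝ} (h : ∀ k l, Measurable fun ω => A ω k l) : Measurable A :=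
  measurable_pi_lambda _ fun k => measurable_pi_lambda _ fun l => h k l

theorem measurable_matrix_entry {Ω' : Type*} {m : MeasurableSpace Ω'} {p q : ℕ}
    {A : Ω' → Matrix (Fin p) (Fin q) ℝ} (h : Measurable A) (k : Fin p) (l : Fin q) :
    Measurable fun ω => A ω k l :=
  (measurable_pi_apply l).comp ((measurable_pi_apply k).comp h)

theorem measurableState_init (η0 : ℝ) {b0 : Ω → EuclideanSpace ℝ (Fin dβ)}
    (hb0 : Measurable[MeasurableSpace.comap (fun ω j => D0 j ω) inferInstance] b0) :
    MeasurableState (obsFiltration D0 D 0) fun ω => init η0 (fun j => D0 j ω) (b0 ω) := by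
  have hD0 (j : Fin n0) := measurable_init_obsFiltration (D0 := D0) (D := D) j 0
  have htuple : Measurable[obsFiltration D0 D 0] fun ω (j : Fin n0) => D0 j ω :=
    @measurable_pi_lambda _ _ _ (obsFiltration D0 D 0) _ _ hD0
  have hb : Measurable[obsFiltration D0 D 0] b0 := hb0.mono htuple.comap_le le_rfl
  have hG (j : Fin n0) : Measurable[obsFiltration D0 D 0] fun ω => Gmat (D0 j ω) :=
    continuous_Gmat.measurable.comp (hD0 j)
  have hz (j : Fin n0) : Measurable[obsFiltration D0 D 0] fun ω => outer (Obs.z (D0 j ω)) :=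
    continuous_outer.measurable.comp (measurable_fst.comp (measurable_snd.comp (hD0 j)))
  refine ⟨hb, ?_, ?_, hb⟩
  · refine measurable_matrix_of_entries fun k l => ?_
    simp only [init, Matrix.smul_apply, Matrix.sum_apply, smul_eq_mul]
    exact (Finset.measurable_fun_sum _ fun j _ => measurable_matrix_entry (hG j) k l).const_mul _
  · refine measurable_matrix_inv.comp (measurable_matrix_of_entries fun k l => ?_)
    simp only [Q0, Matrix.add_apply, Matrix.smul_apply, Matrix.sum_apply, smul_eq_mul]
    exact ((Finset.measurable_fun_sum _ fun j _ =>
      measurable_matrix_entry (hz j) k l).const_mul _).add_const _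

theorem measurableState_s2sls {s0 : Ω → State dβ dg}
    (hs0 : MeasurableState (obsFiltration D0 D 0) s0) (γ : ℕ → ℝ) (i : ℕ) :
    MeasurableState (obsFiltration D0 D i) fun ω => s2sls n0 γ (s0 ω) (fun i => D i ω) i := by
  induction i with
  | zero => exact hs0
  | succ i ih =>
    have hle := obsFiltration_mono (D0 := D0) (D := D) (Nat.le_succ i)
    have hd := measurable_main_obsFiltration (D0 := D0) (D := D) (Nat.lt_succ_self i)
    have hs : MeasurableState (obsFiltration D0 D (i + 1))
        fun ω => s2sls n0 γ (s0 ω) (fun i => D i ω) i :=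
      ⟨ih.β.mono hle le_rfl, ih.Φ.mono hle le_rfl, ih.W.mono hle le_rfl, ih.βbar.mono hle le_rfl⟩
    exact hs.step n0 (γ (i + 1)) (i + 1) hd (measurable_fst.comp (measurable_snd.comp hd))

theorem measurableState_sgmm {s0 : Ω → State dβ dg}
    (hs0 : MeasurableState (obsFiltration D0 D 0) s0) (γ : ℕ → ℝ) (m i : ℕ) :
    MeasurableState (obsFiltration D0 D i) fun ω => sgmm n0 γ (s0 ω) (fun i => D i ω) m i := by
  induction i with
  | zero => exact hs0
  | succ i ih =>
    have hle := obsFiltration_mono (D0 := D0) (D := D) (Nat.le_succ i)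
    have hd := measurable_main_obsFiltration (D0 := D0) (D := D) (Nat.lt_succ_self i)
    have hs : MeasurableState (obsFiltration D0 D (i + 1))
        fun ω => sgmm n0 γ (s0 ω) (fun i => D i ω) m i :=
      ⟨ih.β.mono hle le_rfl, ih.Φ.mono hle le_rfl, ih.W.mono hle le_rfl, ih.βbar.mono hle le_rfl⟩
    refine hs.step n0 (γ (i + 1)) (i + 1) hd
      (v := fun ω => weightVec n0 γ (s0 ω) (fun i => D i ω) m i) ?_
    by_cases him : i < m
    · simp only [weightVec, if_pos him]
      exact measurable_fst.comp (measurable_snd.comp hd)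
    · simp only [weightVec, if_neg him]
      -- After the switch the weights use the warm-up estimate, which is known at time `m ≤ i`; the
      -- gain thus remains a function of the past.
      exact measurable_g ((measurableState_s2sls hs0 γ m).βbar.mono
        (obsFiltration_mono (by omega)) le_rfl) hd

end Sample

end

section

/-! ### Averages with a change of regime -/

/-- Convergence of averages controls all prefixes `k ≤ i` at the scale of `i`: long prefixes by the
limit itself, the finitely many short ones by a constant that `η i` eventually exceeds. Uniformity
in `k` is what later permits an arbitrary switching time. -/
theorem eventually_abs_partialSum_sub_le {z : ℕ → ℝ} {x : ℝ}
    (hz : Tendsto (fun n : ℕ => (n : ℝ)⁻¹ * ∑ j ∈ Finset.range n, z j) atTop (𝓝 x))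
    {η : ℝ} (hη : 0 < η) :
    ∀ᶠ N : ℕ in atTop, ∀ i ≥ N, ∀ k ≤ i, |∑ j ∈ Finset.range k, z j - k * x| ≤ η * i := by
  obtain ⟨N1, hN1⟩ := Metric.tendsto_atTop.1 hz η hη
  have hbig : ∀ k ≥ max N1 1, |∑ j ∈ Finset.range k, z j - k * x| ≤ η * k := by
    intro k hk
    have hk0 : (0 : ℝ) < k := by exact_mod_cast (le_of_max_le_right hk)
    have h := (hN1 k (le_of_max_le_left hk)).le
    rw [Real.dist_eq] at h
    have e : ∑ j ∈ Finset.range k, z j - k * x =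
        k * ((k : ℝ)⁻¹ * ∑ j ∈ Finset.range k, z j - x) := by field_simp
    rw [e, abs_mul, abs_of_pos hk0, mul_comm]
    gcongr
  have hB (k : ℕ) (hk : k < max N1 1) : |∑ j ∈ Finset.range k, z j - k * x| ≤
      ∑ k ∈ Finset.range (max N1 1), |∑ j ∈ Finset.range k, z j - k * x| :=
    Finset.single_le_sum (f := fun k : ℕ => |∑ j ∈ Finset.range k, z j - k * x|)
      (fun _ _ => abs_nonneg _) (Finset.mem_range.2 hk)
  set B := ∑ k ∈ Finset.range (max N1 1), |∑ j ∈ Finset.range k, z j - k * x|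
  have hlim : Tendsto (fun N : ℕ => η * (N : ℝ)) atTop atTop :=
    tendsto_natCast_atTop_atTop.const_mul_atTop hη
  filter_upwards [hlim.eventually_ge_atTop B] with N hN i hi k hk
  have hi' : η * (N : ℝ) ≤ η * i := by gcongr
  rcases lt_or_ge k (max N1 1) with h | h
  · exact (hB k h).trans (hN.trans hi')
  · refine (hbig k h).trans ?_
    gcongr

/-- An average whose summands are `z` before and nearly `e` after time `m` is close to the
corresponding convex combination of the limits, uniformly in `m`. -/
theorem eventually_abs_average_sub_le {z e c : ℕ → ℝ} {Q R C : ℝ} (n0 : ℕ) (q0 : ℝ)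
    (hz : Tendsto (fun n : ℕ => (n : ℝ)⁻¹ * ∑ j ∈ Finset.range n, z j) atTop (𝓝 Q))
    (he : Tendsto (fun n : ℕ => (n : ℝ)⁻¹ * ∑ j ∈ Finset.range n, e j) atTop (𝓝 R))
    (hc : Tendsto (fun n : ℕ => (n : ℝ)⁻¹ * ∑ j ∈ Finset.range n, c j) atTop (𝓝 C))
    (hc0 : ∀ j, 0 ≤ c j) {η : ℝ} (hη : 0 < η) :
    ∀ᶠ N : ℕ in atTop, ∀ i ≥ N, ∀ (m : ℕ) (f : ℕ → ℝ),
      (i ≤ m ∨ ∀ j, |f j - e j| ≤ 2 / ((N : ℝ) + 1) * c j) →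
      |((n0 : ℝ) + i)⁻¹ * (q0 + ∑ j ∈ Finset.range i, if j < m then z j else f j) -
        (((min i m : ℕ) : ℝ) / i * Q + (1 - ((min i m : ℕ) : ℝ) / i) * R)| ≤ η := by
  -- Error budget relative to `i`: `η/8` for each of three prefix sums (one of `z`, two of `e`),
  -- `η/4` for replacing `f` by `e`, and `η/4` for the initial term and the shift from `i` to `n0 +
  -- i`.
  have hz' := eventually_abs_partialSum_sub_le hz (η := η / 8) (by positivity)
  have he' := eventually_abs_partialSum_sub_le he (η := η / 8) (by positivity)
  have hc' := eventually_abs_partialSum_sub_le hc (η := 1) one_pos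
  have h1 : Tendsto (fun N : ℕ => 2 / ((N : ℝ) + 1) * (|C| + 1)) atTop (𝓝 0) := by
    have := (tendsto_one_div_add_atTop_nhds_zero_nat (𝕜 := ℝ)).const_mul (2 * (|C| + 1))
    rw [mul_zero] at this
    exact this.congr fun n => by ring
  have h2 : Tendsto (fun N : ℕ => η / 4 * (N : ℝ)) atTop atTop :=
    tendsto_natCast_atTop_atTop.const_mul_atTop (by positivity)
  filter_upwards [hz', he', hc', h1.eventually_le_const (show 0 < η / 4 by positivity),
    h2.eventually_ge_atTop (|q0| + n0 * (|Q| + |R|)), eventually_ge_atTop 1]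
    with N g1 g2 g3 g4 g5 g6 i hi m f hf
  have hi0 : (0 : ℝ) < i := by exact_mod_cast (g6.trans hi)
  set k := min i m with hk
  have hki : k ≤ i := min_le_left _ _
  have hki' : (k : ℝ) ≤ i := by exact_mod_cast hki
  have ht0 : 0 ≤ (k : ℝ) / i := by positivity
  have ht1 : (k : ℝ) / i ≤ 1 := (div_le_one hi0).2 hki'
  -- The block after the switch is a difference of two prefix sums of `e` plus the perturbation, so
  -- only prefix sums need to be controlled.
  have hsplit : ∑ j ∈ Finset.range i, (if j < m then z j else f j) =
      ∑ j ∈ Finset.range k, z j + (∑ j ∈ Finset.range i, e j - ∑ j ∈ Finset.range k, e j) +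
        ∑ j ∈ Finset.Ico k i, (f j - e j) := by
    rw [← Finset.sum_range_add_sum_Ico _ hki,
      ← Finset.sum_range_add_sum_Ico e hki, add_sub_cancel_left, add_assoc,
      ← Finset.sum_add_distrib]
    congr 1
    · exact Finset.sum_congr rfl fun j hj => if_pos (by
        have := Finset.mem_range.1 hj
        omega)
    · refine Finset.sum_congr rfl fun j hj => ?_
      have := Finset.mem_Ico.1 hj
      rw [if_neg (by omega)]
      ring
  have hrem : |∑ j ∈ Finset.Ico k i, (f j - e j)| ≤ η / 4 * i := by
    rcases hf with h | h
    · rw [hk, min_eq_left h]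
      simp only [Finset.Ico_self, Finset.sum_empty, abs_zero]
      positivity
    · have hcs := (abs_le.1 (g3 i hi i le_rfl)).2
      calc |∑ j ∈ Finset.Ico k i, (f j - e j)| ≤ ∑ j ∈ Finset.Ico k i, |f j - e j| :=
            Finset.abs_sum_le_sum_abs _ _
        _ ≤ ∑ j ∈ Finset.Ico k i, 2 / ((N : ℝ) + 1) * c j := Finset.sum_le_sum fun j _ => h j
        _ ≤ 2 / ((N : ℝ) + 1) * ∑ j ∈ Finset.range i, c j := by
            rw [← Finset.mul_sum]
            refine mul_le_mul_of_nonneg_left (Finset.sum_le_sum_of_subset_of_nonneg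
              (fun j hj => ?_) fun j _ _ => hc0 j) (by positivity)
            exact Finset.mem_range.2 (Finset.mem_Ico.1 hj).2
        _ ≤ 2 / ((N : ℝ) + 1) * ((|C| + 1) * i) := by
            gcongr
            nlinarith [le_abs_self C]
        _ = (2 / ((N : ℝ) + 1) * (|C| + 1)) * i := by ring
        _ ≤ η / 4 * i := by gcongr
  have hconst : |q0| + n0 * (|Q| + |R|) ≤ η / 4 * i := by
    refine g5.trans ?_
    gcongr
  have a1 := g1 i hi k hki
  have a2 := g2 i hi i le_rfl
  have a3 := g2 i hi k hki
  set t := (k : ℝ) / i with ht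
  have hkt : (k : ℝ) = t * i := by rw [ht]; field_simp
  have hcomb : |t * Q + (1 - t) * R| ≤ |Q| + |R| := by
    refine (abs_add_le _ _).trans ?_
    rw [abs_mul, abs_mul, abs_of_nonneg ht0, abs_of_nonneg (sub_nonneg.2 ht1)]
    have := mul_le_mul_of_nonneg_right ht1 (abs_nonneg Q)
    have := mul_le_mul_of_nonneg_right (show 1 - t ≤ 1 by linarith) (abs_nonneg R)
    linarith
  have hpos : (0 : ℝ) < (n0 : ℝ) + i := by positivity
  have e1 : ((n0 : ℝ) + i)⁻¹ * (q0 + ∑ j ∈ Finset.range i, if j < m then z j else f j) -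
      (t * Q + (1 - t) * R) = ((n0 : ℝ) + i)⁻¹ * (q0 - n0 * (t * Q + (1 - t) * R) +
        (∑ j ∈ Finset.range k, z j - k * Q) + (∑ j ∈ Finset.range i, e j - i * R) -
        (∑ j ∈ Finset.range k, e j - k * R) + ∑ j ∈ Finset.Ico k i, (f j - e j)) := by
    rw [hsplit, hkt]
    field_simp
    ring
  rw [e1, abs_mul, abs_of_pos (inv_pos.2 hpos), inv_mul_le_iff₀ hpos]
  have hn : |(n0 : ℝ) * (t * Q + (1 - t) * R)| ≤ n0 * (|Q| + |R|) := by
    rw [abs_mul, Nat.abs_cast]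
    gcongr
  have hn0η : 0 ≤ (n0 : ℝ) * η := by positivity
  rw [abs_le] at *
  constructor <;> nlinarith [neg_abs_le q0, le_abs_self q0]

theorem exists_entry_bound_of_mem_nhds {p q : ℕ} {U : Set (Matrix (Fin p) (Fin q) ℝ)}
    (hU : U ∈ 𝓝 (0 : Matrix (Fin p) (Fin q) ℝ)) :
    ∃ η > 0, ∀ A : Matrix (Fin p) (Fin q) ℝ, (∀ k l, |A k l| ≤ η) → A ∈ U := by
  change U ∈ 𝓝 (0 : Fin p → Fin q → ℝ) at hU
  obtain ⟨r, hr, hU⟩ := Metric.mem_nhds_iff.1 hU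
  have key (A : Fin p → Fin q → ℝ) (hA : ∀ k l, |A k l| ≤ r / 2) : A ∈ Metric.ball 0 r := by
    rw [mem_ball_zero_iff]
    refine ((pi_norm_le_iff_of_nonneg (by positivity)).2 fun k =>
      (pi_norm_le_iff_of_nonneg (by positivity)).2 fun l => ?_).trans_lt (half_lt_self hr)
    exact hA k l
  exact ⟨r / 2, by positivity, fun A hA => hU (key A hA)⟩

theorem abs_outer_add_sub_le {p : ℕ} (e h : EuclideanSpace ℝ (Fin p)) (k l : Fin p) :
    |outer (e + h) k l - outer e k l| ≤ 2 * ‖e‖ * ‖h‖ + ‖h‖ ^ 2 := by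
  have ek (v : EuclideanSpace ℝ (Fin p)) (k : Fin p) : |v k| ≤ ‖v‖ := PiLp.norm_apply_le v k
  have e1 : outer (e + h) k l - outer e k l = e k * h l + h k * e l + h k * h l := by
    simp only [outer, Matrix.vecMulVec_apply, PiLp.add_apply]
    ring
  rw [e1]
  refine (abs_add_le _ _).trans ?_
  have h1 := abs_add_le (e k * h l) (h k * e l)
  rw [abs_mul, abs_mul] at h1
  rw [abs_mul (h k)]
  have b1 := mul_le_mul (ek e k) (ek h l) (abs_nonneg _) (norm_nonneg _)
  have b2 := mul_le_mul (ek h k) (ek e l) (abs_nonneg _) (norm_nonneg _)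
  have b3 := mul_le_mul (ek h k) (ek h l) (abs_nonneg _) (norm_nonneg _)
  nlinarith

variable {dβ dg : ℕ}

/-- The estimate is linear in `κ`, since `κ ≤ 1` lets the quadratic term be absorbed, and its random
factor does not depend on `β`. A law of large numbers for that factor therefore handles weights
evaluated at a random `β`. -/
theorem abs_outer_g_sub_le (βs β : EuclideanSpace ℝ (Fin dβ)) (d : Obs dβ dg) {κ : ℝ}
    (hκ : ‖β - βs‖ ≤ κ) (hκ1 : κ ≤ 1) (k l : Fin dg) :
    |outer (g β d) k l - outer (g βs d) k l| ≤ 2 * κ * (‖g βs d‖ + ‖op (Gmat d)‖) ^ 2 := by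
  have h1 := abs_outer_add_sub_le (g βs d) (op (Gmat d) (β - βs)) k l
  rw [add_comm, ← g_eq] at h1
  refine h1.trans ?_
  have h2 : ‖op (Gmat d) (β - βs)‖ ≤ ‖op (Gmat d)‖ * κ :=
    ((op (Gmat d)).le_opNorm _).trans (by gcongr)
  have hκ0 : 0 ≤ κ := (norm_nonneg _).trans hκ
  calc 2 * ‖g βs d‖ * ‖op (Gmat d) (β - βs)‖ + ‖op (Gmat d) (β - βs)‖ ^ 2
      ≤ 2 * ‖g βs d‖ * (‖op (Gmat d)‖ * κ) + (‖op (Gmat d)‖ * κ) ^ 2 := by gcongr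
    _ ≤ 2 * ‖g βs d‖ * (‖op (Gmat d)‖ * κ) + ‖op (Gmat d)‖ ^ 2 * κ := by
        rw [mul_pow]
        gcongr
        nlinarith
    _ ≤ 2 * κ * (‖g βs d‖ + ‖op (Gmat d)‖) ^ 2 := by
        have : 0 ≤ κ * (‖g βs d‖ ^ 2 + ‖g βs d‖ * ‖op (Gmat d)‖) := by positivity
        have : 0 ≤ κ * ‖op (Gmat d)‖ ^ 2 := by positivity
        have : 0 ≤ κ * ‖g βs d‖ ^ 2 := by positivity
        have : 0 ≤ κ * (‖g βs d‖ * ‖op (Gmat d)‖) := by positivity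
        nlinarith

/-- Laws of large numbers along a sequence of observations. -/
structure IsErgodicPath (n0 : ℕ) (d : ℕ → Obs dβ dg) (βs : EuclideanSpace ℝ (Fin dβ))
    (G : Matrix (Fin dg) (Fin dβ) ℝ) (Q R : Matrix (Fin dg) (Fin dg) ℝ) : Prop where
  tendsto_G : Tendsto (fun n : ℕ => (n : ℝ)⁻¹ • ∑ j ∈ Finset.range n, Gmat (d j)) atTop (𝓝 G)
  tendsto_z : Tendsto (fun n : ℕ => (n : ℝ)⁻¹ • ∑ j ∈ Finset.range n, outer (Obs.z (d j))) atTop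
    (𝓝 Q)
  tendsto_g : Tendsto (fun n : ℕ => (n : ℝ)⁻¹ • ∑ j ∈ Finset.range n, outer (g βs (d j))) atTop
    (𝓝 R)
  tendsto_sq : ∃ C : ℝ, Tendsto (fun n : ℕ => (n : ℝ)⁻¹ *
    ∑ j ∈ Finset.range n, (‖g βs (d j)‖ + ‖op (Gmat (d j))‖) ^ 2) atTop (𝓝 C)

theorem tendsto_average_entry {p q : ℕ} {A : ℕ → Matrix (Fin p) (Fin q) ℝ}
    {B : Matrix (Fin p) (Fin q) ℝ}
    (h : Tendsto (fun n : ℕ => (n : ℝ)⁻¹ • ∑ j ∈ Finset.range n, A j) atTop (𝓝 B))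
    (k : Fin p) (l : Fin q) :
    Tendsto (fun n : ℕ => (n : ℝ)⁻¹ * ∑ j ∈ Finset.range n, A j k l) atTop (𝓝 (B k l)) := by
  refine (tendsto_pi_nhds.1 (tendsto_pi_nhds.1 h k) l).congr fun n => ?_
  simp [Matrix.sum_apply]

namespace IsErgodicPath

variable {n0 : ℕ} {d : ℕ → Obs dβ dg} {βs : EuclideanSpace ℝ (Fin dβ)}
  {G : Matrix (Fin dg) (Fin dβ) ℝ} {Q R : Matrix (Fin dg) (Fin dg) ℝ}

theorem tendsto_Φ (h : IsErgodicPath n0 d βs G Q R) (hn0 : 1 ≤ n0) (γ : ℕ → ℝ)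
    (s0 : State dβ dg) : Tendsto (fun i => (sgmm n0 γ s0 d 0 i).Φ) atTop (𝓝 G) := by
  have h1 : Tendsto (fun i : ℕ => ((n0 : ℝ) + i)⁻¹) atTop (𝓝 0) :=
    tendsto_inv_atTop_zero.comp (tendsto_atTop_add_const_left _ _ tendsto_natCast_atTop_atTop)
  have h2 : Tendsto (fun i : ℕ => (i : ℝ) * ((n0 : ℝ) + i)⁻¹) atTop (𝓝 1) := by
    have := (h1.const_mul (n0 : ℝ)).const_sub 1
    rw [mul_zero, sub_zero] at this
    refine this.congr fun i => ?_
    have hn : (0 : ℝ) < n0 := by exact_mod_cast hn0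
    have : (0 : ℝ) < (n0 : ℝ) + i := by positivity
    field_simp
    ring
  have h3 := (h1.smul_const ((n0 : ℝ) • s0.Φ)).add (h2.smul h.tendsto_G)
  rw [zero_smul, zero_add, one_smul] at h3
  refine h3.congr' ?_
  filter_upwards [eventually_ge_atTop 1] with i hi
  have hi0 : (i : ℝ) ≠ 0 := by positivity
  rw [sgmm_Φ hn0, smul_add]
  congr 1
  rw [smul_smul]
  congr 1
  field_simp

theorem sgmm_Φ_eq (hn0 : 1 ≤ n0) (γ : ℕ → ℝ) (s0 : State dβ dg) (m i : ℕ) :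
    (sgmm n0 γ s0 d m i).Φ = (sgmm n0 γ s0 d 0 i).Φ := by
  rw [sgmm_Φ hn0, sgmm_Φ hn0]

/-- The weighting matrices are uniformly close to convex combinations of their limits. -/
theorem eventually_weightAvg_close (h : IsErgodicPath n0 d βs G Q R) (γ : ℕ → ℝ)
    (s0 : State dβ dg) (Q0 : Matrix (Fin dg) (Fin dg) ℝ)
    {U : Set (Matrix (Fin dg) (Fin dg) ℝ)} (hU : U ∈ 𝓝 0) :
    ∀ᶠ N : ℕ in atTop, ∀ i ≥ N, ∀ m : ℕ,
      (i ≤ m ∨ ‖(s2sls n0 γ s0 d m).βbar - βs‖ ≤ 1 / ((N : ℝ) + 1)) →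
      weightAvg n0 γ s0 d Q0 m i -
        ((((min i m : ℕ) : ℝ) / i) • Q + (1 - ((min i m : ℕ) : ℝ) / i) • R) ∈ U := by
  obtain ⟨η, hη, hηU⟩ := exists_entry_bound_of_mem_nhds hU
  obtain ⟨C, hC⟩ := h.tendsto_sq
  have key : ∀ᶠ N : ℕ in atTop, ∀ k l, ∀ i ≥ N, ∀ (m : ℕ) (f : ℕ → ℝ),
      (i ≤ m ∨ ∀ j, |f j - outer (g βs (d j)) k l| ≤ 2 / ((N : ℝ) + 1) *
        (‖g βs (d j)‖ + ‖op (Gmat (d j))‖) ^ 2) →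
      |((n0 : ℝ) + i)⁻¹ * ((n0 : ℝ) * Q0 k l + ∑ j ∈ Finset.range i,
          if j < m then outer (Obs.z (d j)) k l else f j) -
        (((min i m : ℕ) : ℝ) / i * Q k l + (1 - ((min i m : ℕ) : ℝ) / i) * R k l)| ≤ η :=
    eventually_all.2 fun k => eventually_all.2 fun l =>
      eventually_abs_average_sub_le n0 _ (tendsto_average_entry h.tendsto_z k l)
        (tendsto_average_entry h.tendsto_g k l) hC (fun j => by positivity) hη
  filter_upwards [key] with N hN i hi m hm
  refine hηU _ fun k l => ?_
  have := hN k l i hi m (fun j => outer (g (s2sls n0 γ s0 d m).βbar (d j)) k l) ?_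
  · convert! this using 2
    simp only [weightAvg, Matrix.sub_apply, Matrix.add_apply, Matrix.smul_apply, smul_eq_mul,
      Matrix.sum_apply]
    congr 3
    refine Finset.sum_congr rfl fun j _ => ?_
    unfold weightVec
    split_ifs <;> rfl
  · refine hm.imp id fun hm j => ?_
    have hN1 : 1 / ((N : ℝ) + 1) ≤ 1 := by
      rw [div_le_one (by positivity)]
      have : (0 : ℝ) ≤ N := by positivity
      linarith
    have := abs_outer_g_sub_le βs _ (d j) hm hN1 k l
    rwa [mul_one_div] at this

/-- Eventually all pairs of Jacobian and weighting averages lie in a given neighborhood of the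
segment of limits. -/
theorem exists_forall_mem (h : IsErgodicPath n0 d βs G Q R) (hn0 : 1 ≤ n0) (γ : ℕ → ℝ)
    (s0 : State dβ dg) (Q0 : Matrix (Fin dg) (Fin dg) ℝ)
    {O : Set (Matrix (Fin dg) (Fin dβ) ℝ × Matrix (Fin dg) (Fin dg) ℝ)}
    (hO : ∀ t ∈ Set.Icc (0 : ℝ) 1, O ∈ 𝓝 (G, t • Q + (1 - t) • R)) :
    ∃ N : ℕ, ∀ i ≥ N, ∀ m : ℕ,
      (i ≤ m ∨ ‖(s2sls n0 γ s0 d m).βbar - βs‖ ≤ 1 / ((N : ℝ) + 1)) →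
      ((sgmm n0 γ s0 d m i).Φ, weightAvg n0 γ s0 d Q0 m i) ∈ O := by
  have hcont : Continuous fun x : (Matrix (Fin dg) (Fin dβ) ℝ × Matrix (Fin dg) (Fin dg) ℝ) × ℝ =>
      (x.1.1, x.1.2 + (x.2 • Q + (1 - x.2) • R)) := by fun_prop
  -- The tube lemma over the compact range of `t` yields one neighborhood that works for all mixing
  -- fractions, hence for all warm-up lengths.
  have htube : ∀ᶠ x in 𝓝 ((G, 0) : Matrix (Fin dg) (Fin dβ) ℝ × Matrix (Fin dg) (Fin dg) ℝ),
      ∀ t ∈ Set.Icc (0 : ℝ) 1, (x.1, x.2 + (t • Q + (1 - t) • R)) ∈ O := by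
    refine isCompact_Icc.eventually_forall_of_forall_eventually fun t ht => ?_
    have := hcont.tendsto ((G, 0), t)
    simp only [zero_add] at this
    exact this (hO t ht)
  rw [nhds_prod_eq] at htube
  obtain ⟨U1, hU1, U2, hU2, hU⟩ := mem_prod_iff.1 htube
  have e1 := (h.tendsto_Φ hn0 γ s0).eventually hU1
  obtain ⟨N1, hN1⟩ := eventually_atTop.1 e1
  obtain ⟨N, hN⟩ := ((h.eventually_weightAvg_close γ s0 Q0 hU2).and
    (eventually_ge_atTop (max N1 1))).exists
  obtain ⟨hNa, hNb⟩ := hN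
  refine ⟨N, fun i hi m hm => ?_⟩
  have hi0 : (0 : ℝ) < i := by exact_mod_cast ((le_of_max_le_right hNb).trans hi)
  have hmem := hU (Set.mk_mem_prod (hN1 i ((le_of_max_le_left hNb).trans hi)) (hNa i hi m hm))
    (((min i m : ℕ) : ℝ) / i)
    ⟨by positivity, (div_le_one hi0).2 (by exact_mod_cast min_le_left i m)⟩
  rw [sgmm_Φ_eq hn0]
  simpa using hmem

/-- Well after the change of regime the pairs are close to the limit of the second regime. -/
theorem exists_forall_mem_of_le (h : IsErgodicPath n0 d βs G Q R) (hn0 : 1 ≤ n0) (γ : ℕ → ℝ)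
    (s0 : State dβ dg) (Q0 : Matrix (Fin dg) (Fin dg) ℝ)
    {O : Set (Matrix (Fin dg) (Fin dβ) ℝ × Matrix (Fin dg) (Fin dg) ℝ)} (hO : O ∈ 𝓝 (G, R)) :
    ∃ N : ℕ, ∀ i ≥ N, ∀ m : ℕ, N * m ≤ i →
      ‖(s2sls n0 γ s0 d m).βbar - βs‖ ≤ 1 / ((N : ℝ) + 1) →
      ((sgmm n0 γ s0 d m i).Φ, weightAvg n0 γ s0 d Q0 m i) ∈ O := by
  have hcont : Continuous fun x : Matrix (Fin dg) (Fin dβ) ℝ × Matrix (Fin dg) (Fin dg) ℝ × ℝ =>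
      (x.1, x.2.1 + (x.2.2 • Q + (1 - x.2.2) • R)) := by fun_prop
  have htube : ∀ᶠ x in 𝓝 ((G, 0, 0) : Matrix (Fin dg) (Fin dβ) ℝ ×
      Matrix (Fin dg) (Fin dg) ℝ × ℝ), (x.1, x.2.1 + (x.2.2 • Q + (1 - x.2.2) • R)) ∈ O := by
    have := hcont.tendsto (G, 0, 0)
    simp only [zero_add, zero_smul, sub_zero, one_smul] at this
    exact this hO
  rw [nhds_prod_eq, nhds_prod_eq] at htube
  obtain ⟨U1, hU1, U', hU', hU⟩ := mem_prod_iff.1 htube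
  obtain ⟨U2, hU2, U3, hU3, hUU⟩ := mem_prod_iff.1 hU'
  obtain ⟨r, hr, hrU⟩ := Metric.mem_nhds_iff.1 hU3
  obtain ⟨N1, hN1⟩ := eventually_atTop.1 ((h.tendsto_Φ hn0 γ s0).eventually hU1)
  have hr1 : ∀ᶠ N : ℕ in atTop, 1 / (N : ℝ) < r :=
    tendsto_one_div_atTop_nhds_zero_nat.eventually_lt_const hr
  obtain ⟨N, ⟨hNa, hNb⟩, hNc⟩ := (((h.eventually_weightAvg_close γ s0 Q0 hU2).and
    (eventually_ge_atTop (max N1 1))).and hr1).exists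
  refine ⟨N, fun i hi m hmi hm => ?_⟩
  have hN0 : (0 : ℝ) < N := by exact_mod_cast (le_of_max_le_right hNb)
  have hi0 : (0 : ℝ) < i := by exact_mod_cast ((le_of_max_le_right hNb).trans hi)
  -- Since `N m ≤ i`, the warm-up fraction of the sample is at most `1/N`, which places the mixture
  -- near its endpoint `t = 0`.
  have ht : ((min i m : ℕ) : ℝ) / i ∈ U3 := by
    refine hrU ?_
    rw [mem_ball_zero_iff, Real.norm_of_nonneg (by positivity)]
    refine lt_of_le_of_lt ?_ hNc
    rw [div_le_div_iff₀ hi0 hN0, one_mul]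
    have : min i m * N ≤ i := by
      calc min i m * N ≤ m * N := Nat.mul_le_mul_right _ (min_le_right _ _)
        _ ≤ i := by rwa [mul_comm]
    exact_mod_cast this
  have hmem := hU (Set.mk_mem_prod (hN1 i ((le_of_max_le_left hNb).trans hi))
    (hUU (Set.mk_mem_prod (hNa i hi m (Or.inr hm)) ht)))
  rw [sgmm_Φ_eq hn0]
  simpa using hmem

end IsErgodicPath

end

section

variable {dβ dg : ℕ}

/-! ### The gain near its limits -/

/-- Jacobian and weighting averages whose gain is bounded and nearly left inverse to `Γ`. -/
def regularSet (M : ℝ) (Γ : EuclideanSpace ℝ (Fin dβ) →L[ℝ] EuclideanSpace ℝ (Fin dg)) :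
    Set (Matrix (Fin dg) (Fin dβ) ℝ × Matrix (Fin dg) (Fin dg) ℝ) :=
  {x | (x.1.transpose * x.2 * x.1).det ≠ 0 ∧ ‖gain x.1 x.2‖ ≤ M ∧
    ‖(gain x.1 x.2).comp Γ - 1‖ ≤ 1 / 4}

open Classical in
/-- The gain on the regular set, replaced by `As` elsewhere. -/
def truncGain (M : ℝ) (Γ : EuclideanSpace ℝ (Fin dβ) →L[ℝ] EuclideanSpace ℝ (Fin dg))
    (As : EuclideanSpace ℝ (Fin dg) →L[ℝ] EuclideanSpace ℝ (Fin dβ))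
    (x : Matrix (Fin dg) (Fin dβ) ℝ × Matrix (Fin dg) (Fin dg) ℝ) :
    EuclideanSpace ℝ (Fin dg) →L[ℝ] EuclideanSpace ℝ (Fin dβ) :=
  if x ∈ regularSet M Γ then gain x.1 x.2 else As

/-- The gain inverts its own Jacobian average exactly, whatever the weighting; only `Φ - G` can
spoil the inversion of `G`. -/
theorem gain_comp_op {Φ : Matrix (Fin dg) (Fin dβ) ℝ} {W : Matrix (Fin dg) (Fin dg) ℝ}
    (h : (Φ.transpose * W * Φ).det ≠ 0) : (gain Φ W).comp (op Φ) = 1 := by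
  rw [gain, ← op_mul, pinv_eq_inv h.isUnit, Matrix.mul_assoc, Matrix.mul_assoc,
    ← Matrix.mul_assoc Φ.transpose, Matrix.nonsing_inv_mul _ h.isUnit, op_one]

theorem measurable_gain_uncurry :
    Measurable fun x : Matrix (Fin dg) (Fin dβ) ℝ × Matrix (Fin dg) (Fin dg) ℝ =>
      gain x.1 x.2 := measurable_gain measurable_fst measurable_snd

theorem measurableSet_regularSet (M : ℝ)
    (Γ : EuclideanSpace ℝ (Fin dβ) →L[ℝ] EuclideanSpace ℝ (Fin dg)) :
    MeasurableSet (regularSet M Γ) := by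
  have h1 : Measurable fun x : Matrix (Fin dg) (Fin dβ) ℝ × Matrix (Fin dg) (Fin dg) ℝ =>
      (x.1.transpose * x.2 * x.1).det := by
    have : Continuous fun x : Matrix (Fin dg) (Fin dβ) ℝ × Matrix (Fin dg) (Fin dg) ℝ =>
      (x.1.transpose * x.2 * x.1).det := by fun_prop
    exact this.measurable
  have h2 : Measurable fun x : Matrix (Fin dg) (Fin dβ) ℝ × Matrix (Fin dg) (Fin dg) ℝ =>
      ‖(gain x.1 x.2).comp Γ - 1‖ := by
    have : Continuous fun A : EuclideanSpace ℝ (Fin dg) →L[ℝ] EuclideanSpace ℝ (Fin dβ) =>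
      ‖A.comp Γ - 1‖ := by fun_prop
    exact this.measurable.comp measurable_gain_uncurry
  exact (h1 (measurableSet_singleton 0).compl).inter
    ((measurableSet_le measurable_gain_uncurry.norm measurable_const).inter
      (measurableSet_le h2 measurable_const))

theorem measurable_truncGain (M : ℝ)
    (Γ : EuclideanSpace ℝ (Fin dβ) →L[ℝ] EuclideanSpace ℝ (Fin dg))
    (As : EuclideanSpace ℝ (Fin dg) →L[ℝ] EuclideanSpace ℝ (Fin dβ)) :
    Measurable (truncGain M Γ As) :=
  Measurable.ite (measurableSet_regularSet M Γ) measurable_gain_uncurry measurable_const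

section truncGain

variable {M : ℝ} {G : Matrix (Fin dg) (Fin dβ) ℝ}
  {Γ : EuclideanSpace ℝ (Fin dβ) →L[ℝ] EuclideanSpace ℝ (Fin dg)}
  {As : EuclideanSpace ℝ (Fin dg) →L[ℝ] EuclideanSpace ℝ (Fin dβ)}

theorem norm_truncGain_le (hM : ‖As‖ ≤ M)
    (x : Matrix (Fin dg) (Fin dβ) ℝ × Matrix (Fin dg) (Fin dg) ℝ) : ‖truncGain M Γ As x‖ ≤ M := by
  unfold truncGain
  split_ifs with h
  · exact h.2.1
  · exact hM

theorem norm_truncGain_comp_sub_one_le (hAs : As.comp Γ = 1)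
    (x : Matrix (Fin dg) (Fin dβ) ℝ × Matrix (Fin dg) (Fin dg) ℝ) :
    ‖(truncGain M Γ As x).comp Γ - 1‖ ≤ 1 / 4 := by
  unfold truncGain
  split_ifs with h
  · exact h.2.2
  · rw [hAs, sub_self, norm_zero]
    norm_num

/-- From `A Φ = 1` one gets `A G - 1 = -A (Φ - G)`. The deviation thus has the root-n rate of the
Jacobian average and does not see how slowly the weighting matrix converges. -/
theorem norm_truncGain_comp_sub_one_le_mul (hM0 : 0 ≤ M) (hAs : As.comp (op G) = 1)
    (x : Matrix (Fin dg) (Fin dβ) ℝ × Matrix (Fin dg) (Fin dg) ℝ) :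
    ‖(truncGain M (op G) As x).comp (op G) - 1‖ ≤ M * ‖op (x.1 - G)‖ := by
  unfold truncGain
  split_ifs with h
  · have e : (gain x.1 x.2).comp (op G) - 1 = -(gain x.1 x.2).comp (op (x.1 - G)) := by
      rw [map_sub, ContinuousLinearMap.comp_sub, gain_comp_op h.1]
      abel
    rw [e, norm_neg]
    exact (ContinuousLinearMap.opNorm_comp_le _ _).trans (by gcongr; exact h.2.1)
  · rw [hAs, sub_self, norm_zero]
    positivity

end truncGain

theorem det_ne_zero_of_posDef {G : Matrix (Fin dg) (Fin dβ) ℝ} (hG : (G.transpose * G).PosDef)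
    {S : Matrix (Fin dg) (Fin dg) ℝ} (hS : S.PosDef) : (G.transpose * S⁻¹ * G).det ≠ 0 :=
  (transpose_mul_mul_posDef hS.inv hG).det_pos.ne'

/-- Near an invertible `Φ'WΦ` the pseudoinverse is the inverse, which is continuous. -/
theorem continuousAt_gain {Φ : Matrix (Fin dg) (Fin dβ) ℝ} {W : Matrix (Fin dg) (Fin dg) ℝ}
    (h : (Φ.transpose * W * Φ).det ≠ 0) :
    ContinuousAt (fun x : Matrix (Fin dg) (Fin dβ) ℝ × Matrix (Fin dg) (Fin dg) ℝ =>
      gain x.1 x.2) (Φ, W) := by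
  have hB : Continuous fun x : Matrix (Fin dg) (Fin dβ) ℝ × Matrix (Fin dg) (Fin dg) ℝ =>
      x.1.transpose * x.2 * x.1 := by fun_prop
  have hdet : ∀ᶠ x : Matrix (Fin dg) (Fin dβ) ℝ × Matrix (Fin dg) (Fin dg) ℝ in 𝓝 (Φ, W),
      (x.1.transpose * x.2 * x.1).det ≠ 0 :=
    (hB.matrix_det.continuousAt (x := (Φ, W))).eventually_ne h
  have hinv : ContinuousAt (fun x : Matrix (Fin dg) (Fin dβ) ℝ × Matrix (Fin dg) (Fin dg) ℝ =>
      (x.1.transpose * x.2 * x.1)⁻¹) (Φ, W) :=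
    ContinuousAt.comp (g := fun A : Matrix (Fin dβ) (Fin dβ) ℝ => A⁻¹)
      (f := fun x : Matrix (Fin dg) (Fin dβ) ℝ × Matrix (Fin dg) (Fin dg) ℝ =>
        x.1.transpose * x.2 * x.1) (x := (Φ, W)) (continuousAt_matrix_inv h) hB.continuousAt
  have hmul : Continuous fun y : Matrix (Fin dβ) (Fin dβ) ℝ × Matrix (Fin dg) (Fin dβ) ℝ ×
      Matrix (Fin dg) (Fin dg) ℝ => op (y.1 * y.2.1.transpose * y.2.2) :=
    continuous_op.comp (by fun_prop)
  have hall : ContinuousAt (fun x : Matrix (Fin dg) (Fin dβ) ℝ × Matrix (Fin dg) (Fin dg) ℝ =>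
      op ((x.1.transpose * x.2 * x.1)⁻¹ * x.1.transpose * x.2)) (Φ, W) :=
    ContinuousAt.comp (g := fun y : Matrix (Fin dβ) (Fin dβ) ℝ × Matrix (Fin dg) (Fin dβ) ℝ ×
      Matrix (Fin dg) (Fin dg) ℝ => op (y.1 * y.2.1.transpose * y.2.2))
      (f := fun x : Matrix (Fin dg) (Fin dβ) ℝ × Matrix (Fin dg) (Fin dg) ℝ =>
        ((x.1.transpose * x.2 * x.1)⁻¹, x)) (x := (Φ, W))
      hmul.continuousAt (hinv.prodMk continuousAt_id)
  refine hall.congr (hdet.mono fun x hx => ?_)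
  simp only [gain, pinv_eq_inv hx.isUnit]

theorem continuousAt_gain_inv {G : Matrix (Fin dg) (Fin dβ) ℝ} (hG : (G.transpose * G).PosDef)
    {S : Matrix (Fin dg) (Fin dg) ℝ} (hS : S.PosDef) :
    ContinuousAt (fun x : Matrix (Fin dg) (Fin dβ) ℝ × Matrix (Fin dg) (Fin dg) ℝ =>
      gain x.1 x.2⁻¹) (G, S) := by
  have h1 : ContinuousAt (fun x : Matrix (Fin dg) (Fin dβ) ℝ × Matrix (Fin dg) (Fin dg) ℝ =>
      (x.1, x.2⁻¹)) (G, S) :=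
    continuousAt_fst.prodMk (ContinuousAt.comp
      (g := fun A : Matrix (Fin dg) (Fin dg) ℝ => A⁻¹) (f := Prod.snd) (x := (G, S))
      (continuousAt_matrix_inv hS.det_pos.ne') continuousAt_snd)
  exact ContinuousAt.comp
    (g := fun x : Matrix (Fin dg) (Fin dβ) ℝ × Matrix (Fin dg) (Fin dg) ℝ => gain x.1 x.2)
    (f := fun x : Matrix (Fin dg) (Fin dβ) ℝ × Matrix (Fin dg) (Fin dg) ℝ => (x.1, x.2⁻¹))
    (x := (G, S)) (continuousAt_gain (det_ne_zero_of_posDef hG hS)) h1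

/-- At `(G, S)` the three defining conditions hold strictly, the last because the gain there is an
exact left inverse of `G`; continuity of the gain extends them to a neighborhood. -/
theorem regularSet_mem_nhds {G : Matrix (Fin dg) (Fin dβ) ℝ} (hG : (G.transpose * G).PosDef)
    {S : Matrix (Fin dg) (Fin dg) ℝ} (hS : S.PosDef) {M : ℝ} (hM : ‖gain G S⁻¹‖ < M) :
    {x : Matrix (Fin dg) (Fin dβ) ℝ × Matrix (Fin dg) (Fin dg) ℝ |
      (x.1, x.2⁻¹) ∈ regularSet M (op G)} ∈ 𝓝 (G, S) := by
  have hc := continuousAt_gain_inv hG hS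
  have hdet0 := det_ne_zero_of_posDef hG hS
  have h1 : ContinuousAt (fun x : Matrix (Fin dg) (Fin dβ) ℝ × Matrix (Fin dg) (Fin dg) ℝ =>
      (x.1, x.2⁻¹)) (G, S) :=
    continuousAt_fst.prodMk (ContinuousAt.comp
      (g := fun A : Matrix (Fin dg) (Fin dg) ℝ => A⁻¹) (f := Prod.snd) (x := (G, S))
      (continuousAt_matrix_inv hS.det_pos.ne') continuousAt_snd)
  have hB : Continuous fun x : Matrix (Fin dg) (Fin dβ) ℝ × Matrix (Fin dg) (Fin dg) ℝ =>
      (x.1.transpose * x.2 * x.1).det := by fun_prop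
  have h2 : ContinuousAt (fun x : Matrix (Fin dg) (Fin dβ) ℝ × Matrix (Fin dg) (Fin dg) ℝ =>
      (x.1.transpose * x.2⁻¹ * x.1).det) (G, S) :=
    ContinuousAt.comp
      (g := fun x : Matrix (Fin dg) (Fin dβ) ℝ × Matrix (Fin dg) (Fin dg) ℝ =>
        (x.1.transpose * x.2 * x.1).det)
      (f := fun x : Matrix (Fin dg) (Fin dβ) ℝ × Matrix (Fin dg) (Fin dg) ℝ => (x.1, x.2⁻¹))
      (x := (G, S)) hB.continuousAt h1
  have h3 : ContinuousAt (fun x : Matrix (Fin dg) (Fin dβ) ℝ × Matrix (Fin dg) (Fin dg) ℝ =>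
      ‖(gain x.1 x.2⁻¹).comp (op G) - 1‖) (G, S) :=
    ((hc.clm_comp continuousAt_const).sub continuousAt_const).norm
  have h4 : ‖(gain G S⁻¹).comp (op G) - 1‖ < 1 / 4 := by
    rw [gain_comp_op hdet0, sub_self, norm_zero]
    norm_num
  filter_upwards [h2.eventually_ne hdet0, hc.norm.eventually_lt_const hM,
    h3.eventually_lt_const h4] with x g1 g2 g3
  exact ⟨g1, g2.le, g3.le⟩

theorem posDef_segment {p : ℕ} {Q R : Matrix (Fin p) (Fin p) ℝ} (hQ : Q.PosDef) (hR : R.PosDef)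
    {t : ℝ} (ht : t ∈ Set.Icc (0 : ℝ) 1) : (t • Q + (1 - t) • R).PosDef := by
  rcases ht.1.eq_or_lt with rfl | h
  · simpa using hR
  · exact (hQ.smul h).add_posSemidef (hR.posSemidef.smul (sub_nonneg.2 ht.2))

theorem exists_regularSet_mem_nhds {G : Matrix (Fin dg) (Fin dβ) ℝ}
    (hG : (G.transpose * G).PosDef) {Q R : Matrix (Fin dg) (Fin dg) ℝ} (hQ : Q.PosDef)
    (hR : R.PosDef) : ∃ M : ℝ, ‖gain G R⁻¹‖ ≤ M ∧ ∀ t ∈ Set.Icc (0 : ℝ) 1,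
      {x : Matrix (Fin dg) (Fin dβ) ℝ × Matrix (Fin dg) (Fin dg) ℝ |
        (x.1, x.2⁻¹) ∈ regularSet M (op G)} ∈ 𝓝 (G, t • Q + (1 - t) • R) := by
  have hcont : ContinuousOn (fun t : ℝ => gain G (t • Q + (1 - t) • R)⁻¹) (Set.Icc 0 1) := by
    intro t ht
    have h1 : Continuous fun t : ℝ => (G, t • Q + (1 - t) • R) := by fun_prop
    exact (ContinuousAt.comp (g := fun x : Matrix (Fin dg) (Fin dβ) ℝ ×
      Matrix (Fin dg) (Fin dg) ℝ => gain x.1 x.2⁻¹) (f := fun t : ℝ => (G, t • Q + (1 - t) • R))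
      (x := t) (continuousAt_gain_inv hG (posDef_segment hQ hR ht))
      h1.continuousAt).continuousWithinAt
  obtain ⟨C, hC⟩ := isCompact_Icc.exists_bound_of_continuousOn hcont
  -- Compactness of the segment gives the bound `C`; the extra `1` supplies the strict inequality
  -- that the neighborhoods require. The endpoint `t = 0` gives the bound on the limit gain.
  refine ⟨C + 1, ?_, fun t ht => regularSet_mem_nhds hG (posDef_segment hQ hR ht)
    ((hC t ht).trans_lt (lt_add_one C))⟩
  have := hC 0 (by simp)
  simp only [zero_smul, sub_zero, one_smul, zero_add] at this
  linarith

end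

section

variable {dβ dg : ℕ}

/-! ### The model -/

/-- The standing assumptions on the sample, the moment function and the initialization. -/
structure IsModel {Ω : Type*} [MeasurableSpace Ω] (μ : Measure Ω) {n0 : ℕ}
    (P : Measure (Obs dβ dg)) (D0 : Fin n0 → Ω → Obs dβ dg) (D : ℕ → Ω → Obs dβ dg)
    (βs : EuclideanSpace ℝ (Fin dβ)) (η0 : ℝ) (b0 : Ω → EuclideanSpace ℝ (Fin dβ)) : Prop where
  sample : IsSample μ P D0 D
  one_le : 1 ≤ n0
  zz : Integrable (fun d : Obs dβ dg => ‖Obs.z d‖ ^ 2) P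
  posDef_G : ((Gpop P).transpose * Gpop P).PosDef
  posDef_z : (meanMat P fun d => outer (Obs.z d)).PosDef
  posDef_g : (varg P βs).PosDef
  mean : ∫ d, g βs d ∂P = 0
  sq_G : Integrable (fun d => opNorm (Gmat d) ^ 2) P
  sq_g : Integrable (fun d => ‖g βs d‖ ^ 2) P
  nonneg : 0 ≤ η0
  isUnit : ∀ᵐ ω ∂μ, IsUnit (Q0 η0 fun j => D0 j ω)
  measurable_init : Measurable[MeasurableSpace.comap (fun ω j => D0 j ω) inferInstance] b0

/-- The algorithm along a path, with warm-up length `m`. -/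
def run {Ω : Type*} {n0 : ℕ} (D0 : Fin n0 → Ω → Obs dβ dg) (D : ℕ → Ω → Obs dβ dg) (η0 : ℝ)
    (b0 : Ω → EuclideanSpace ℝ (Fin dβ)) (γ : ℕ → ℝ) (m i : ℕ) (ω : Ω) : State dβ dg :=
  sgmm n0 γ (init η0 (fun j => D0 j ω) (b0 ω)) (fun i => D i ω) m i

/-- The limit of the gain. -/
def limitGain (P : Measure (Obs dβ dg)) (βs : EuclideanSpace ℝ (Fin dβ)) :
    EuclideanSpace ℝ (Fin dg) →L[ℝ] EuclideanSpace ℝ (Fin dβ) :=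
  gain (Gpop P) (varg P βs)⁻¹

section Moments

variable {P : Measure (Obs dβ dg)} [IsProbabilityMeasure P] {βs : EuclideanSpace ℝ (Fin dβ)}

theorem memLp_coord {p : ℕ} {f : Obs dβ dg → EuclideanSpace ℝ (Fin p)} (hf : MemLp f 2 P)
    (k : Fin p) : MemLp (fun d => f d k) 2 P :=
  (EuclideanSpace.proj k : EuclideanSpace ℝ (Fin p) →L[ℝ] ℝ).comp_memLp' hf

theorem memLp_z (h : Integrable (fun d : Obs dβ dg => ‖Obs.z d‖ ^ 2) P) :
    MemLp (fun d : Obs dβ dg => Obs.z d) 2 P :=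
  (memLp_two_iff_integrable_sq_norm
    (measurable_fst.comp measurable_snd).aestronglyMeasurable).2 h

theorem integrable_outer {p : ℕ} {f : Obs dβ dg → EuclideanSpace ℝ (Fin p)} (hf : MemLp f 2 P)
    (k l : Fin p) : Integrable (fun d => outer (f d) k l) P := by
  simp only [outer, Matrix.vecMulVec_apply]
  exact (memLp_coord hf k).integrable_mul (memLp_coord hf l)

theorem meanMat_outer_g (hg2 : Integrable (fun d => ‖g βs d‖ ^ 2) P)
    (h0 : ∫ d, g βs d ∂P = 0) : meanMat P (fun d => outer (g βs d)) = varg P βs := by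
  have hL := memLp_g βs hg2
  have hz (k : Fin dg) : ∫ d, g βs d k ∂P = 0 := by
    have := (EuclideanSpace.proj k : EuclideanSpace ℝ (Fin dg) →L[ℝ] ℝ).integral_comp_comm
      (hL.integrable one_le_two)
    rw [h0, map_zero] at this
    exact this
  ext k l
  simp only [meanMat, varg, Matrix.of_apply]
  rw [covariance_eq_sub (memLp_coord hL k) (memLp_coord hL l), hz, zero_mul, sub_zero]
  rfl

end Moments

/-- Almost sure eventual validity of a monotone sequence of events holds at a fixed time with
large probability. -/
theorem exists_measure_compl_le {Ω : Type*} [MeasurableSpace Ω] {μ : Measure Ω}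
    [IsProbabilityMeasure μ] {s : ℕ → Set Ω} (hs : ∀ N, MeasurableSet (s N)) (hmono : Monotone s)
    (h : ∀ᵐ ω ∂μ, ∃ N, ω ∈ s N) {δ : ℝ} (hδ : 0 < δ) :
    ∀ᶠ N in atTop, μ (s N)ᶜ ≤ ENNReal.ofReal δ := by
  have h1 := tendsto_measure_iInter_atTop (μ := μ) (s := fun N => (s N)ᶜ)
    (fun N => (hs N).compl.nullMeasurableSet)
    (fun N N' hN => Set.compl_subset_compl.2 (hmono hN)) ⟨0, measure_ne_top _ _⟩
  have h2 : μ (⋂ N, (s N)ᶜ) = 0 := by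
    refine measure_mono_null ?_ (ae_iff.1 h)
    intro ω hω
    simpa using hω
  rw [h2] at h1
  exact (h1.eventually_lt_const (ENNReal.ofReal_pos.2 hδ)).mono fun N hN => hN.le

namespace IsModel

variable {Ω : Type*} [mΩ : MeasurableSpace Ω] {μ : Measure Ω} [IsProbabilityMeasure μ] {n0 : ℕ}
  {P : Measure (Obs dβ dg)} {D0 : Fin n0 → Ω → Obs dβ dg} {D : ℕ → Ω → Obs dβ dg}
  {βs : EuclideanSpace ℝ (Fin dβ)} {η0 : ℝ} {b0 : Ω → EuclideanSpace ℝ (Fin dβ)}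

theorem isProbabilityMeasure (h : IsModel μ P D0 D βs η0 b0) : IsProbabilityMeasure P :=
  h.sample.isProbabilityMeasure

theorem isDriven (h : IsModel μ P D0 D βs η0 b0) :
    IsDriven μ (obsFiltration D0 D) D P (fun d => op (Gmat d)) (g βs) (op (Gpop P)) :=
  have := h.isProbabilityMeasure
  h.sample.isDriven h.sq_G h.sq_g h.mean

theorem measurableState (h : IsModel μ P D0 D βs η0 b0) (γ : ℕ → ℝ) (m i : ℕ) :
    MeasurableState (obsFiltration D0 D i) (run D0 D η0 b0 γ m i) :=
  measurableState_sgmm (measurableState_init η0 h.measurable_init) γ m i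

theorem measurableState' (h : IsModel μ P D0 D βs η0 b0) (γ : ℕ → ℝ) (m i : ℕ) :
    MeasurableState mΩ (run D0 D η0 b0 γ m i) :=
  have hs := h.measurableState γ m i
  have hle := h.sample.obsFiltration_le i
  ⟨hs.β.mono hle le_rfl, hs.Φ.mono hle le_rfl, hs.W.mono hle le_rfl, hs.βbar.mono hle le_rfl⟩

theorem ae_isErgodicPath (h : IsModel μ P D0 D βs η0 b0) :
    ∀ᵐ ω ∂μ, IsErgodicPath n0 (fun i => D i ω) βs (Gpop P)
      (meanMat P fun d => outer (Obs.z d)) (varg P βs) := by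
  have := h.isProbabilityMeasure
  have h1 := h.sample.ae_tendsto_average_matrix (f := Gmat)
    (fun k l => measurable_matrix_entry continuous_Gmat.measurable k l)
    (fun k l => (memLp_Gmat_entry h.sq_G k l).integrable one_le_two)
  have h2 := h.sample.ae_tendsto_average_matrix (f := fun d => outer (Obs.z d))
    (fun k l => measurable_matrix_entry (continuous_outer.measurable.comp
      (measurable_fst.comp measurable_snd)) k l)
    (integrable_outer (memLp_z h.zz))
  have h3 := h.sample.ae_tendsto_average_matrix (f := fun d => outer (g βs d))
    (fun k l => measurable_matrix_entry (continuous_outer.measurable.comp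
      (measurable_g_const βs)) k l)
    (integrable_outer (memLp_g βs h.sq_g))
  rw [meanMat_outer_g h.sq_g h.mean] at h3
  have h4 := h.sample.ae_tendsto_average (f := fun d => (‖g βs d‖ + ‖op (Gmat d)‖) ^ 2)
    (((measurable_g_const βs).norm.add measurable_op_Gmat.norm).pow_const 2)
    (((memLp_g βs h.sq_g).norm.add (memLp_op_Gmat h.sq_G).norm).integrable_sq)
  filter_upwards [h1, h2, h3, h4] with ω g1 g2 g3 g4
  exact ⟨g1, g2, g3, _, g4⟩

theorem run_βbar_eq (γ : ℕ → ℝ) (m : ℕ) (ω : Ω) : (run D0 D η0 b0 γ m m ω).βbar =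
    (s2sls n0 γ (init η0 (fun j => D0 j ω) (b0 ω)) (fun i => D i ω) m).βbar := by
  rw [run, sgmm_eq_s2sls _ _ _ _ _ _ le_rfl]

theorem ae_run_W (h : IsModel μ P D0 D βs η0 b0) (γ : ℕ → ℝ) :
    ∀ᵐ ω ∂μ, ∀ m i, (run D0 D η0 b0 γ m i ω).W =
      (weightAvg n0 γ (init η0 (fun j => D0 j ω) (b0 ω)) (fun i => D i ω)
        (Q0 η0 fun j => D0 j ω) m i)⁻¹ := by
  filter_upwards [h.isUnit] with ω hω m i
  exact sgmm_W h.one_le γ _ _ (Q0_posDef h.nonneg hω) rfl m i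

/-- The bound `M` depends only on the population limits, so it is deterministic; only the time `N`
depends on the path. -/
theorem exists_ae_mem_regularSet (h : IsModel μ P D0 D βs η0 b0) :
    ∃ M : ℝ, ‖limitGain P βs‖ ≤ M ∧ ∀ γ : ℕ → ℝ, ∀ᵐ ω ∂μ, ∃ N : ℕ, ∀ i ≥ N, ∀ m : ℕ,
      (i ≤ m ∨ ‖(run D0 D η0 b0 γ m m ω).βbar - βs‖ ≤ 1 / ((N : ℝ) + 1)) →
      ((run D0 D η0 b0 γ m i ω).Φ, (run D0 D η0 b0 γ m i ω).W) ∈ regularSet M (op (Gpop P)) := by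
  obtain ⟨M, hM, hO⟩ := exists_regularSet_mem_nhds h.posDef_G h.posDef_z h.posDef_g
  refine ⟨M, hM, fun γ => ?_⟩
  filter_upwards [h.ae_isErgodicPath, h.ae_run_W γ] with ω hω hW
  obtain ⟨N, hN⟩ := hω.exists_forall_mem h.one_le γ (init η0 (fun j => D0 j ω) (b0 ω))
    (Q0 η0 fun j => D0 j ω) hO
  refine ⟨N, fun i hi m him => ?_⟩
  rw [run_βbar_eq] at him
  rw [hW]
  exact hN i hi m him

theorem ae_exists_norm_gain_sub_le (h : IsModel μ P D0 D βs η0 b0) (γ : ℕ → ℝ) {κ : ℝ}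
    (hκ : 0 < κ) : ∀ᵐ ω ∂μ, ∃ N : ℕ, ∀ i ≥ N, ∀ m : ℕ, N * m ≤ i →
      ‖(run D0 D η0 b0 γ m m ω).βbar - βs‖ ≤ 1 / ((N : ℝ) + 1) →
      ‖gain (run D0 D η0 b0 γ m i ω).Φ (run D0 D η0 b0 γ m i ω).W - limitGain P βs‖ ≤ κ := by
  have hO : {x : Matrix (Fin dg) (Fin dβ) ℝ × Matrix (Fin dg) (Fin dg) ℝ |
      ‖gain x.1 x.2⁻¹ - limitGain P βs‖ ≤ κ} ∈ 𝓝 (Gpop P, varg P βs) := by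
    have hc := ((continuousAt_gain_inv h.posDef_G h.posDef_g).sub
      (continuousAt_const (y := limitGain P βs))).norm
    have h0 : ‖gain (Gpop P) (varg P βs)⁻¹ - limitGain P βs‖ < κ := by
      rw [limitGain, sub_self, norm_zero]
      exact hκ
    exact (hc.eventually_lt_const h0).mono fun x hx => le_of_lt hx
  filter_upwards [h.ae_isErgodicPath, h.ae_run_W γ] with ω hω hW
  obtain ⟨N, hN⟩ := hω.exists_forall_mem_of_le h.one_le γ (init η0 (fun j => D0 j ω) (b0 ω))
    (Q0 η0 fun j => D0 j ω) hO
  refine ⟨N, fun i hi m him hm => ?_⟩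
  rw [run_βbar_eq] at hm
  rw [hW]
  exact hN i hi m him hm

/-- From time `N` on, the preconditioners are regular, for every warm-up length whose estimate is
precise. -/
def regularEvent {Ω : Type*} {n0 : ℕ} (P : Measure (Obs dβ dg)) (D0 : Fin n0 → Ω → Obs dβ dg)
    (D : ℕ → Ω → Obs dβ dg) (βs : EuclideanSpace ℝ (Fin dβ)) (η0 : ℝ)
    (b0 : Ω → EuclideanSpace ℝ (Fin dβ)) (γ : ℕ → ℝ) (M : ℝ) (N : ℕ) : Set Ω :=
  {ω | ∀ i ≥ N, ∀ m : ℕ,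
    (i ≤ m ∨ ‖(run D0 D η0 b0 γ m m ω).βbar - βs‖ ≤ 1 / ((N : ℝ) + 1)) →
    ((run D0 D η0 b0 γ m i ω).Φ, (run D0 D η0 b0 γ m i ω).W) ∈ regularSet M (op (Gpop P))}

/-- From time `N` and a multiple `N` of the warm-up length on, the gains are within `κ` of their
limit, for every warm-up length whose estimate is precise. -/
def closeEvent {Ω : Type*} {n0 : ℕ} (P : Measure (Obs dβ dg)) (D0 : Fin n0 → Ω → Obs dβ dg)
    (D : ℕ → Ω → Obs dβ dg) (βs : EuclideanSpace ℝ (Fin dβ)) (η0 : ℝ)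
    (b0 : Ω → EuclideanSpace ℝ (Fin dβ)) (γ : ℕ → ℝ) (κ : ℝ) (N : ℕ) : Set Ω :=
  {ω | ∀ i ≥ N, ∀ m : ℕ, N * m ≤ i →
    ‖(run D0 D η0 b0 γ m m ω).βbar - βs‖ ≤ 1 / ((N : ℝ) + 1) →
    ‖gain (run D0 D η0 b0 γ m i ω).Φ (run D0 D η0 b0 γ m i ω).W - limitGain P βs‖ ≤ κ}

theorem measurableSet_precise (h : IsModel μ P D0 D βs η0 b0) (γ : ℕ → ℝ) (m : ℕ) (κ : ℝ) :
    MeasurableSet {ω | ‖(run D0 D η0 b0 γ m m ω).βbar - βs‖ ≤ κ} :=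
  measurableSet_le ((h.measurableState' γ m m).βbar.sub_const βs).norm measurable_const

theorem measurableSet_regularEvent (h : IsModel μ P D0 D βs η0 b0) (γ : ℕ → ℝ) (M : ℝ) (N : ℕ) :
    MeasurableSet (regularEvent P D0 D βs η0 b0 γ M N) := by
  have hr (m i : ℕ) : MeasurableSet {ω | ((run D0 D η0 b0 γ m i ω).Φ,
      (run D0 D η0 b0 γ m i ω).W) ∈ regularSet M (op (Gpop P))} :=
    ((h.measurableState' γ m i).Φ.prodMk (h.measurableState' γ m i).W)
      (measurableSet_regularSet M (op (Gpop P)))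
  have e : regularEvent P D0 D βs η0 b0 γ M N = ⋂ i, ⋂ (_ : i ≥ N), ⋂ m,
      (({_ω | i ≤ m} ∪ {ω | ‖(run D0 D η0 b0 γ m m ω).βbar - βs‖ ≤ 1 / ((N : ℝ) + 1)})ᶜ ∪
        {ω | ((run D0 D η0 b0 γ m i ω).Φ,
          (run D0 D η0 b0 γ m i ω).W) ∈ regularSet M (op (Gpop P))}) := by
    ext ω
    simp only [regularEvent, Set.mem_iInter, Set.mem_union, Set.mem_compl_iff, Set.mem_ofPred_eq,
      ← imp_iff_not_or]
  rw [e]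
  exact .iInter fun i => .iInter fun _ => .iInter fun m =>
    ((MeasurableSet.const _).union (h.measurableSet_precise γ m _)).compl.union (hr m i)

theorem measurableSet_closeEvent (h : IsModel μ P D0 D βs η0 b0) (γ : ℕ → ℝ) (κ : ℝ) (N : ℕ) :
    MeasurableSet (closeEvent P D0 D βs η0 b0 γ κ N) := by
  have hr (m i : ℕ) : MeasurableSet {ω | ‖gain (run D0 D η0 b0 γ m i ω).Φ
      (run D0 D η0 b0 γ m i ω).W - limitGain P βs‖ ≤ κ} :=
    measurableSet_le ((measurable_gain (h.measurableState' γ m i).Φ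
      (h.measurableState' γ m i).W).sub_const _).norm measurable_const
  have e : closeEvent P D0 D βs η0 b0 γ κ N = ⋂ i, ⋂ (_ : i ≥ N), ⋂ m, ⋂ (_ : N * m ≤ i),
      ({ω | ‖(run D0 D η0 b0 γ m m ω).βbar - βs‖ ≤ 1 / ((N : ℝ) + 1)}ᶜ ∪
        {ω | ‖gain (run D0 D η0 b0 γ m i ω).Φ
          (run D0 D η0 b0 γ m i ω).W - limitGain P βs‖ ≤ κ}) := by
    ext ω
    simp only [closeEvent, Set.mem_iInter, Set.mem_union, Set.mem_compl_iff, Set.mem_ofPred_eq,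
      ← imp_iff_not_or]
  rw [e]
  exact .iInter fun i => .iInter fun _ => .iInter fun m => .iInter fun _ =>
    (h.measurableSet_precise γ m _).compl.union (hr m i)

/-- With large probability, the preconditioners are regular from a fixed time on, uniformly in the
warm-up length. -/
theorem exists_measure_regularEvent (h : IsModel μ P D0 D βs η0 b0) :
    ∃ M : ℝ, ‖limitGain P βs‖ ≤ M ∧ ∀ (γ : ℕ → ℝ) (δ : ℝ), 0 < δ → ∀ᶠ N : ℕ in atTop,
      μ (regularEvent P D0 D βs η0 b0 γ M N)ᶜ ≤ ENNReal.ofReal δ := by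
  obtain ⟨M, hM, hae⟩ := h.exists_ae_mem_regularSet
  refine ⟨M, hM, fun γ δ hδ => exists_measure_compl_le (h.measurableSet_regularEvent γ M) ?_
    (hae γ) hδ⟩
  -- The events increase with `N`: a larger `N` constrains fewer times and assumes a more precise
  -- warm-up estimate.
  intro N N' hN ω hω i hi m him
  refine hω i (hN.trans hi) m (him.imp_right fun hm => hm.trans ?_)
  have : (N : ℝ) ≤ N' := by exact_mod_cast hN
  gcongr

/-- With large probability, the gains are close to their limit from a fixed multiple of the
warm-up length on. -/
theorem eventually_measure_closeEvent (h : IsModel μ P D0 D βs η0 b0) (γ : ℕ → ℝ) {κ δ : ℝ}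
    (hκ : 0 < κ) (hδ : 0 < δ) : ∀ᶠ N : ℕ in atTop,
      μ (closeEvent P D0 D βs η0 b0 γ κ N)ᶜ ≤ ENNReal.ofReal δ := by
  refine exists_measure_compl_le (h.measurableSet_closeEvent γ κ) ?_
    (h.ae_exists_norm_gain_sub_le γ hκ) hδ
  intro N N' hN ω hω i hi m him hm
  refine hω i (hN.trans hi) m ((Nat.mul_le_mul_right m hN).trans him) (hm.trans ?_)
  have : (N : ℝ) ≤ N' := by exact_mod_cast hN
  gcongr

/-! ### The rate of the Jacobian average -/

/-- The weight `n0` of the initial average is its sample size, so `Φ` is a plain average of `n0 + i`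
independent Jacobians and does not depend on the warm-up length. -/
theorem run_Φ (h : IsModel μ P D0 D βs η0 b0) (γ : ℕ → ℝ) (m i : ℕ) (ω : Ω) :
    (run D0 D η0 b0 γ m i ω).Φ = ((n0 : ℝ) + i)⁻¹ •
      ∑ s ∈ (Finset.univ : Finset (Fin n0)).disjSum (Finset.range i),
        Gmat (Sum.elim D0 D s ω) := by
  have hn : (n0 : ℝ) ≠ 0 := by exact_mod_cast (Nat.one_le_iff_ne_zero.1 h.one_le)
  rw [run, sgmm_Φ h.one_le, init, Finset.sum_disjSum, smul_smul, mul_one_div_cancel hn, one_smul]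
  rfl

theorem law_elim (h : IsModel μ P D0 D βs η0 b0) (s : Fin n0 ⊕ ℕ) :
    μ.map (Sum.elim D0 D s) = P := by
  cases s with
  | inl j => exact h.sample.law0 j
  | inr k => exact h.sample.law k

/-- The left side is the variance of an entry of an average of `n0 + i` independent, identically
distributed matrices. -/
theorem lintegral_entry_Φ_sub_sq (h : IsModel μ P D0 D βs η0 b0) (γ : ℕ → ℝ) (m i : ℕ)
    (k : Fin dg) (l : Fin dβ) :
    ∫⁻ ω, ‖((run D0 D η0 b0 γ m i ω).Φ - Gpop P) k l‖ₑ ^ 2 ∂μ =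
      ENNReal.ofReal (((n0 : ℝ) + i)⁻¹ * Var[fun d => Gmat d k l; P]) := by
  have := h.isProbabilityMeasure
  set T := (Finset.univ : Finset (Fin n0)).disjSum (Finset.range i) with hT
  have hcard : (T.card : ℝ) = n0 + i := by simp [hT]
  have hn : (0 : ℝ) < n0 := by exact_mod_cast h.one_le
  set f : Obs dβ dg → ℝ := fun d => Gmat d k l with hf
  have hfm : Measurable f := measurable_matrix_entry continuous_Gmat.measurable k l
  have hfL : MemLp f 2 P := memLp_Gmat_entry h.sq_G k l
  have hmp (s : Fin n0 ⊕ ℕ) : MeasurePreserving (Sum.elim D0 D s) μ P :=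
    ⟨h.sample.meas_elim s, h.law_elim s⟩
  have hL (s : Fin n0 ⊕ ℕ) : MemLp (fun ω => f (Sum.elim D0 D s ω)) 2 μ :=
    hfL.comp_measurePreserving (hmp s)
  have hvar : Var[∑ s ∈ T, fun ω => f (Sum.elim D0 D s ω); μ] = (n0 + i) * Var[f; P] := by
    rw [IndepFun.variance_sum (fun s _ => hL s)
      (fun s _ t _ hst => (h.sample.indep.indepFun hst).comp hfm hfm)]
    have e (s : Fin n0 ⊕ ℕ) : Var[fun ω => f (Sum.elim D0 D s ω); μ] = Var[f; P] := by
      rw [← h.law_elim s, variance_map hfm.aemeasurable (h.sample.meas_elim s).aemeasurable]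
      rfl
    rw [Finset.sum_congr rfl fun s _ => e s, Finset.sum_const, nsmul_eq_mul, hcard]
  have hmean : ∫ ω, (∑ s ∈ T, fun ω => f (Sum.elim D0 D s ω)) ω ∂μ = (n0 + i) * ∫ d, f d ∂P := by
    simp only [Finset.sum_apply]
    rw [integral_finsetSum _ fun s _ => (hL s).integrable one_le_two]
    have e (s : Fin n0 ⊕ ℕ) : ∫ ω, f (Sum.elim D0 D s ω) ∂μ = ∫ d, f d ∂P := by
      rw [← h.law_elim s, integral_map (h.sample.meas_elim s).aemeasurable
        hfm.aestronglyMeasurable]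
    rw [Finset.sum_congr rfl fun s _ => e s, Finset.sum_const, nsmul_eq_mul, hcard]
  have hSL : MemLp (∑ s ∈ T, fun ω => f (Sum.elim D0 D s ω)) 2 μ :=
    memLp_finsetSum' _ fun s _ => hL s
  have hev := ofReal_variance hSL
  rw [evariance, hvar, hmean] at hev
  have hpt (ω : Ω) : ((run D0 D η0 b0 γ m i ω).Φ - Gpop P) k l = ((n0 : ℝ) + i)⁻¹ *
      ((∑ s ∈ T, fun ω => f (Sum.elim D0 D s ω)) ω - (n0 + i) * ∫ d, f d ∂P) := by
    rw [h.run_Φ, mul_sub, inv_mul_cancel_left₀ (by positivity)]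
    simp [Matrix.sum_apply, Gpop, meanMat, f, T, mul_add]
  simp_rw [hpt, enorm_mul, mul_pow]
  rw [lintegral_const_mul' _ _ (by simp), ← hev, enorm_sq_eq_ofReal,
    ← ENNReal.ofReal_mul (by positivity)]
  congr 1
  rw [Real.norm_eq_abs, sq_abs]
  field_simp

theorem exists_lintegral_op_Φ_sub_sq_le (h : IsModel μ P D0 D βs η0 b0) :
    ∃ C : ℝ, 0 ≤ C ∧ ∀ (γ : ℕ → ℝ) (m i : ℕ), 1 ≤ i →
      ∫⁻ ω, ‖‖op ((run D0 D η0 b0 γ m i ω).Φ - Gpop P)‖‖ₑ ^ 2 ∂μ ≤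
        ENNReal.ofReal (C * (i : ℝ) ^ (-1 : ℝ)) := by
  have := h.isProbabilityMeasure
  set V : ℝ := ∑ k : Fin dg, ∑ l : Fin dβ, Var[fun d => Gmat d k l; P] with hV
  have hV0 : 0 ≤ V := Finset.sum_nonneg fun k _ => Finset.sum_nonneg fun l _ => variance_nonneg _ _
  refine ⟨(dg * dβ : ℝ) * V, by positivity, fun γ m i hi => ?_⟩
  have hi0 : (0 : ℝ) < i := by exact_mod_cast hi
  have hpt (ω : Ω) : ‖‖op ((run D0 D η0 b0 γ m i ω).Φ - Gpop P)‖‖ₑ ^ 2 ≤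
      ENNReal.ofReal (dg * dβ : ℝ) * ∑ k : Fin dg, ∑ l : Fin dβ,
        ‖((run D0 D η0 b0 γ m i ω).Φ - Gpop P) k l‖ₑ ^ 2 := by
    set A := (run D0 D η0 b0 γ m i ω).Φ - Gpop P
    have h1 : ‖op A‖ ^ 2 ≤ (dg * dβ : ℝ) * ∑ k : Fin dg, ∑ l : Fin dβ, |A k l| ^ 2 := by
      calc ‖op A‖ ^ 2 ≤ (∑ x : Fin dg × Fin dβ, |A x.1 x.2|) ^ 2 := by
            rw [Fintype.sum_prod_type]
            gcongr
            exact norm_op_le_sum A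
        _ ≤ (Finset.univ : Finset (Fin dg × Fin dβ)).card * ∑ x : Fin dg × Fin dβ,
            |A x.1 x.2| ^ 2 := sq_sum_le_card_mul_sum_sq
        _ = _ := by
            rw [Fintype.sum_prod_type]
            simp
    rw [enorm_sq_eq_ofReal, norm_norm]
    simp only [enorm_sq_eq_ofReal]
    have e : ∑ k : Fin dg, ∑ l : Fin dβ, ENNReal.ofReal (‖A k l‖ ^ 2) =
        ENNReal.ofReal (∑ k : Fin dg, ∑ l : Fin dβ, |A k l| ^ 2) := by
      rw [ENNReal.ofReal_sum_of_nonneg fun k _ => Finset.sum_nonneg fun l _ => by positivity]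
      refine Finset.sum_congr rfl fun k _ => ?_
      rw [ENNReal.ofReal_sum_of_nonneg fun l _ => by positivity]
      rfl
    rw [e, ← ENNReal.ofReal_mul (by positivity)]
    exact ENNReal.ofReal_le_ofReal h1
  have hmeas (k : Fin dg) (l : Fin dβ) :
      Measurable fun ω => ‖((run D0 D η0 b0 γ m i ω).Φ - Gpop P) k l‖ₑ ^ 2 := by
    have := measurable_matrix_entry (h.measurableState' γ m i).Φ k l
    exact (this.sub_const (Gpop P k l)).enorm.pow_const 2
  refine (lintegral_mono hpt).trans ?_
  rw [lintegral_const_mul' _ _ ENNReal.ofReal_ne_top,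
    lintegral_finsetSum _ fun k _ => Finset.measurable_fun_sum _ fun l _ => hmeas k l]
  simp_rw [fun k => lintegral_finsetSum (μ := μ) Finset.univ fun l _ => hmeas k l,
    h.lintegral_entry_Φ_sub_sq]
  have e : ∑ k : Fin dg, ∑ l : Fin dβ,
      ENNReal.ofReal (((n0 : ℝ) + i)⁻¹ * Var[fun d => Gmat d k l; P]) =
        ENNReal.ofReal (((n0 : ℝ) + i)⁻¹ * V) := by
    have hv (k : Fin dg) (l : Fin dβ) :
        0 ≤ ((n0 : ℝ) + i)⁻¹ * Var[fun d => Gmat d k l; P] :=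
      mul_nonneg (by positivity) (variance_nonneg _ _)
    rw [hV, Finset.mul_sum,
      ENNReal.ofReal_sum_of_nonneg fun k _ => by
        rw [Finset.mul_sum]; exact Finset.sum_nonneg fun l _ => hv k l]
    refine Finset.sum_congr rfl fun k _ => ?_
    rw [Finset.mul_sum, ENNReal.ofReal_sum_of_nonneg fun l _ => hv k l]
  rw [e, ← ENNReal.ofReal_mul (by positivity), Real.rpow_neg_one]
  refine ENNReal.ofReal_le_ofReal ?_
  have e2 : (dg * dβ : ℝ) * V * (i : ℝ)⁻¹ = (dg * dβ : ℝ) * ((i : ℝ)⁻¹ * V) := by ring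
  rw [e2]
  gcongr
  exact le_add_of_nonneg_left (Nat.cast_nonneg _)

end IsModel

end

section

variable {dβ dg : ℕ}

/-! ### Coupling with a stochastic approximation with bounded preconditioners -/

/-- The stochastic approximation path that equals `X` up to time `N` and has preconditioners `A`
from then on. -/
def approxPath {Ω 𝒟 E F : Type*} [NormedAddCommGroup E] [NormedSpace ℝ E] [NormedAddCommGroup F]
    [NormedSpace ℝ F] (D : ℕ → Ω → 𝒟) (H : 𝒟 → E →L[ℝ] F) (ε : 𝒟 → F) (γ : ℕ → ℝ) (N : ℕ)
    (A : ℕ → Ω → F →L[ℝ] E) (X : Ω → E) : ℕ → Ω → E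
  | 0 => X
  | i + 1 => if i < N then X else fun ω => approxPath D H ε γ N A X i ω -
      γ (i + 1) • A i ω (H (D i ω) (approxPath D H ε γ N A X i ω) + ε (D i ω))

section approxPath

variable {Ω 𝒟 E F : Type*} [NormedAddCommGroup E] [NormedSpace ℝ E] [NormedAddCommGroup F]
  [NormedSpace ℝ F] (D : ℕ → Ω → 𝒟) (H : 𝒟 → E →L[ℝ] F) (ε : 𝒟 → F) (γ : ℕ → ℝ) (N : ℕ)
  (A : ℕ → Ω → F →L[ℝ] E) (X : Ω → E)

theorem approxPath_start : approxPath D H ε γ N A X N = X := by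
  cases N with
  | zero => rfl
  | succ i => rw [approxPath, if_pos (Nat.lt_succ_self i)]

theorem approxPath_succ {i : ℕ} (hi : N ≤ i) (ω : Ω) : approxPath D H ε γ N A X (i + 1) ω =
    approxPath D H ε γ N A X i ω -
      γ (i + 1) • A i ω (H (D i ω) (approxPath D H ε γ N A X i ω) + ε (D i ω)) := by
  rw [approxPath, if_neg (not_lt.2 hi)]

end approxPath

namespace IsModel

variable {Ω : Type*} [mΩ : MeasurableSpace Ω] {μ : Measure Ω} [IsProbabilityMeasure μ] {n0 : ℕ}
  {P : Measure (Obs dβ dg)} {D0 : Fin n0 → Ω → Obs dβ dg} {D : ℕ → Ω → Obs dβ dg}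
  {βs : EuclideanSpace ℝ (Fin dβ)} {η0 : ℝ} {b0 : Ω → EuclideanSpace ℝ (Fin dβ)}

theorem limitGain_comp (h : IsModel μ P D0 D βs η0 b0) :
    (limitGain P βs).comp (op (Gpop P)) = 1 :=
  gain_comp_op (det_ne_zero_of_posDef h.posDef_G h.posDef_g)

theorem run_eq_of_le {γ : ℕ → ℝ} {m m' i : ℕ} (hm : i ≤ m) (hm' : i ≤ m') (ω : Ω) :
    run D0 D η0 b0 γ m i ω = run D0 D η0 b0 γ m' i ω := by
  rw [run, run, sgmm_eq_s2sls _ _ _ _ _ _ hm, sgmm_eq_s2sls _ _ _ _ _ _ hm']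

theorem run_β_succ (βs : EuclideanSpace ℝ (Fin dβ)) (γ : ℕ → ℝ) (m i : ℕ) (ω : Ω) :
    (run D0 D η0 b0 γ m (i + 1) ω).β - βs = (run D0 D η0 b0 γ m i ω).β - βs -
      γ (i + 1) • gain (run D0 D η0 b0 γ m i ω).Φ (run D0 D η0 b0 γ m i ω).W
        (op (Gmat (D i ω)) ((run D0 D η0 b0 γ m i ω).β - βs) + g βs (D i ω)) := by
  rw [← g_eq]
  simp only [run, sgmm_succ, step_β]
  abel

/-- The truncated gain used at time `i` with warm-up length `m`. -/
def runGain (P : Measure (Obs dβ dg)) (D0 : Fin n0 → Ω → Obs dβ dg) (D : ℕ → Ω → Obs dβ dg)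
    (βs : EuclideanSpace ℝ (Fin dβ)) (η0 : ℝ) (b0 : Ω → EuclideanSpace ℝ (Fin dβ)) (γ : ℕ → ℝ)
    (M : ℝ) (m i : ℕ) (ω : Ω) : EuclideanSpace ℝ (Fin dg) →L[ℝ] EuclideanSpace ℝ (Fin dβ) :=
  truncGain M (op (Gpop P)) (limitGain P βs)
    ((run D0 D η0 b0 γ m i ω).Φ, (run D0 D η0 b0 γ m i ω).W)

theorem measurable_runGain (h : IsModel μ P D0 D βs η0 b0) (γ : ℕ → ℝ) (M : ℝ) (m i : ℕ) :
    Measurable[obsFiltration D0 D i] (runGain P D0 D βs η0 b0 γ M m i) :=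
  (measurable_truncGain _ _ _).comp
    ((h.measurableState γ m i).Φ.prodMk (h.measurableState γ m i).W)

theorem isStochApprox (h : IsModel μ P D0 D βs η0 b0) (γ : ℕ → ℝ) {M : ℝ}
    (hM : ‖limitGain P βs‖ ≤ M) (m N : ℕ) {X : Ω → EuclideanSpace ℝ (Fin dβ)}
    (hX : Measurable[obsFiltration D0 D N] X) :
    IsStochApprox (obsFiltration D0 D) D (fun d => op (Gmat d)) (g βs) (op (Gpop P)) γ M N
      (runGain P D0 D βs η0 b0 γ M m) (approxPath D (fun d => op (Gmat d)) (g βs) γ N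
        (runGain P D0 D βs η0 b0 γ M m) X) where
  measA := h.measurable_runGain γ M m
  normA_le i ω := norm_truncGain_le hM _
  leftInv i ω := norm_truncGain_comp_sub_one_le h.limitGain_comp _
  meas_start := by rwa [approxPath_start]
  recursion i hi ω := approxPath_succ _ _ _ _ _ _ _ hi ω

/-- On the regular event the truncation is never active from time `N` on, so both paths follow the
same recursion from the same start. -/
theorem run_sub_eq_approxPath {γ : ℕ → ℝ} {M : ℝ} {m N n : ℕ} {X : Ω → EuclideanSpace ℝ (Fin dβ)}
    {ω : Ω} (hX : (run D0 D η0 b0 γ m N ω).β - βs = X ω)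
    (hreg : ω ∈ regularEvent P D0 D βs η0 b0 γ M N)
    (hm : ∀ i ≤ n, i ≤ m ∨ ‖(run D0 D η0 b0 γ m m ω).βbar - βs‖ ≤ 1 / ((N : ℝ) + 1)) {i : ℕ}
    (hi : N ≤ i) (hin : i ≤ n) :
    (run D0 D η0 b0 γ m i ω).β - βs = approxPath D (fun d => op (Gmat d)) (g βs) γ N
        (runGain P D0 D βs η0 b0 γ M m) X i ω := by
  induction i, hi using Nat.le_induction with
  | base => rw [approxPath_start, hX]
  | succ i hi ih =>
    rw [approxPath_succ _ _ _ _ _ _ _ hi, run_β_succ, ih (by omega), runGain, truncGain,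
      if_pos (hreg i hi m (hm i (by omega)))]

/-- The warm-up length `ν n` at sample size `n` diverges, and the warm-up estimate is consistent
whenever it is used. -/
structure IsWarmup {n0 : ℕ} (μ : Measure Ω) (D0 : Fin n0 → Ω → Obs dβ dg)
    (D : ℕ → Ω → Obs dβ dg) (βs : EuclideanSpace ℝ (Fin dβ)) (η0 : ℝ)
    (b0 : Ω → EuclideanSpace ℝ (Fin dβ)) (γ : ℕ → ℝ) (ν : ℕ → ℕ) : Prop where
  tendsto_atTop : Tendsto ν atTop atTop
  tendsto_measure : ∀ κ : ℝ, 0 < κ → Tendsto (fun n =>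
    μ {ω | ν n < n ∧ κ < ‖(run D0 D η0 b0 γ (ν n) (ν n) ω).βbar - βs‖}) atTop (𝓝 0)

/-- With the whole sample as warm-up, `ν n < n` never happens and the precision condition is
vacuous. This starts the argument: S2SLS is analyzed before anything is known about its precision.
-/
theorem isWarmup_id (γ : ℕ → ℝ) : IsWarmup μ D0 D βs η0 b0 γ id where
  tendsto_atTop := tendsto_id
  tendsto_measure κ hκ := by simp

/-- Up to small probability and from a fixed time on, the estimation error is a stochastic
approximation path with bounded preconditioners, with second moments of the order of the
learning rate. -/
theorem exists_coupling (h : IsModel μ P D0 D βs η0 b0) {γ0 a : ℝ} (hγ0 : 0 < γ0) (ha0 : 0 < a)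
    (ha1 : a < 1) : ∃ M : ℝ, ‖limitGain P βs‖ ≤ M ∧ ∀ ν : ℕ → ℕ,
      IsWarmup μ D0 D βs η0 b0 (fun i => γ0 * (i : ℝ) ^ (-a)) ν → ∀ δ : ℝ, 0 < δ →
      ∃ N : ℕ, 1 ≤ N ∧ ∃ K : ℝ, 0 ≤ K ∧ ∃ Δ : ℕ → ℕ → Ω → EuclideanSpace ℝ (Fin dβ),
        (∀ n, IsStochApprox (obsFiltration D0 D) D (fun d => op (Gmat d)) (g βs) (op (Gpop P))
          (fun i => γ0 * (i : ℝ) ^ (-a)) M N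
          (runGain P D0 D βs η0 b0 (fun i => γ0 * (i : ℝ) ^ (-a)) M (ν n)) (Δ n)) ∧
        (∀ n, ∀ i ≥ N, ∫⁻ ω, ‖Δ n i ω‖ₑ ^ 2 ∂μ ≤ ENNReal.ofReal (K * (i : ℝ) ^ (-a))) ∧
        ∀ᶠ n in atTop, μ {ω | ∃ i, N ≤ i ∧ i ≤ n ∧
          (run D0 D η0 b0 (fun i => γ0 * (i : ℝ) ^ (-a)) (ν n) i ω).β - βs ≠ Δ n i ω} ≤
            ENNReal.ofReal δ := by
  have := h.isProbabilityMeasure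
  obtain ⟨M, hM, hreg⟩ := h.exists_measure_regularEvent
  refine ⟨M, hM, fun ν hν δ hδ => ?_⟩
  set γ : ℕ → ℝ := fun i => γ0 * (i : ℝ) ^ (-a) with hγ
  obtain ⟨N0, hN0, hrate⟩ := IsStochApprox.exists_lintegral_le (μ := μ) P
    (fun d : Obs dβ dg => op (Gmat d)) (g βs) (op (Gpop P)) M hγ0 ha0 ha1
  obtain ⟨N, hN, hNreg⟩ := ((eventually_ge_atTop N0).and (hreg γ (δ / 3) (by positivity))).exists
  have hXm : Measurable[obsFiltration D0 D N] fun ω => (run D0 D η0 b0 γ N N ω).β - βs :=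
    (h.measurableState γ N N).β.sub_const βs
  have hXm' : Measurable fun ω => (run D0 D η0 b0 γ N N ω).β - βs :=
    (h.measurableState' γ N N).β.sub_const βs
  -- No moment bound is available for the untruncated recursion up to time `N`. The error at `N` is
  -- finite, so cutting it off at a high level changes it with small probability only and makes it
  -- bounded.
  obtain ⟨L, hL⟩ : ∃ L : ℕ, μ {ω | ‖(run D0 D η0 b0 γ N N ω).β - βs‖ ≤ L}ᶜ ≤
      ENNReal.ofReal (δ / 3) := by
    refine (exists_measure_compl_le (μ := μ)
      (s := fun L : ℕ => {ω | ‖(run D0 D η0 b0 γ N N ω).β - βs‖ ≤ L})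
      (fun L => measurableSet_le hXm'.norm measurable_const) (fun L L' hLL ω hω => ?_)
      (ae_of_all _ fun ω => exists_nat_ge ‖(run D0 D η0 b0 γ N N ω).β - βs‖) (by positivity)).exists
    exact (show ‖(run D0 D η0 b0 γ N N ω).β - βs‖ ≤ L from hω).trans (by exact_mod_cast hLL)
  -- The start is read off the run with warm-up length `N`, hence is the same for all `n`; it agrees
  -- with the run of warm-up length `ν n` as soon as `N ≤ ν n`.
  set X : Ω → EuclideanSpace ℝ (Fin dβ) :=
    Set.indicator {ω | ‖(run D0 D η0 b0 γ N N ω).β - βs‖ ≤ L}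
      fun ω => (run D0 D η0 b0 γ N N ω).β - βs with hX
  have hset : MeasurableSet[obsFiltration D0 D N] {ω | ‖(run D0 D η0 b0 γ N N ω).β - βs‖ ≤ L} :=
    hXm (t := {x | ‖x‖ ≤ L}) (measurableSet_le measurable_norm measurable_const)
  have hXmeas : Measurable[obsFiltration D0 D N] X := hXm.indicator hset
  have hXL (ω : Ω) : ‖X ω‖ ≤ L := by
    rw [hX, Set.indicator_apply]
    split_ifs with hω
    · exact hω
    · simp
  obtain ⟨K, hK0, hK⟩ := hrate N hN ((L : ℝ) ^ 2)
  have hSA (n : ℕ) := h.isStochApprox γ hM (ν n) N hXmeas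
  refine ⟨N, hN0.trans hN, K, hK0, _, hSA, fun n => ?_, ?_⟩
  · refine hK _ _ h.isDriven _ _ (hSA n) ?_
    rw [approxPath_start]
    calc ∫⁻ ω, ‖X ω‖ₑ ^ 2 ∂μ ≤ ∫⁻ _, ENNReal.ofReal ((L : ℝ) ^ 2) ∂μ := by
          refine lintegral_mono fun ω => ?_
          rw [enorm_sq_eq_ofReal]
          have := hXL ω
          exact ENNReal.ofReal_le_ofReal (by gcongr)
      _ = ENNReal.ofReal ((L : ℝ) ^ 2) := by simp
  · have hκ : (0 : ℝ) < 1 / ((N : ℝ) + 1) := by positivity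
    filter_upwards [hν.tendsto_atTop.eventually_ge_atTop N,
      (hν.tendsto_measure _ hκ).eventually_lt_const
        (ENNReal.ofReal_pos.2 (show 0 < δ / 3 by positivity))] with n hNn hsmall
    -- The paths can differ only if the gains are irregular, the error at `N` was cut off, or a
    -- warm-up estimate in use is imprecise; each has probability at most `δ/3`.
    have hsub : {ω | ∃ i, N ≤ i ∧ i ≤ n ∧ (run D0 D η0 b0 γ (ν n) i ω).β - βs ≠
        approxPath D (fun d => op (Gmat d)) (g βs) γ N
          (runGain P D0 D βs η0 b0 γ M (ν n)) X i ω} ⊆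
        ((regularEvent P D0 D βs η0 b0 γ M N)ᶜ ∪
          {ω | ‖(run D0 D η0 b0 γ N N ω).β - βs‖ ≤ L}ᶜ) ∪
        {ω | ν n < n ∧ 1 / ((N : ℝ) + 1) <
          ‖(run D0 D η0 b0 γ (ν n) (ν n) ω).βbar - βs‖} := by
      rintro ω ⟨i, hi, hin, hne⟩
      by_contra hω
      simp only [Set.mem_union, Set.mem_compl_iff, Set.mem_ofPred_eq, not_or, not_not, not_and,
        not_lt] at hω
      refine hne (run_sub_eq_approxPath ?_ hω.1.1 (fun j hj => ?_) hi hin)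
      · rw [hX, Set.indicator_of_mem (show ω ∈ {ω | ‖(run D0 D η0 b0 γ N N ω).β - βs‖ ≤ L} from
          hω.1.2), run_eq_of_le hNn le_rfl]
      · by_cases hνn : ν n < n
        · exact Or.inr (hω.2 hνn)
        · exact Or.inl (hj.trans (not_lt.1 hνn))
    refine (measure_mono hsub).trans ((measure_union_le _ _).trans ?_)
    refine (add_le_add ((measure_union_le _ _).trans (add_le_add hNreg hL)) hsmall.le).trans ?_
    rw [← ENNReal.ofReal_add (by positivity) (by positivity),
      ← ENNReal.ofReal_add (by positivity) (by positivity)]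
    exact ENNReal.ofReal_le_ofReal (by linarith)

end IsModel

end

/-! ### Consistency, and convergence of the gains on average -/

section

variable {dβ dg : ℕ}

theorem tendstoInMeasure_smul_const {Ω V : Type*} {mΩ : MeasurableSpace Ω} {μ : Measure Ω}
    [IsFiniteMeasure μ] [NormedAddCommGroup V] [NormedSpace ℝ V] {c : ℕ → ℝ}
    (hc : Tendsto c atTop (𝓝 0)) {Z : Ω → V} (hZ : AEStronglyMeasurable Z μ) :
    TendstoInMeasure μ (fun n ω => c n • Z ω) atTop 0 := by
  refine tendstoInMeasure_of_tendsto_ae (fun n => hZ.const_smul (c n)) (ae_of_all _ fun ω => ?_)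
  simpa using hc.smul_const (Z ω)

theorem tendstoInMeasure_smul_zero {Ω V : Type*} {mΩ : MeasurableSpace Ω} {μ : Measure Ω}
    [NormedAddCommGroup V] [NormedSpace ℝ V] {c : ℕ → ℝ} (hc : Tendsto c atTop (𝓝 0))
    {f : ℕ → Ω → V} (hf : TendstoInMeasure μ f atTop 0) :
    TendstoInMeasure μ (fun n ω => c n • f n ω) atTop 0 := by
  refine tendstoInMeasure_zero_of_norm_le hf ?_
  have h1 := hc.norm
  rw [norm_zero] at h1
  filter_upwards [h1.eventually_lt_const one_pos] with n hn ω
  rw [norm_smul]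
  exact mul_le_of_le_one_left (norm_nonneg _) hn.le

theorem tendsto_natCast_inv : Tendsto (fun n : ℕ => (n : ℝ)⁻¹) atTop (𝓝 0) :=
  tendsto_inv_atTop_zero.comp tendsto_natCast_atTop_atTop

theorem tendsto_sqrt_natCast_inv : Tendsto (fun n : ℕ => (√(n : ℝ))⁻¹) atTop (𝓝 0) :=
  tendsto_inv_atTop_zero.comp (Real.tendsto_sqrt_atTop.comp tendsto_natCast_atTop_atTop)

namespace IsModel

variable {Ω : Type*} [mΩ : MeasurableSpace Ω] {μ : Measure Ω} [IsProbabilityMeasure μ] {n0 : ℕ}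
  {P : Measure (Obs dβ dg)} {D0 : Fin n0 → Ω → Obs dβ dg} {D : ℕ → Ω → Obs dβ dg}
  {βs : EuclideanSpace ℝ (Fin dβ)} {η0 : ℝ} {b0 : Ω → EuclideanSpace ℝ (Fin dβ)}

/-- The average runs over `β_1, …, β_n`, whereas the coupled path is summed over `N ≤ i < n`; the
last iterate and a fixed initial block are split off. -/
theorem smul_run_βbar_sub (βs : EuclideanSpace ℝ (Fin dβ)) (γ : ℕ → ℝ) (m : ℕ) {N n : ℕ}
    (hN : 1 ≤ N) (hn : N ≤ n) (ω : Ω) :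
    (n : ℝ) • ((run D0 D η0 b0 γ m n ω).βbar - βs) =
      ∑ i ∈ Finset.Ico N n, ((run D0 D η0 b0 γ m i ω).β - βs) +
        (((run D0 D η0 b0 γ m n ω).β - βs) +
          ∑ i ∈ Finset.Ico 1 N, ((run D0 D η0 b0 γ m i ω).β - βs)) := by
  have e : (n : ℝ) • ((run D0 D η0 b0 γ m n ω).βbar - βs) =
      ∑ j ∈ Finset.range n, ((run D0 D η0 b0 γ m (j + 1) ω).β - βs) := by
    rw [smul_sub, run, sgmm_βbar, Finset.sum_sub_distrib, Finset.sum_const, Finset.card_range,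
      Nat.cast_smul_eq_nsmul]
    rfl
  rw [e, Finset.range_eq_Ico,
    Finset.sum_Ico_add' (fun j => (run D0 D η0 b0 γ m j ω).β - βs) 0 n 1, zero_add,
    Finset.sum_Ico_succ_top (hN.trans hn), ← Finset.sum_Ico_consecutive _ hN hn]
  abel

/-- Outside the exceptional event of a coupling, the averaged error is an average along the
coupled path, up to finitely many terms. -/
theorem setOf_smul_run_βbar_sub_subset {γ : ℕ → ℝ} {m N n : ℕ} (hN : 1 ≤ N) (hn : N ≤ n)
    (hm : N ≤ m) (Δ : ℕ → Ω → EuclideanSpace ℝ (Fin dβ)) :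
    {ω | (n : ℝ) • ((run D0 D η0 b0 γ m n ω).βbar - βs) ≠ ∑ i ∈ Finset.Ico N n, Δ i ω +
      (Δ (max N n) ω + ∑ i ∈ Finset.Ico 1 N, ((run D0 D η0 b0 γ N i ω).β - βs))} ⊆
    {ω | ∃ i, N ≤ i ∧ i ≤ n ∧ (run D0 D η0 b0 γ m i ω).β - βs ≠ Δ i ω} := by
  intro ω hω
  by_contra hcon
  simp only [Set.mem_ofPred_eq, not_exists, not_and, not_not] at hcon
  refine hω ?_
  rw [smul_run_βbar_sub βs γ m hN hn, max_eq_right hn, hcon n hn le_rfl]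
  congr 1
  · refine Finset.sum_congr rfl fun i hi => ?_
    rw [Finset.mem_Ico] at hi
    exact hcon i hi.1 hi.2.le
  · congr 1
    refine Finset.sum_congr rfl fun i hi => ?_
    rw [Finset.mem_Ico] at hi
    rw [run_eq_of_le (hi.2.le.trans hm) hi.2.le]

/-- For every `δ` the error agrees with a coupled path off an event of probability `δ`, and the
coupled path tends to zero in mean square. -/
theorem tendstoInMeasure_β (h : IsModel μ P D0 D βs η0 b0) {γ0 a : ℝ} (hγ0 : 0 < γ0)
    (ha0 : 0 < a) (ha1 : a < 1) {ν : ℕ → ℕ}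
    (hν : IsWarmup μ D0 D βs η0 b0 (fun i => γ0 * (i : ℝ) ^ (-a)) ν) :
    TendstoInMeasure μ (fun n ω =>
      (run D0 D η0 b0 (fun i => γ0 * (i : ℝ) ^ (-a)) (ν n) n ω).β - βs) atTop 0 := by
  have := h.isProbabilityMeasure
  obtain ⟨M, hM, hc⟩ := h.exists_coupling hγ0 ha0 ha1
  refine tendstoInMeasure_zero_of_approx fun δ hδ => ?_
  obtain ⟨N, hN, K, hK0, Δ, hSA, hK, hbad⟩ := hc ν hν δ hδ
  have hm (n i : ℕ) (hi : N ≤ i) : Measurable (Δ n i) :=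
    ((hSA n).measurable h.isDriven i hi).mono (h.sample.obsFiltration_le i) le_rfl
  refine ⟨_, tendstoInMeasure_last ha0 hm hK, ?_⟩
  filter_upwards [hbad, eventually_ge_atTop N] with n hn hNn
  refine (measure_mono fun ω hω => ?_).trans hn
  rw [max_eq_right hNn] at hω
  exact ⟨n, hNn, le_rfl, hω⟩

theorem tendstoInMeasure_βbar (h : IsModel μ P D0 D βs η0 b0) {γ0 a : ℝ} (hγ0 : 0 < γ0)
    (ha0 : 0 < a) (ha1 : a < 1) {ν : ℕ → ℕ}
    (hν : IsWarmup μ D0 D βs η0 b0 (fun i => γ0 * (i : ℝ) ^ (-a)) ν) :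
    TendstoInMeasure μ (fun n ω =>
      (run D0 D η0 b0 (fun i => γ0 * (i : ℝ) ^ (-a)) (ν n) n ω).βbar - βs) atTop 0 := by
  have := h.isProbabilityMeasure
  obtain ⟨M, hM, hc⟩ := h.exists_coupling hγ0 ha0 ha1
  refine tendstoInMeasure_zero_of_approx fun δ hδ => ?_
  obtain ⟨N, hN, K, hK0, Δ, hSA, hK, hbad⟩ := hc ν hν δ hδ
  have hm (n i : ℕ) (hi : N ≤ i) : Measurable (Δ n i) :=
    ((hSA n).measurable h.isDriven i hi).mono (h.sample.obsFiltration_le i) le_rfl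
  set γ : ℕ → ℝ := fun i => γ0 * (i : ℝ) ^ (-a) with hγ
  have hZ : Measurable fun ω => ∑ i ∈ Finset.Ico 1 N, ((run D0 D η0 b0 γ N i ω).β - βs) :=
    Finset.measurable_fun_sum _ fun i _ => (h.measurableState' γ N i).β.sub_const βs
  refine ⟨_, tendstoInMeasure_zero_add (tendstoInMeasure_average ha0 ha1 hN hK0 hm hK)
    (tendstoInMeasure_zero_add (tendstoInMeasure_smul_zero tendsto_natCast_inv
      (tendstoInMeasure_last ha0 hm hK))
      (tendstoInMeasure_smul_const tendsto_natCast_inv hZ.aestronglyMeasurable)), ?_⟩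
  filter_upwards [hbad, eventually_ge_atTop N, hν.tendsto_atTop.eventually_ge_atTop N]
    with n hn hNn hNν
  refine (measure_mono ?_).trans hn
  intro ω hω
  refine setOf_smul_run_βbar_sub_subset hN hNn hNν (Δ n) fun heq => hω ?_
  have hn0 : (n : ℝ) ≠ 0 := by
    have : 1 ≤ n := hN.trans hNn
    positivity
  rw [← smul_add, ← smul_add, ← heq, inv_smul_smul₀ hn0]

theorem tendstoInMeasure_warmup (h : IsModel μ P D0 D βs η0 b0) {γ0 a : ℝ} (hγ0 : 0 < γ0)
    (ha0 : 0 < a) (ha1 : a < 1) :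
    TendstoInMeasure μ (fun m ω =>
      (run D0 D η0 b0 (fun i => γ0 * (i : ℝ) ^ (-a)) m m ω).βbar - βs) atTop 0 :=
  h.tendstoInMeasure_βbar hγ0 ha0 ha1 (isWarmup_id _)

/-- Consistency of S2SLS along all sample sizes, evaluated along the diverging sequence `ν`. -/
theorem isWarmup (h : IsModel μ P D0 D βs η0 b0) {γ0 a : ℝ} (hγ0 : 0 < γ0)
    (ha0 : 0 < a) (ha1 : a < 1) {ν : ℕ → ℕ} (hν : Tendsto ν atTop atTop) :
    IsWarmup μ D0 D βs η0 b0 (fun i => γ0 * (i : ℝ) ^ (-a)) ν where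
  tendsto_atTop := hν
  tendsto_measure κ hκ := by
    have h1 := (tendstoInMeasure_iff_norm.1 (h.tendstoInMeasure_warmup hγ0 ha0 ha1) κ hκ).comp hν
    refine tendsto_of_tendsto_of_tendsto_of_le_of_le tendsto_const_nhds h1 (fun _ => zero_le)
      fun n => measure_mono fun ω hω => ?_
    simpa using hω.2.le

end IsModel

/-! ### Averages of bounded arrays -/

/-- The first `k n` terms contribute at most `B k n / n`, which vanishes; the remaining ones are
uniformly small. -/
theorem tendsto_average_of_eventually_small {t : ℕ → ℕ → ENNReal} {B : ℝ} (hB0 : 0 ≤ B) (N : ℕ)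
    (hB : ∀ n i, t n i ≤ ENNReal.ofReal B)
    (h : ∀ η : ℝ, 0 < η → ∃ k : ℕ → ℕ, Tendsto (fun n => (k n : ℝ) / n) atTop (𝓝 0) ∧
      ∀ᶠ n in atTop, ∀ i, k n ≤ i → i < n → t n i ≤ ENNReal.ofReal η) :
    Tendsto (fun n : ℕ => ENNReal.ofReal (n : ℝ)⁻¹ * ∑ i ∈ Finset.Ico N n, t n i) atTop (𝓝 0) := by
  rw [ENNReal.tendsto_nhds_zero]
  intro δ hδ
  obtain ⟨η, hη0, hη⟩ : ∃ η : ℝ, 0 < η ∧ ENNReal.ofReal η ≤ δ := by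
    rcases eq_or_ne δ ⊤ with rfl | ht
    · exact ⟨1, one_pos, le_top⟩
    · exact ⟨δ.toReal, ENNReal.toReal_pos hδ.ne' ht, (ENNReal.ofReal_toReal ht).le⟩
  obtain ⟨k, hk, hsmall⟩ := h (η / 2) (by positivity)
  have hk' := hk.mul_const B
  rw [zero_mul] at hk'
  filter_upwards [hsmall, hk'.eventually_lt_const (show 0 < η / 2 by positivity),
    eventually_ge_atTop 1] with n hn hkn hn1
  refine le_trans ?_ hη
  have hn0 : (0 : ℝ) < n := by exact_mod_cast hn1
  have hterm : ∀ i ∈ Finset.Ico N n, t n i ≤ ENNReal.ofReal ((if i < k n then B else 0) + η / 2) := by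
    intro i hi
    split_ifs with hik
    · exact (hB n i).trans (ENNReal.ofReal_le_ofReal (by linarith))
    · rw [zero_add]
      exact hn i (not_lt.1 hik) (Finset.mem_Ico.1 hi).2
  have hsum : ∑ i ∈ Finset.Ico N n, ((if i < k n then B else 0) + η / 2) ≤
      k n * B + n * (η / 2) := by
    have hnn (i : ℕ) : 0 ≤ (if i < k n then B else 0) + η / 2 := by split_ifs <;> positivity
    calc ∑ i ∈ Finset.Ico N n, ((if i < k n then B else 0) + η / 2)
        ≤ ∑ i ∈ Finset.range n, ((if i < k n then B else 0) + η / 2) :=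
          Finset.sum_le_sum_of_subset_of_nonneg
            (fun i hi => Finset.mem_range.2 (Finset.mem_Ico.1 hi).2) fun i _ _ => hnn i
      _ = (((Finset.range n).filter fun i => i < k n).card : ℝ) * B + n * (η / 2) := by
          rw [Finset.sum_add_distrib, ← Finset.sum_filter]
          simp
      _ ≤ k n * B + n * (η / 2) := by
          have hsub : (Finset.range n).filter (fun i => i < k n) ⊆ Finset.range (k n) :=
            fun i hi => Finset.mem_range.2 (Finset.mem_filter.1 hi).2
          have hcard := Finset.card_le_card hsub
          rw [Finset.card_range] at hcard
          have : (((Finset.range n).filter fun i => i < k n).card : ℝ) ≤ k n := by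
            exact_mod_cast hcard
          gcongr
  calc ENNReal.ofReal (n : ℝ)⁻¹ * ∑ i ∈ Finset.Ico N n, t n i
      ≤ ENNReal.ofReal (n : ℝ)⁻¹ * ENNReal.ofReal (k n * B + n * (η / 2)) := by
        gcongr
        refine (Finset.sum_le_sum hterm).trans ?_
        rw [← ENNReal.ofReal_sum_of_nonneg fun i _ => by split_ifs <;> positivity]
        exact ENNReal.ofReal_le_ofReal hsum
    _ = ENNReal.ofReal ((k n : ℝ) / n * B + η / 2) := by
        rw [← ENNReal.ofReal_mul (by positivity)]
        congr 1
        field_simp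
    _ ≤ ENNReal.ofReal η := ENNReal.ofReal_le_ofReal (by linarith)

namespace IsModel

variable {Ω : Type*} [mΩ : MeasurableSpace Ω] {μ : Measure Ω} [IsProbabilityMeasure μ] {n0 : ℕ}
  {P : Measure (Obs dβ dg)} {D0 : Fin n0 → Ω → Obs dβ dg} {D : ℕ → Ω → Obs dβ dg}
  {βs : EuclideanSpace ℝ (Fin dβ)} {η0 : ℝ} {b0 : Ω → EuclideanSpace ℝ (Fin dβ)}

/-- Along warm-up lengths of smaller order than the sample size, the truncated gains converge on
average to the limit gain. -/
theorem tendsto_average_runGain (h : IsModel μ P D0 D βs η0 b0) {γ : ℕ → ℝ} {M : ℝ}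
    (hM : ‖limitGain P βs‖ ≤ M) {ν : ℕ → ℕ} (hν : IsWarmup μ D0 D βs η0 b0 γ ν)
    (hνn : Tendsto (fun n => (ν n : ℝ) / n) atTop (𝓝 0)) (N : ℕ) :
    Tendsto (fun n : ℕ => ENNReal.ofReal (n : ℝ)⁻¹ * ∑ i ∈ Finset.Ico N n,
      ∫⁻ ω, ‖runGain P D0 D βs η0 b0 γ M (ν n) i ω - limitGain P βs‖ₑ ^ 2 ∂μ) atTop (𝓝 0) := by
  have hM0 : 0 ≤ M := (norm_nonneg _).trans hM
  have hbd (m i : ℕ) (ω : Ω) :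
      ‖runGain P D0 D βs η0 b0 γ M m i ω - limitGain P βs‖ₑ ^ 2 ≤ ENNReal.ofReal ((2 * M) ^ 2) := by
    rw [enorm_sq_eq_ofReal]
    refine ENNReal.ofReal_le_ofReal ?_
    have h1 := norm_sub_le (runGain P D0 D βs η0 b0 γ M m i ω) (limitGain P βs)
    have h2 : ‖runGain P D0 D βs η0 b0 γ M m i ω‖ ≤ M := norm_truncGain_le hM _
    have h3 : ‖runGain P D0 D βs η0 b0 γ M m i ω - limitGain P βs‖ ≤ 2 * M := by linarith
    gcongr
  refine tendsto_average_of_eventually_small (B := (2 * M) ^ 2) (by positivity) N (fun n i => ?_)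
    fun η hη => ?_
  · exact (lintegral_mono fun ω => hbd (ν n) i ω).trans (by simp)
  -- Two exceptional events of probability `δ`, on which the squared distance is at most `(2M)²`,
  -- together cost at most `η/2`.
  · set δ : ℝ := η / 4 / ((2 * M) ^ 2 + 1) with hδdef
    have hδ : 0 < δ := by positivity
    have hκ : 0 < √(η / 2) := by positivity
    obtain ⟨N', hN', hN'1⟩ := ((h.eventually_measure_closeEvent γ hκ hδ).and
      (eventually_ge_atTop 1)).exists
    have hκ' : (0 : ℝ) < 1 / ((N' : ℝ) + 1) := by positivity
    -- This index ensures both `i ≥ N'` and `N' ν n ≤ i`, as `closeEvent` demands, and is still of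
    -- smaller order than `n`.
    refine ⟨fun n => N' + N' * ν n, ?_, ?_⟩
    · have h1 : Tendsto (fun n : ℕ => (N' : ℝ) * (n : ℝ)⁻¹ + N' * ((ν n : ℝ) / n)) atTop (𝓝 0) := by
        simpa using (tendsto_natCast_inv.const_mul (N' : ℝ)).add (hνn.const_mul (N' : ℝ))
      refine h1.congr fun n => ?_
      push_cast
      ring
    · filter_upwards [(hν.tendsto_measure _ hκ').eventually_lt_const (ENNReal.ofReal_pos.2 hδ)]
        with n hn i hi hin
      -- Together with `i < n` this gives `ν n < n`, the only case in which precision of the warm-up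
      -- estimate is guaranteed.
      have hle : ν n ≤ N' * ν n := Nat.le_mul_of_pos_left _ hN'1
      set B := (closeEvent P D0 D βs η0 b0 γ (√(η / 2)) N')ᶜ ∪
        {ω | ν n < n ∧ 1 / ((N' : ℝ) + 1) <
          ‖(run D0 D η0 b0 γ (ν n) (ν n) ω).βbar - βs‖} with hB
      have hpt (ω : Ω) : ‖runGain P D0 D βs η0 b0 γ M (ν n) i ω - limitGain P βs‖ₑ ^ 2 ≤
          ENNReal.ofReal (η / 2) + B.indicator (fun _ => ENNReal.ofReal ((2 * M) ^ 2)) ω := by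
        by_cases hω : ω ∈ B
        · rw [Set.indicator_of_mem hω]
          exact (hbd _ _ ω).trans le_add_self
        · rw [Set.indicator_of_notMem hω, add_zero, enorm_sq_eq_ofReal]
          simp only [hB, Set.mem_union, Set.mem_compl_iff, Set.mem_ofPred_eq, not_or, not_not,
            not_and, not_lt] at hω
          have h1 := hω.1 i (by omega) (ν n) (by omega) (hω.2 (by omega))
          have h2 : ‖runGain P D0 D βs η0 b0 γ M (ν n) i ω - limitGain P βs‖ ≤ √(η / 2) := by
            -- Truncation cannot hurt here, since the replacement value is the limit gain itself.
            rw [runGain, truncGain]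
            split_ifs
            · exact h1
            · rw [sub_self, norm_zero]
              positivity
          refine ENNReal.ofReal_le_ofReal ?_
          rw [← Real.sq_sqrt (show 0 ≤ η / 2 by positivity)]
          gcongr
      calc ∫⁻ ω, ‖runGain P D0 D βs η0 b0 γ M (ν n) i ω - limitGain P βs‖ₑ ^ 2 ∂μ
          ≤ ENNReal.ofReal (η / 2) + ENNReal.ofReal ((2 * M) ^ 2) * μ B := by
            refine (lintegral_mono hpt).trans ?_
            rw [lintegral_add_left measurable_const, lintegral_const, measure_univ, mul_one]
            gcongr
            exact lintegral_indicator_const_le _ _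
        _ ≤ ENNReal.ofReal (η / 2) +
            ENNReal.ofReal ((2 * M) ^ 2) * (ENNReal.ofReal δ + ENNReal.ofReal δ) := by
            gcongr
            exact (measure_union_le _ _).trans (add_le_add hN' hn.le)
        _ = ENNReal.ofReal (η / 2 + (2 * M) ^ 2 * (δ + δ)) := by
            rw [← ENNReal.ofReal_add hδ.le hδ.le, ← ENNReal.ofReal_mul (by positivity),
              ← ENNReal.ofReal_add (by positivity) (by positivity)]
        _ ≤ ENNReal.ofReal η := by
            refine ENNReal.ofReal_le_ofReal ?_
            have h1 : (2 * M) ^ 2 * δ ≤ η / 4 := by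
              rw [hδdef, mul_div_assoc', div_le_iff₀ (by positivity)]
              nlinarith [sq_nonneg (2 * M)]
            linarith

end IsModel

end

section

variable {dβ dg : ℕ}

/-! ### Asymptotic normality -/

/-- Efficiency of the weighting `S⁻¹`: in the sandwich variance one factor `S⁻¹` cancels `S`, and
what remains is `V⁻¹ V V⁻¹` with `V = G'S⁻¹G`. -/
theorem gain_mul_mul_gain_transpose {G : Matrix (Fin dg) (Fin dβ) ℝ}
    (hG : (G.transpose * G).PosDef) {S : Matrix (Fin dg) (Fin dg) ℝ} (hS : S.PosDef) :
    ((G.transpose * S⁻¹ * G)⁻¹ * G.transpose * S⁻¹) * S *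
      ((G.transpose * S⁻¹ * G)⁻¹ * G.transpose * S⁻¹).transpose = (G.transpose * S⁻¹ * G)⁻¹ := by
  have hV := transpose_mul_mul_posDef hS.inv hG
  have hSu : IsUnit S.det := hS.det_pos.ne'.isUnit
  have hVu : IsUnit (G.transpose * S⁻¹ * G).det := hV.det_pos.ne'.isUnit
  have hSt : S⁻¹.transpose = S⁻¹ := by simpa using hS.inv.isHermitian.eq
  have hVt : ((G.transpose * S⁻¹ * G)⁻¹).transpose = (G.transpose * S⁻¹ * G)⁻¹ := by
    simpa using hV.inv.isHermitian.eq
  rw [Matrix.transpose_mul, Matrix.transpose_mul, Matrix.transpose_transpose, hSt, hVt,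
    Matrix.nonsing_inv_mul_cancel_right _ _ hSu]
  set V := G.transpose * S⁻¹ * G with hVdef
  calc V⁻¹ * G.transpose * (S⁻¹ * (G * V⁻¹)) = V⁻¹ * V * V⁻¹ := by
        simp only [hVdef, Matrix.mul_assoc]
    _ = V⁻¹ := by rw [Matrix.nonsing_inv_mul _ hVu, one_mul]

section Covariance

variable {P : Measure (Obs dβ dg)} [IsProbabilityMeasure P] {βs : EuclideanSpace ℝ (Fin dβ)}

theorem integral_dotProduct_g_sq (hg2 : Integrable (fun d => ‖g βs d‖ ^ 2) P)
    (h0 : ∫ d, g βs d ∂P = 0) (u : Fin dg → ℝ) :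
    ∫ d, (u ⬝ᵥ (g βs d).ofLp) ^ 2 ∂P = u ⬝ᵥ (varg P βs).mulVec u := by
  have hint := integrable_outer (memLp_g βs hg2)
  have e (d : Obs dβ dg) : (u ⬝ᵥ (g βs d).ofLp) ^ 2 =
      ∑ k, ∑ l, u k * u l * outer (g βs d) k l := by
    rw [sq, dotProduct, Finset.sum_mul_sum]
    refine Finset.sum_congr rfl fun k _ => Finset.sum_congr rfl fun l _ => ?_
    rw [outer, Matrix.vecMulVec_apply]
    ring
  simp_rw [e]
  rw [integral_finsetSum _ fun k _ => integrable_finsetSum _ fun l _ => (hint k l).const_mul _,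
    ← meanMat_outer_g hg2 h0, dotProduct]
  refine Finset.sum_congr rfl fun k _ => ?_
  rw [integral_finsetSum _ fun l _ => (hint k l).const_mul _, Matrix.mulVec, dotProduct,
    Finset.mul_sum]
  refine Finset.sum_congr rfl fun l _ => ?_
  rw [integral_const_mul, meanMat, Matrix.of_apply]
  ring

end Covariance

namespace IsModel

variable {Ω : Type*} [mΩ : MeasurableSpace Ω] {μ : Measure Ω} [IsProbabilityMeasure μ] {n0 : ℕ}
  {P : Measure (Obs dβ dg)} {D0 : Fin n0 → Ω → Obs dβ dg} {D : ℕ → Ω → Obs dβ dg}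
  {βs : EuclideanSpace ℝ (Fin dβ)} {η0 : ℝ} {b0 : Ω → EuclideanSpace ℝ (Fin dβ)}

theorem integral_inner_limitGain_sq (h : IsModel μ P D0 D βs η0 b0)
    (t : EuclideanSpace ℝ (Fin dβ)) :
    ∫ d, (inner ℝ t (limitGain P βs (g βs d))) ^ 2 ∂P =
      t.ofLp ⬝ᵥ ((Gpop P).transpose * (varg P βs)⁻¹ * Gpop P)⁻¹.mulVec t.ofLp := by
  have := h.isProbabilityMeasure
  rw [← gain_mul_mul_gain_transpose h.posDef_G h.posDef_g]
  have hgain : limitGain P βs = op (((Gpop P).transpose * (varg P βs)⁻¹ * Gpop P)⁻¹ *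
      (Gpop P).transpose * (varg P βs)⁻¹) := by
    rw [limitGain, gain, pinv_eq_inv (det_ne_zero_of_posDef h.posDef_G h.posDef_g).isUnit]
  rw [hgain]
  set B := ((Gpop P).transpose * (varg P βs)⁻¹ * Gpop P)⁻¹ * (Gpop P).transpose * (varg P βs)⁻¹
  have e (d : Obs dβ dg) : inner ℝ t (op B (g βs d)) =
      (Matrix.vecMul t.ofLp B) ⬝ᵥ (g βs d).ofLp := by
    rw [← Matrix.dotProduct_mulVec, op_apply, EuclideanSpace.inner_eq_star_dotProduct]
    simp [dotProduct_comm]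
  simp_rw [e]
  rw [integral_dotProduct_g_sq h.sq_g h.mean, ← Matrix.dotProduct_mulVec, ← Matrix.mulVec_transpose,
    Matrix.mulVec_mulVec, Matrix.mulVec_mulVec, Matrix.mul_assoc]

theorem tendstoInDistribution_linear (h : IsModel μ P D0 D βs η0 b0) :
    TendstoInDistribution (fun (n : ℕ) ω => (√(n : ℝ))⁻¹ • ∑ i ∈ Finset.range n,
        -limitGain P βs (g βs (D i ω))) atTop
      (id : EuclideanSpace ℝ (Fin dβ) → EuclideanSpace ℝ (Fin dβ)) (fun _ => μ)
      (multivariateGaussian 0 ((Gpop P).transpose * (varg P βs)⁻¹ * Gpop P)⁻¹) := by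
  have := h.isProbabilityMeasure
  have hf : Measurable fun d : Obs dβ dg => -limitGain P βs (g βs d) :=
    ((limitGain P βs).continuous.measurable.comp (measurable_g_const βs)).neg
  have hL : MemLp (fun d : Obs dβ dg => limitGain P βs (g βs d)) 2 P :=
    (limitGain P βs).comp_memLp' (memLp_g βs h.sq_g)
  have hmp : MeasurePreserving (D 0) μ P := ⟨h.sample.meas 0, h.sample.law 0⟩
  refine tendstoInDistribution_multivariateGaussian
    (Y := fun i ω => -limitGain P βs (g βs (D i ω))) (hL.neg.comp_measurePreserving hmp) ?_
    (h.sample.iIndepFun_main.comp _ fun _ => hf) (fun i => (h.sample.identDistrib i).comp hf)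
    (transpose_mul_mul_posDef h.posDef_g.inv h.posDef_G).inv.posSemidef fun t => ?_
  · have e := integral_map (μ := μ) (h.sample.meas 0).aemeasurable hf.aestronglyMeasurable
    rw [h.sample.law] at e
    rw [← e, integral_neg, (limitGain P βs).integral_comp_comm
      ((memLp_g βs h.sq_g).integrable one_le_two), h.mean, map_zero, neg_zero]
  · have hsq : Measurable fun d : Obs dβ dg => (inner ℝ t (-limitGain P βs (g βs d))) ^ 2 :=
      (measurable_const.inner hf).pow_const 2
    have e := integral_map (μ := μ) (h.sample.meas 0).aemeasurable hsq.aestronglyMeasurable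
    rw [h.sample.law] at e
    rw [← e, ← h.integral_inner_limitGain_sq t]
    simp only [inner_neg_right, neg_sq]

theorem tendstoInMeasure_sqrt_smul_sub (h : IsModel μ P D0 D βs η0 b0) {γ0 a : ℝ} (hγ0 : 0 < γ0)
    (ha0 : 0 < a) (ha1 : a < 1) {ν : ℕ → ℕ} (hν : Tendsto ν atTop atTop)
    (hνn : Tendsto (fun n => (ν n : ℝ) / n) atTop (𝓝 0)) :
    TendstoInMeasure μ (fun (n : ℕ) ω =>
      √(n : ℝ) • ((run D0 D η0 b0 (fun i => γ0 * (i : ℝ) ^ (-a)) (ν n) n ω).βbar - βs) -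
        (√(n : ℝ))⁻¹ • ∑ i ∈ Finset.range n, -limitGain P βs (g βs (D i ω))) atTop 0 := by
  have := h.isProbabilityMeasure
  have hw := h.isWarmup hγ0 ha0 ha1 hν
  obtain ⟨M, hM, hc⟩ := h.exists_coupling hγ0 ha0 ha1
  have hM0 : 0 ≤ M := (norm_nonneg _).trans hM
  obtain ⟨C, hC0, hC⟩ := h.exists_lintegral_op_Φ_sub_sq_le
  refine tendstoInMeasure_zero_of_approx fun δ hδ => ?_
  obtain ⟨N, hN, K, hK0, Δ, hSA, hK, hbad⟩ := hc ν hw δ hδ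
  have hm (n i : ℕ) (hi : N ≤ i) : Measurable (Δ n i) :=
    ((hSA n).measurable h.isDriven i hi).mono (h.sample.obsFiltration_le i) le_rfl
  set γ : ℕ → ℝ := fun i => γ0 * (i : ℝ) ^ (-a) with hγ
  -- As `Φ` does not depend on the warm-up length, length `0` may be used here; one sequence of
  -- bounds then serves all `n`.
  have hρm (i : ℕ) : Measurable fun ω => M * ‖op ((run D0 D η0 b0 γ 0 i ω).Φ - Gpop P)‖ := by
    have h1 : Continuous fun A : Matrix (Fin dg) (Fin dβ) ℝ => M * ‖op (A - Gpop P)‖ :=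
      continuous_const.mul (continuous_op.comp (continuous_id.sub continuous_const)).norm
    exact h1.measurable.comp (h.measurableState' γ 0 i).Φ
  have hρ : ∀ i ≥ N, ∫⁻ ω, ‖M * ‖op ((run D0 D η0 b0 γ 0 i ω).Φ - Gpop P)‖‖ₑ ^ 2 ∂μ ≤
      ENNReal.ofReal (M ^ 2 * C * (i : ℝ) ^ (-1 : ℝ)) := by
    intro i hi
    simp_rw [enorm_mul, mul_pow]
    rw [lintegral_const_mul' _ _ (by simp), mul_assoc, ENNReal.ofReal_mul (by positivity),
      enorm_sq_eq_ofReal, Real.norm_eq_abs, sq_abs]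
    gcongr
    exact hC γ 0 i (hN.trans hi)
  have hAρ (n i : ℕ) (ω : Ω) :
      ‖(runGain P D0 D βs η0 b0 γ M (ν n) i ω).comp (op (Gpop P)) - 1‖ ≤
        M * ‖op ((run D0 D η0 b0 γ 0 i ω).Φ - Gpop P)‖ := by
    rw [h.run_Φ γ 0, ← h.run_Φ γ (ν n)]
    exact norm_truncGain_comp_sub_one_le_mul hM0 h.limitGain_comp _
  have hlin := tendstoInMeasure_asymptotic_linearity ha0 ha1 hγ0 hN h.isDriven hK0
    (show 0 ≤ M ^ 2 * C by positivity) hSA hK hρm hρ hAρ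
    (h.tendsto_average_runGain hM hw hνn N)
  -- These are the errors and the noise terms before time `N`, which the linearization omits; the
  -- total does not depend on `n`, so `1/√n` annihilates it.
  have hZ : Measurable fun ω => ∑ i ∈ Finset.Ico 1 N, ((run D0 D η0 b0 γ N i ω).β - βs) +
      ∑ i ∈ Finset.range N, limitGain P βs (g βs (D i ω)) :=
    (Finset.measurable_fun_sum _ fun i _ => (h.measurableState' γ N i).β.sub_const βs).add
      (Finset.measurable_fun_sum _ fun i _ => (limitGain P βs).continuous.measurable.comp
        ((measurable_g_const βs).comp (h.sample.meas i)))
  refine ⟨_, tendstoInMeasure_zero_add hlin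
    (tendstoInMeasure_zero_add (tendstoInMeasure_smul_zero tendsto_sqrt_natCast_inv
      (tendstoInMeasure_last ha0 hm hK))
      (tendstoInMeasure_smul_const tendsto_sqrt_natCast_inv hZ.aestronglyMeasurable)), ?_⟩
  filter_upwards [hbad, eventually_ge_atTop N, hν.eventually_ge_atTop N] with n hn hNn hNν
  refine (measure_mono ?_).trans hn
  intro ω hω
  refine setOf_smul_run_βbar_sub_subset hN hNn hNν (Δ n) fun heq => hω ?_
  have hn0 : (0 : ℝ) < n := by exact_mod_cast hN.trans hNn
  have hsqrt : √(n : ℝ) • ((run D0 D η0 b0 γ (ν n) n ω).βbar - βs) =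
      (√(n : ℝ))⁻¹ • (n : ℝ) • ((run D0 D η0 b0 γ (ν n) n ω).βbar - βs) := by
    rw [smul_smul, inv_mul_eq_div, Real.div_sqrt]
  rw [hsqrt, heq, ← smul_sub, ← smul_add, ← smul_add, Finset.sum_neg_distrib, sub_neg_eq_add,
    ← Finset.sum_range_add_sum_Ico _ hNn, Finset.sum_add_distrib]
  congr 1
  abel

theorem tendstoInDistribution_βbar (h : IsModel μ P D0 D βs η0 b0) {γ0 a : ℝ} (hγ0 : 0 < γ0)
    (ha0 : 0 < a) (ha1 : a < 1) {ν : ℕ → ℕ} (hν : Tendsto ν atTop atTop)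
    (hνn : Tendsto (fun n => (ν n : ℝ) / n) atTop (𝓝 0)) :
    TendstoInDistribution (fun (n : ℕ) ω =>
      √(n : ℝ) • ((run D0 D η0 b0 (fun i => γ0 * (i : ℝ) ^ (-a)) (ν n) n ω).βbar - βs)) atTop
      (id : EuclideanSpace ℝ (Fin dβ) → EuclideanSpace ℝ (Fin dβ)) (fun _ => μ)
      (multivariateGaussian 0 ((Gpop P).transpose * (varg P βs)⁻¹ * Gpop P)⁻¹) := by
  refine tendstoInDistribution_of_tendstoInMeasure_sub _ _ h.tendstoInDistribution_linear
    (h.tendstoInMeasure_sqrt_smul_sub hγ0 ha0 ha1 hν hνn) fun n => ?_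
  have hm : Measurable fun ω =>
      (run D0 D η0 b0 (fun i => γ0 * (i : ℝ) ^ (-a)) (ν n) n ω).βbar - βs :=
    (h.measurableState' _ (ν n) n).βbar.sub_const βs
  exact (hm.const_smul √(n : ℝ)).aemeasurable

end IsModel

end

end SGMM

end

/-! ### The main theorem -/

theorem theorem3 {dβ dg : ℕ} (hd : dβ ≤ dg)
    {Ω₀ : Type*} [MeasurableSpace Ω₀] (μ : Measure Ω₀) [IsProbabilityMeasure μ]
    (n0 : ℕ) (hn0 : 1 ≤ n0)
    -- population distribution of an observation, initialization sample, main sample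
    (P : Measure (Obs dβ dg))
    (D0 : Fin n0 → Ω₀ → Obs dβ dg) (D : ℕ → Ω₀ → Obs dβ dg)
    (hD0_meas : ∀ j, Measurable (D0 j)) (hD_meas : ∀ i, Measurable (D i))
    (hD0_law : ∀ j, μ.map (D0 j) = P) (hD_law : ∀ i, μ.map (D i) = P)
    (h_indep : iIndepFun (fun s : Fin n0 ⊕ ℕ => Sum.elim D0 D s) μ)
    -- identification
    (h_zz : Integrable (fun d : Obs dβ dg => ‖Obs.z d‖ ^ 2) P)
    (hG : 0 < lambdaMin ((Gpop P).transpose * Gpop P))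
    (hQ : 0 < lambdaMin (meanMat P fun d => outer (Obs.z d)))
    (βs : EuclideanSpace ℝ (Fin dβ))
    (hβs : ∀ β : EuclideanSpace ℝ (Fin dβ), ∫ d, g β d ∂P = 0 ↔ β = βs)
    -- learning rate
    (γ0 a : ℝ) (hγ0 : 0 < γ0) (ha : a ∈ Set.Ioo (1 / 2 : ℝ) 1)
    -- moments
    (hG2 : Integrable (fun d => opNorm (Gmat d) ^ 2) P)
    (hg2 : Integrable (fun d => ‖g βs d‖ ^ 2) P)
    -- initialization: `η0`, existence of `W_0`, and the initial estimate `β_0 ∈ σ(S_0)`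
    (η0 : ℝ) (hη0 : 0 ≤ η0)
    (hW0 : ∀ᵐ ω ∂μ, IsUnit (Q0 η0 fun j => D0 j ω))
    (b0 : Ω₀ → EuclideanSpace ℝ (Fin dβ))
    (hb0 : Measurable[MeasurableSpace.comap (fun ω j => D0 j ω) inferInstance] b0)
    (hb0_sq : Integrable (fun ω => ‖b0 ω‖ ^ 2) μ)
    -- warm-up length
    (n1 : ℕ → ℕ) (hn1 : Tendsto n1 atTop atTop)
    (hn1n : Tendsto (fun n => (n1 n : ℝ) / n) atTop (𝓝 0))
    -- nondegeneracy near the true parameter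
    (K : Set (EuclideanSpace ℝ (Fin dβ))) (hK : IsCompact K) (hβsK : βs ∈ interior K)
    (hK_pos : 0 < ⨅ β : K, lambdaMin (meanMat P fun d => outer (g (β : EuclideanSpace ℝ _) d)))
    -- the algorithm: `S n ω` is the terminal state `(β_n, Φ_n, W_n, β̄_n)` with sample size `n`
    (S : ℕ → Ω₀ → State dβ dg)
    (hS : ∀ n ω, S n ω = sgmm n0 (fun i => γ0 * (i : ℝ) ^ (-a))
      (init η0 (fun j => D0 j ω) (b0 ω)) (fun i => D i ω) (n1 n) n) :
    -- the limiting variance is well defined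
    (varg P βs).PosDef ∧
    ((Gpop P).transpose * (varg P βs)⁻¹ * Gpop P).PosDef ∧
    -- weak consistency
    TendstoInMeasure μ (fun n ω => (S n ω).β) atTop (fun _ => βs) ∧
    TendstoInMeasure μ (fun n ω => (S n ω).βbar) atTop (fun _ => βs) ∧
    -- asymptotic normality with the efficient variance
    TendstoInDistribution (fun (n : ℕ) ω => √(n : ℝ) • ((S n ω).βbar - βs)) atTop
      (id : EuclideanSpace ℝ (Fin dβ) → EuclideanSpace ℝ (Fin dβ)) (fun _ => μ)
      (multivariateGaussian 0 ((Gpop P).transpose * (varg P βs)⁻¹ * Gpop P)⁻¹) := by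
  have hherm {p : ℕ} (f : Obs dβ dg → EuclideanSpace ℝ (Fin p)) :
      (meanMat P fun d => outer (f d)).IsHermitian := by
    ext k l
    simp [meanMat, outer, Matrix.vecMulVec_apply, mul_comm]
  have hmean : ∫ d, g βs d ∂P = 0 := (hβs βs).2 rfl
  have hsample : IsSample μ P D0 D := ⟨hD0_meas, hD_meas, hD0_law, hD_law, h_indep⟩
  have := hsample.isProbabilityMeasure
  have hΩ : (varg P βs).PosDef := by
    rw [← meanMat_outer_g hg2 hmean]
    refine posDef_of_lambdaMin_pos (hherm (g βs)) (hK_pos.trans_le ?_)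
    -- A real infimum over a family unbounded below is `0` by convention, so its positivity already
    -- forces a lower bound.
    have hbdd : BddBelow (Set.range fun β : K =>
        lambdaMin (meanMat P fun d => outer (g (β : EuclideanSpace ℝ _) d))) := by
      by_contra hcon
      rw [Real.iInf_of_not_bddBelow hcon] at hK_pos
      exact lt_irrefl _ hK_pos
    exact ciInf_le hbdd ⟨βs, interior_subset hβsK⟩
  have hGG : ((Gpop P).transpose * Gpop P).PosDef :=
    posDef_of_lambdaMin_pos (by simpa using Matrix.isHermitian_conjTranspose_mul_self (Gpop P)) hG
  have h : IsModel μ P D0 D βs η0 b0 :=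
    ⟨hsample, hn0, h_zz, hGG, posDef_of_lambdaMin_pos (hherm Obs.z) hQ, hΩ, hmean, hG2, hg2, hη0,
      hW0, hb0⟩
  have ha0 : 0 < a := lt_trans (by norm_num) ha.1
  have hSrun (n : ℕ) (ω : Ω₀) :
      S n ω = run D0 D η0 b0 (fun i => γ0 * (i : ℝ) ^ (-a)) (n1 n) n ω := hS n ω
  have hw := h.isWarmup hγ0 ha0 ha.2 hn1
  simp only [hSrun]
  refine ⟨hΩ, transpose_mul_mul_posDef hΩ.inv hGG, ?_, ?_,
    h.tendstoInDistribution_βbar hγ0 ha0 ha.2 hn1 hn1n⟩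
  · rw [tendstoInMeasure_iff_norm]
    simpa [tendstoInMeasure_iff_norm] using h.tendstoInMeasure_β hγ0 ha0 ha.2 hw
  · rw [tendstoInMeasure_iff_norm]
    simpa [tendstoInMeasure_iff_norm] using h.tendstoInMeasure_βbar hγ0 ha0 ha.2 hw
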